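/- **Setting.** A smooth planar path $P(\theta)=(x_P(\theta),y_P(\theta))$ is parametrised by arc length, with tangent angle $\gamma(\theta)$ (so $x_P'=\cos\gamma$, $y_P'=\sin\gamma$) and curvature $\kappa=\gamma'$; $|\kappa|\le\kappa_{\max}$ and $\kappa'$ is bounded. The vessel in a constant unknown current $(V_x,V_y)$, $\sqrt{V_x^2+V_y^2}\le V_{\max}$, $V_{\max}>0$, is $$\dot x=u_r\cos\psi-v_r\sin\psi+V_x,\quad \dot y=u_r\sin\psi+v_r\cos\psi+V_y,\quad \dot\psi=r,$$ $$\dot u_r=F_u(v_r,r)-\tfrac{d_{11}}{m_{11}}u_r+\tau_u,\quad \dot v_r=X(u_r)r+Y(u_r)v_r,\quad \dot r=F_r(u_r,v_r,r)+\tau_r,$$ where, with $D=m_{22}m_{33}-m_{23}^2$, $F_u=\frac1{m_{11}}(m_{22}v_r+m_{23}r)r$, $X(u)=\frac{m_{23}^2-m_{11}m_{33}}{D}u+\frac{d_{33}m_{23}-d_{23}m_{33}}{D}$, $Y(u)=\frac{(m_{22}-m_{11})m_{23}}{D}u-\frac{d_{22}m_{33}-d_{32}m_{23}}{D}$, $F_r=\frac{m_{23}d_{22}-m_{22}(d_{32}+(m_{22}-m_{11})u_r)}{D}v_r+\frac{m_{23}(d_{23}+m_{11}u_r)-m_{22}(d_{33}+m_{23}u_r)}{D}r$;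 $m_{11},m_{22},D>0$, $d_{11}\ge0$. The desired surge velocity $u_{rd}(t)$ is $C^2$, and for $t\ge t_0$ it is bounded with bounded first and second derivative and satisfies $2V_{\max}<u_{rd}(t)$. All gains below and $\Delta$ are positive. Write $\tilde u=u_r-u_{rd}$, $u_t=\sqrt{u_r^2+v_r^2}$, $u_{td}=\sqrt{u_{rd}^2+v_r^2}$, and $\beta$ for the polar angle of $(u_r,v_r)$. The path errors are $x_{b/p}=\cos\gamma\,(x-x_P)+\sin\gamma\,(y-y_P)$ and $y_{b/p}=-\sin\gamma\,(x-x_P)+\cos\gamma\,(y-y_P)$. *Observer:* $\dot{\hat x}=u_r\cos\psi-v_r\sin\psi+\hat V_x+k_{x_1}\tilde x$, $\dot{\hat y}=u_r\sin\psi+v_r\cos\psi+\hat V_y+k_{y_1}\tilde y$, $\dot{\hat V}_x=k_{x_2}\tilde x$, $\dot{\hat V}_y=k_{y_2}\tilde y$, with $\tilde x=x-\hat x$, $\tilde y=y-\hat y$, $\tilde V_x=V_x-\hat V_x$, $\tilde V_y=V_y-\hat V_y$; put $\hat V_T=\hat V_x\cos\gamma+\hat V_y\sin\gamma$ and $\hat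 V_N=-\hat V_x\sin\gamma+\hat V_y\cos\gamma$. *Update law:* $\dot\theta=\dfrac{u_t\cos(\psi+\beta-\gamma)+\hat V_T+k_\delta x_{b/p}}{1-\kappa y_{b/p}}$. *Surge controller:* $\tau_u=-F_u+\dot u_{rd}+\frac{d_{11}}{m_{11}}u_{rd}-k_u\tilde u$. *Guidance:* with $a=\hat V_N^2-u_{td}^2$, $b=y_{b/p}\hat V_N$, $c=\Delta^2+y_{b/p}^2$, put $g=\hat V_N\frac{b+\sqrt{b^2-ac}}{-a}$ (regarded as a function of $\hat V_N,a,b,c$ when it is differentiated), $\psi_d=\gamma-\arctan\frac{v_r}{u_{rd}}-\arctan\frac{y_{b/p}+g}{\Delta}$, $\tilde\psi=\psi-\psi_d$, $L=\frac{\Delta}{\Delta^2+(y_{b/p}+g)^2}$, $\alpha=\arctan\frac{y_{b/p}+g}\Delta$, $$C_r=1+\frac{X(u_r)u_{rd}}{u_{rd}^2+v_r^2}-\frac{\partial g}{\partial a}\,2v_rX(u_r)\,L,$$ $$\dot y^{\,0}=-\frac{u_{td}\,y_{b/p}}{\sqrt{\Delta^2+(y_{b/p}+g)^2}}+u_{td}(1-\cos\tilde\psi)\sin\alpha+\tilde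 u\sin(\psi-\gamma)+u_{td}\cos\alpha\sin\tilde\psi-x_{b/p}\kappa\dot\theta,$$ $$r_d=-\frac1{C_r}\Big[-\kappa\dot\theta+\frac{Y(u_r)v_ru_{rd}-\dot u_{rd}v_r}{u_{rd}^2+v_r^2}+L\Big(\dot{\hat V}_N\tfrac{\partial g}{\partial\hat V_N}+\tfrac{\partial g}{\partial a}\big(2\hat V_N\dot{\hat V}_N-2u_{rd}\dot u_{rd}-2v_r^2Y(u_r)\big)+\tfrac{\partial g}{\partial b}\dot{\hat V}_Ny_{b/p}+\big(1+2y_{b/p}\tfrac{\partial g}{\partial c}+\hat V_N\tfrac{\partial g}{\partial b}\big)\dot y^{\,0}\Big)\Big],$$ a function of $\xi=(\theta,v_r,u_r,u_{rd},\dot u_{rd},\hat V_T,\hat V_N,y_{b/p},x_{b/p},\tilde\psi,\tilde x,\tilde y)$; in it $\dot\theta$ and $\dot{\hat V}_N$ are given by the laws above, and $\psi-\gamma$ is expressed through $\tilde\psi$. Put $\tilde r=r-r_d$. *Yaw controller:* $\tau_r=-F_r+\sum_i\frac{\partial r_d}{\partial\xi_i}\eta_i-k_1\tilde r-k_2C_r\tilde\psi$,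 where $\eta=(\dot\theta,\dot v_r,\dot u_r,\dot u_{rd},\ddot u_{rd},\dot{\hat V}_T,\dot{\hat V}_N,\dot y^{\,0},-k_\delta x_{b/p},C_r\tilde r,-k_{x_1}\tilde x,-k_{y_1}\tilde y)$ is the known part of $\dot\xi$. **Hypotheses.** There are constants $Y_{\min},X_{\max},\sigma,c_r>0$ such that for $t\ge t_0$: $Y(u)\le-Y_{\min}$ for all $u\in[-V_{\max},u_{rd}(t)]$ and $|X(u_{rd}(t))|\le X_{\max}$; moreover $$\kappa_{\max}<\frac{Y_{\min}}{X_{\max}},\qquad \kappa_{\max}<\sigma\frac{Y_{\min}}{X_{\max}},\qquad Y_{\min}-\frac{X_{\max}\kappa_{\max}}\sigma>0,\qquad \Delta>\frac{4X_{\max}}{Y_{\min}-X_{\max}\kappa_{\max}/\sigma}.$$ Consider closed-loop solutions on intervals $[t_0,T)$, $t_0<T\le\infty$, on which $1-\kappa(\theta)y_{b/p}\ge\sigma$ (the tube) and $|C_r|\ge c_r$, and whose observer error at $t_0$ satisfies $$\max(k_{x_2},k_{y_2})\Big(\tilde x^2+\tilde y^2+\frac{\tilde V_x^2}{k_{x_2}}+\frac{\tilde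 V_y^2}{k_{y_2}}\Big)\le V_{\max}^2$$ (for $k_{x_2}=k_{y_2}$ this includes the start $\hat x=x$, $\hat y=y$, $\hat V_x=\hat V_y=0$). Let $e=(x_{b/p},y_{b/p},\tilde\psi,\tilde r,\tilde u,\tilde x,\tilde y,\tilde V_x,\tilde V_y)$. **Theorem.** For these solutions: 1. (Forward completeness.) If $T<\infty$, the solution can be continued as a closed-loop solution, with $1-\kappa y_{b/p}\ne0$ and $C_r\neq0$, beyond $T$. 2. (Path following.) If $T=\infty$, the distance between $(x,y)$ and $P(\theta)$ tends to $0$. 3. (Boundedness.) $v_r$, $\tau_r$ and $\tau_u$ are bounded on $[t_0,T)$; for every $R>0$ the bound is uniform over all solutions with $|e(t_0)|\le R$ and $|v_r(t_0)|\le R$. 4. (Stability of $e=0$.) The origin of the error system is globally asymptotically stable: for all $R,\varepsilon>0$ there is $\delta>0$ such that $|v_r(t_0)|\le R$ and $|e(t_0)|<\delta$ imply $|e(t)|<\varepsilon$ on $[t_0,T)$, and $e(t)\to0$ for every solution with $T=\infty$. It is locally exponentially stable: for every $R>0$ there are $\rho,C,\lambda>0$ such that $|v_r(t_0)|\le R$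 and $|e(t_0)|\le\rho$ imply $|e(t)|\le C|e(t_0)|e^{-\lambda(t-t_0)}$ on $[t_0,T)$. It is exponentially stable in the tube: for all $R,\rho>0$ there are $C,\lambda>0$ such that $|v_r(t_0)|\le R$ and $|e(t_0)|\le\rho$ imply $|e(t)|\le C|e(t_0)|e^{-\lambda(t-t_0)}$ on $[t_0,T)$. -/

import Mathlib

open scoped ContDiff

noncomputable section

namespace PathFollowing

/-! ## Known data: vessel, path, gains -/

/-- Coefficients of the three degree-of-freedom manoeuvring model. The inertia matrix
`[[m11, 0, 0], [0, m22, m23], [0, m23, m33]]` is positive definite. -/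
structure Vessel where
  m11 : ℝ
  m22 : ℝ
  m23 : ℝ
  m33 : ℝ
  d11 : ℝ
  d22 : ℝ
  d23 : ℝ
  d32 : ℝ
  d33 : ℝ
  m11_pos : 0 < m11
  m22_pos : 0 < m22
  det_pos : 0 < m22 * m33 - m23 ^ 2
  d11_nonneg : 0 ≤ d11

namespace Vessel

variable (w : Vessel)

/-- The determinant of the sway-yaw block of the inertia matrix. -/
def det : ℝ := w.m22 * w.m33 - w.m23 ^ 2

/-- `F_{u_r}(v_r, r)`. -/
def Fu (v r : ℝ) : ℝ := 1 / w.m11 * (w.m22 * v + w.m23 * r) * r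

/-- `X(u_r)`. -/
def X (u : ℝ) : ℝ :=
  (w.m23 ^ 2 - w.m11 * w.m33) / w.det * u + (w.d33 * w.m23 - w.d23 * w.m33) / w.det

/-- `Y(u_r)`. -/
def Y (u : ℝ) : ℝ :=
  (w.m22 - w.m11) * w.m23 / w.det * u - (w.d22 * w.m33 - w.d32 * w.m23) / w.det

/-- `F_r(u_r, v_r, r)`. -/
def Fr (u v r : ℝ) : ℝ :=
  (w.m23 * w.d22 - w.m22 * (w.d32 + (w.m22 - w.m11) * u)) / w.det * v
    + (w.m23 * (w.d23 + w.m11 * u) - w.m22 * (w.d33 + w.m23 * u)) / w.det * r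

end Vessel

/-- A smooth planar path `θ ↦ (xP θ, yP θ)` with tangent angle `γ`; the path variable `θ` is the
arc length, so that the path-tangential frame moves with speed `dθ/dt` along its tangent. -/
structure PlanarPath where
  xP : ℝ → ℝ
  yP : ℝ → ℝ
  γ : ℝ → ℝ
  smooth_γ : ContDiff ℝ ∞ γ
  hasDerivAt_xP : ∀ θ, HasDerivAt xP (Real.cos (γ θ)) θ
  hasDerivAt_yP : ∀ θ, HasDerivAt yP (Real.sin (γ θ)) θ

/-- The signed curvature, the derivative of the tangent angle with respect to arc length. -/
def PlanarPath.κ (P : PlanarPath) : ℝ → ℝ := deriv P.γ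

/-- Gains of the controllers, of the observer and of the update law, and the look-ahead
distance `Δ`. -/
structure Gains where
  ku : ℝ
  k1 : ℝ
  k2 : ℝ
  kx1 : ℝ
  kx2 : ℝ
  ky1 : ℝ
  ky2 : ℝ
  kδ : ℝ
  Δ : ℝ
  ku_pos : 0 < ku
  k1_pos : 0 < k1
  k2_pos : 0 < k2
  kx1_pos : 0 < kx1
  kx2_pos : 0 < kx2
  ky1_pos : 0 < ky1
  ky2_pos : 0 < ky2
  kδ_pos : 0 < kδ
  Δ_pos : 0 < Δ

/-- Everything the controller knows beforehand. -/
structure Design where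
  w : Vessel
  P : PlanarPath
  k : Gains

/-! ## Speeds and angles -/

/-- Total relative speed `u_t` of a vessel with surge `u` and sway `v` (for `u = u_rd` this is
`u_td`). -/
def ut (u v : ℝ) : ℝ := √(u ^ 2 + v ^ 2)

/-- Side-slip angle `β`, the polar angle of `(u, v)`; the course angle is `χ = ψ + β`. -/
def sideslip (u v : ℝ) : ℝ := Complex.arg (⟨u, v⟩ : ℂ)

/-! ## The current-compensating term `g` of the guidance law

`v` is the sway velocity, `q` the desired surge velocity `u_rd`, `N` the estimate of the normal
current component and `y` the normal path error. -/

def ga (v q N : ℝ) : ℝ := N ^ 2 - (q ^ 2 + v ^ 2)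

def gb (N y : ℝ) : ℝ := y * N

def gc (Δ y : ℝ) : ℝ := Δ ^ 2 + y ^ 2

/-- `g` as a function of `N, a, b, c`. -/
def gOf (N a b c : ℝ) : ℝ := N * ((b + √(b ^ 2 - a * c)) / (-a))

/-- The factor `(b + √(b² - ac)) / (-a) = ∂g/∂N`. -/
def gS (a b c : ℝ) : ℝ := (b + √(b ^ 2 - a * c)) / (-a)

/-- `∂g/∂a`. -/
def gDa (N a b c : ℝ) : ℝ :=
  N * (c / (2 * a * √(b ^ 2 - a * c))) + N * ((b + √(b ^ 2 - a * c)) / a ^ 2)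

/-- `∂g/∂b`. -/
def gDb (N a b c : ℝ) : ℝ :=
  N * ((b + √(b ^ 2 - a * c)) / (-a * √(b ^ 2 - a * c)))

/-- `∂g/∂c`. -/
def gDc (N a b c : ℝ) : ℝ := N * (1 / (2 * √(b ^ 2 - a * c)))

theorem hasDerivAt_gOf_a {N a b c : ℝ} (ha : a ≠ 0) (h : 0 < b ^ 2 - a * c) :
    HasDerivAt (fun s => gOf N s b c) (gDa N a b c) a := by
  have hs : √(b ^ 2 - a * c) ≠ 0 := (Real.sqrt_pos.2 h).ne'
  have h1 : HasDerivAt (fun s : ℝ => b ^ 2 - s * c) (-c) a := by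
    simpa using ((hasDerivAt_id a).mul_const c).const_sub (b ^ 2)
  have h2 := ((h1.sqrt h.ne').const_add b).div (hasDerivAt_id a).neg (by simpa using ha)
  refine (h2.const_mul N).congr_deriv ?_
  simp only [gDa, id, Pi.neg_apply]
  field_simp
  ring

theorem hasDerivAt_gOf_b {N a b c : ℝ} (h : 0 < b ^ 2 - a * c) :
    HasDerivAt (fun s => gOf N a s c) (gDb N a b c) b := by
  have hs : √(b ^ 2 - a * c) ≠ 0 := (Real.sqrt_pos.2 h).ne'
  have h1 : HasDerivAt (fun s : ℝ => s ^ 2 - a * c) (2 * b) b := by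
    simpa using (hasDerivAt_pow 2 b).sub_const (a * c)
  have h2 := ((hasDerivAt_id b).add (h1.sqrt h.ne')).div_const (-a)
  refine (h2.const_mul N).congr_deriv ?_
  simp only [gDb]
  by_cases ha : a = 0
  · simp [ha]
  · field_simp
    ring

theorem hasDerivAt_gOf_c {N a b c : ℝ} (ha : a ≠ 0) (h : 0 < b ^ 2 - a * c) :
    HasDerivAt (fun s => gOf N a b s) (gDc N a b c) c := by
  have hs : √(b ^ 2 - a * c) ≠ 0 := (Real.sqrt_pos.2 h).ne'
  have h1 : HasDerivAt (fun s : ℝ => b ^ 2 - a * s) (-a) c := by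
    simpa using ((hasDerivAt_id c).const_mul a).const_sub (b ^ 2)
  have h2 := ((h1.sqrt h.ne').const_add b).div_const (-a)
  refine (h2.const_mul N).congr_deriv ?_
  simp only [gDc]
  field_simp

/-- The values of `g` and its partial derivatives in the vessel's variables. -/
def g (Δ v q N y : ℝ) : ℝ := gOf N (ga v q N) (gb N y) (gc Δ y)

def g_N (Δ v q N y : ℝ) : ℝ := gS (ga v q N) (gb N y) (gc Δ y)

def g_a (Δ v q N y : ℝ) : ℝ := gDa N (ga v q N) (gb N y) (gc Δ y)

def g_b (Δ v q N y : ℝ) : ℝ := gDb N (ga v q N) (gb N y) (gc Δ y)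

def g_c (Δ v q N y : ℝ) : ℝ := gDc N (ga v q N) (gb N y) (gc Δ y)

/-- The line-of-sight angle `atan ((y + g) / Δ)`. -/
def los (Δ v q N y : ℝ) : ℝ := Real.arctan ((y + g Δ v q N y) / Δ)

/-- `Δ / (Δ² + (y + g)²)`. -/
def losGain (Δ v q N y : ℝ) : ℝ := Δ / (Δ ^ 2 + (y + g Δ v q N y) ^ 2)

/-! ## Desired yaw rate

The arguments are the measured or estimated quantities `θ`, `v = v_r`, `u = u_r`, `q = u_rd`,
`q' = du_rd/dt`, `A` and `N` (estimates of the tangential and of the normal current component),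
`y = y_{b/p}`, `x = x_{b/p}`, `e` (yaw angle error) and `ex`, `ey` (position errors of the
observer). -/

/-- `ψ - γ(θ)` expressed through the yaw angle error `e = ψ - ψ_d`. -/
def relHeading (Δ v q N y e : ℝ) : ℝ := e - Real.arctan (v / q) - los Δ v q N y

/-- Update law of the path variable; `φ = ψ - γ(θ)`. -/
def thetaDot (D : Design) (θ v u A y x φ : ℝ) : ℝ :=
  (ut u v * Real.cos (φ + sideslip u v) + A + D.k.kδ * x) / (1 - D.P.κ θ * y)

/-- Time derivative of the estimate of the tangential current component;
`s` is the value of `dθ/dt`. -/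
def VTdot (D : Design) (θ N ex ey s : ℝ) : ℝ :=
  D.k.kx2 * ex * Real.cos (D.P.γ θ) + D.k.ky2 * ey * Real.sin (D.P.γ θ) + D.P.κ θ * s * N

/-- Time derivative of the estimate of the normal current component;
`s` is the value of `dθ/dt`. -/
def VNdot (D : Design) (θ A ex ey s : ℝ) : ℝ :=
  -(D.k.kx2 * ex) * Real.sin (D.P.γ θ) + D.k.ky2 * ey * Real.cos (D.P.γ θ) - D.P.κ θ * s * A

/-- The perturbing term `G_1`; `s` is the value of `dθ/dt`. -/
def G1 (D : Design) (θ v u q N y x e s : ℝ) : ℝ :=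
  ut q v * (1 - Real.cos e) * Real.sin (los D.k.Δ v q N y)
    + (u - q) * Real.sin (relHeading D.k.Δ v q N y e)
    + ut q v * Real.cos (los D.k.Δ v q N y) * Real.sin e
    - x * (D.P.κ θ * s)

/-- The part of `dy_{b/p}/dt` that does not contain the unknown current error. -/
def yDotKnown (D : Design) (θ v u q N y x e s : ℝ) : ℝ :=
  -ut q v * (y / √(D.k.Δ ^ 2 + (y + g D.k.Δ v q N y) ^ 2)) + G1 D θ v u q N y x e s

/-- `C_r`. -/
def Cr (D : Design) (v u q N y : ℝ) : ℝ :=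
  1 + D.w.X u * q / (q ^ 2 + v ^ 2)
    - g_a D.k.Δ v q N y * (2 * v * D.w.X u) * losGain D.k.Δ v q N y

/-- The desired yaw rate `r_d`. -/
def rd (D : Design) (θ v u q q' A N y x e ex ey : ℝ) : ℝ :=
  let Δ := D.k.Δ
  let s := thetaDot D θ v u A y x (relHeading Δ v q N y e)
  let N' := VNdot D θ A ex ey s
  (-1 / Cr D v u q N y) *
    (-(D.P.κ θ * s)
      + (D.w.Y u * v * q - q' * v) / (q ^ 2 + v ^ 2)
      + losGain Δ v q N y *
        (N' * g_N Δ v q N y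
          + g_a Δ v q N y * (2 * N * N' - 2 * q * q' - 2 * v * (D.w.Y u * v))
          + g_b Δ v q N y * (N' * y)
          + (1 + g_c Δ v q N y * (2 * y) + g_b Δ v q N y * N)
              * yDotKnown D θ v u q N y x e s))

/-- `r_d` as a function on `ℝ¹²`, in order to write its derivative. -/
def rdVec (D : Design) (ξ : Fin 12 → ℝ) : ℝ :=
  rd D (ξ 0) (ξ 1) (ξ 2) (ξ 3) (ξ 4) (ξ 5) (ξ 6) (ξ 7) (ξ 8) (ξ 9) (ξ 10) (ξ 11)

/-! ## State of vessel, observer and path variable, and derived quantities -/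

/-- Position `(x, y)`, heading `ψ`, relative surge and sway velocities `u, v`, yaw rate `r`,
observer states `xh, yh, Vxh, Vyh` and path variable `θ`. -/
structure State where
  x : ℝ
  y : ℝ
  ψ : ℝ
  u : ℝ
  v : ℝ
  r : ℝ
  xh : ℝ
  yh : ℝ
  Vxh : ℝ
  Vyh : ℝ
  θ : ℝ

namespace State

variable (z : State) (D : Design) (q q' : ℝ)

/-- Tangential path-following error `x_{b/p}`. -/
def xbp : ℝ :=
  Real.cos (D.P.γ z.θ) * (z.x - D.P.xP z.θ) + Real.sin (D.P.γ z.θ) * (z.y - D.P.yP z.θ)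

/-- Normal path-following error `y_{b/p}`. -/
def ybp : ℝ :=
  -Real.sin (D.P.γ z.θ) * (z.x - D.P.xP z.θ) + Real.cos (D.P.γ z.θ) * (z.y - D.P.yP z.θ)

/-- Estimate of the tangential current component. -/
def VT : ℝ := z.Vxh * Real.cos (D.P.γ z.θ) + z.Vyh * Real.sin (D.P.γ z.θ)

/-- Estimate of the normal current component. -/
def VN : ℝ := -z.Vxh * Real.sin (D.P.γ z.θ) + z.Vyh * Real.cos (D.P.γ z.θ)

/-- Position errors of the observer. -/
def ex : ℝ := z.x - z.xh

def ey : ℝ := z.y - z.yh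

/-- Desired heading (guidance law); `q` is the current value of `u_rd`. -/
def psiD : ℝ :=
  D.P.γ z.θ - Real.arctan (z.v / q) - los D.k.Δ z.v q (z.VN D) (z.ybp D)

/-- Yaw angle error. -/
def ePsi : ℝ := z.ψ - z.psiD D q

/-- Current value of `dθ/dt`. -/
def thetaRate : ℝ :=
  thetaDot D z.θ z.v z.u (z.VT D) (z.ybp D) (z.xbp D) (z.ψ - D.P.γ z.θ)

/-- Current value of `C_r`. -/
def CrVal : ℝ := Cr D z.v z.u q (z.VN D) (z.ybp D)

/-- The arguments of `r_d`; `q'` is the current value of `du_rd/dt`. -/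
def rdArg : Fin 12 → ℝ :=
  ![z.θ, z.v, z.u, q, q', z.VT D, z.VN D, z.ybp D, z.xbp D, z.ePsi D q, z.ex, z.ey]

/-- Yaw rate error. -/
def eR : ℝ := z.r - rdVec D (z.rdArg D q q')

/-- Surge control law. -/
def tauU : ℝ :=
  -D.w.Fu z.v z.r + q' + D.w.d11 / D.w.m11 * q - D.k.ku * (z.u - q)

/-- Right-hand sides of the surge and of the sway equation. -/
def uRate : ℝ := D.w.Fu z.v z.r - D.w.d11 / D.w.m11 * z.u + z.tauU D q q'

def vRate : ℝ := D.w.X z.u * z.r + D.w.Y z.u * z.v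

/-- The known part of the time derivative of `rdArg`, i.e. without the current estimation errors;
`q''` is the current value of `d²u_rd/dt²`. -/
def rdArgRate (q'' : ℝ) : Fin 12 → ℝ :=
  ![z.thetaRate D, z.vRate D, z.uRate D q q', q', q'',
    VTdot D z.θ (z.VN D) z.ex z.ey (z.thetaRate D),
    VNdot D z.θ (z.VT D) z.ex z.ey (z.thetaRate D),
    yDotKnown D z.θ z.v z.u q (z.VN D) (z.ybp D) (z.xbp D) (z.ePsi D q) (z.thetaRate D),
    -D.k.kδ * z.xbp D,
    z.CrVal D q * z.eR D q q',
    -D.k.kx1 * z.ex,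
    -D.k.ky1 * z.ey]

/-- Yaw control law. The `fderiv` term is the sum of all partial derivatives of `r_d`, each times
the known part of the time derivative of its argument. -/
def tauR (q'' : ℝ) : ℝ :=
  -D.w.Fr z.u z.v z.r
    + fderiv ℝ (rdVec D) (z.rdArg D q q') (z.rdArgRate D q q' q'')
    - D.k.k1 * z.eR D q q' - D.k.k2 * z.CrVal D q * z.ePsi D q

/-- Euclidean norm of the error vector
`(x_{b/p}, y_{b/p}, yaw angle error, yaw rate error, surge error, observer errors)`;
`Vx, Vy` is the true current. -/
def errNorm (Vx Vy : ℝ) : ℝ :=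
  √(z.xbp D ^ 2 + z.ybp D ^ 2 + z.ePsi D q ^ 2 + z.eR D q q' ^ 2 + (z.u - q) ^ 2
    + z.ex ^ 2 + z.ey ^ 2 + (Vx - z.Vxh) ^ 2 + (Vy - z.Vyh) ^ 2)

end State

/-! ## Closed loop -/

/-- The time interval `[t₀, T)`, where `T = ⊤` is allowed. -/
def timeInterval (t₀ : ℝ) (T : EReal) : Set ℝ := {t | t₀ ≤ t ∧ (t : EReal) < T}

/-- `z` is a solution on `[t₀, T)` of the vessel model in the constant current `(Vx, Vy)`, in
closed loop with the surge and yaw controllers, the current observer and the update law, for the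
desired surge velocity `urd`; along it the update law (`1 - κ y_{b/p} ≠ 0`) and the yaw controller
(`C_r ≠ 0`) are well defined. -/
structure IsSolution (D : Design) (Vx Vy : ℝ) (urd : ℝ → ℝ) (t₀ : ℝ) (T : EReal)
    (z : ℝ → State) : Prop where
  lt : (t₀ : EReal) < T
  curv_ne : ∀ t ∈ timeInterval t₀ T, 1 - D.P.κ (z t).θ * (z t).ybp D ≠ 0
  Cr_ne : ∀ t ∈ timeInterval t₀ T, (z t).CrVal D (urd t) ≠ 0
  x_eq : ∀ t ∈ timeInterval t₀ T, HasDerivWithinAt (fun τ => (z τ).x)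
    ((z t).u * Real.cos (z t).ψ - (z t).v * Real.sin (z t).ψ + Vx) (timeInterval t₀ T) t
  y_eq : ∀ t ∈ timeInterval t₀ T, HasDerivWithinAt (fun τ => (z τ).y)
    ((z t).u * Real.sin (z t).ψ + (z t).v * Real.cos (z t).ψ + Vy) (timeInterval t₀ T) t
  ψ_eq : ∀ t ∈ timeInterval t₀ T, HasDerivWithinAt (fun τ => (z τ).ψ)
    ((z t).r) (timeInterval t₀ T) t
  u_eq : ∀ t ∈ timeInterval t₀ T, HasDerivWithinAt (fun τ => (z τ).u)
    (D.w.Fu (z t).v (z t).r - D.w.d11 / D.w.m11 * (z t).u + (z t).tauU D (urd t) (deriv urd t))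
    (timeInterval t₀ T) t
  v_eq : ∀ t ∈ timeInterval t₀ T, HasDerivWithinAt (fun τ => (z τ).v)
    (D.w.X (z t).u * (z t).r + D.w.Y (z t).u * (z t).v) (timeInterval t₀ T) t
  r_eq : ∀ t ∈ timeInterval t₀ T, HasDerivWithinAt (fun τ => (z τ).r)
    (D.w.Fr (z t).u (z t).v (z t).r
      + (z t).tauR D (urd t) (deriv urd t) (deriv (deriv urd) t)) (timeInterval t₀ T) t
  xh_eq : ∀ t ∈ timeInterval t₀ T, HasDerivWithinAt (fun τ => (z τ).xh)
    ((z t).u * Real.cos (z t).ψ - (z t).v * Real.sin (z t).ψ + (z t).Vxh + D.k.kx1 * (z t).ex)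
    (timeInterval t₀ T) t
  yh_eq : ∀ t ∈ timeInterval t₀ T, HasDerivWithinAt (fun τ => (z τ).yh)
    ((z t).u * Real.sin (z t).ψ + (z t).v * Real.cos (z t).ψ + (z t).Vyh + D.k.ky1 * (z t).ey)
    (timeInterval t₀ T) t
  Vxh_eq : ∀ t ∈ timeInterval t₀ T, HasDerivWithinAt (fun τ => (z τ).Vxh)
    (D.k.kx2 * (z t).ex) (timeInterval t₀ T) t
  Vyh_eq : ∀ t ∈ timeInterval t₀ T, HasDerivWithinAt (fun τ => (z τ).Vyh)
    (D.k.ky2 * (z t).ey) (timeInterval t₀ T) t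
  θ_eq : ∀ t ∈ timeInterval t₀ T, HasDerivWithinAt (fun τ => (z τ).θ)
    ((z t).thetaRate D) (timeInterval t₀ T) t

/-- Solutions that stay in the tube `1 - κ y_{b/p} ≥ σ`, along which `C_r` stays away from zero,
and whose observer starts with an admissible error. When `kx2 = ky2`, the last condition holds for
the initialisation `xh = x`, `yh = y`, `Vxh = Vyh = 0` in every current of size at most `Vmax`. -/
structure InTube (D : Design) (Vx Vy Vmax : ℝ) (urd : ℝ → ℝ) (σ cr : ℝ) (t₀ : ℝ) (T : EReal)
    (z : ℝ → State) : Prop where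
  sol : IsSolution D Vx Vy urd t₀ T z
  tube : ∀ t ∈ timeInterval t₀ T, σ ≤ 1 - D.P.κ (z t).θ * (z t).ybp D
  Cr_away : ∀ t ∈ timeInterval t₀ T, cr ≤ |(z t).CrVal D (urd t)|
  observer_init : max D.k.kx2 D.k.ky2 *
    ((z t₀).ex ^ 2 + (z t₀).ey ^ 2 + (Vx - (z t₀).Vxh) ^ 2 / D.k.kx2
      + (Vy - (z t₀).Vyh) ^ 2 / D.k.ky2) ≤ Vmax ^ 2

/-! ## Stability notions

`F T z` says that `z` is one of the considered solutions on `[t₀, T)`, and `err t s` is the norm of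
the error at time `t` in the state `s`. The sway velocity is not an error variable: its initial
value ranges over an arbitrary bounded set. -/

section Stability

variable (F : EReal → (ℝ → State) → Prop) (err : ℝ → State → ℝ) (t₀ : ℝ)

/-- Lyapunov stability of the zero error. -/
def StableOrigin : Prop :=
  ∀ R > 0, ∀ ε > 0, ∃ δ > 0, ∀ T z, F T z → |(z t₀).v| ≤ R → err t₀ (z t₀) < δ →
    ∀ t ∈ timeInterval t₀ T, err t (z t) < ε

/-- The error of every considered solution tends to zero. -/
def AttractiveOrigin : Prop :=
  ∀ z, F ⊤ z → Filter.Tendsto (fun t => err t (z t)) Filter.atTop (nhds 0)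

/-- Global asymptotic stability of the zero error. -/
def GloballyAsymptoticallyStable : Prop :=
  StableOrigin F err t₀ ∧ AttractiveOrigin F err

/-- An exponential estimate for all initial errors of norm at most `ρ` and all initial sway
velocities of modulus at most `R`. -/
def ExpEstimate (R ρ : ℝ) : Prop :=
  ∃ C > 0, ∃ rate > 0, ∀ T z, F T z → |(z t₀).v| ≤ R → err t₀ (z t₀) ≤ ρ →
    ∀ t ∈ timeInterval t₀ T,
      err t (z t) ≤ C * err t₀ (z t₀) * Real.exp (-rate * (t - t₀))

/-- Local exponential stability of the zero error. -/
def LocallyExponentiallyStable : Prop :=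
  ∀ R > 0, ∃ ρ > 0, ExpEstimate F err t₀ R ρ

/-- Exponential stability of the zero error on the whole region covered by `F`, with constants
that depend on a bound for the initial data. -/
def ExponentiallyStable : Prop :=
  ∀ R > 0, ∀ ρ > 0, ExpEstimate F err t₀ R ρ

/-- The quantity `f` is bounded along the considered solutions, uniformly for bounded
initial data. -/
def BoundedAlong (f : ℝ → State → ℝ) : Prop :=
  ∀ R > 0, ∃ B, ∀ T z, F T z → |(z t₀).v| ≤ R → err t₀ (z t₀) ≤ R →
    ∀ t ∈ timeInterval t₀ T, |f t (z t)| ≤ B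

end Stability

end PathFollowing

end

open PathFollowing

noncomputable section

namespace PathFollowing

/-! ## Differential inequalities -/

/-! The closed loop is a cascade, and the errors are estimated in the order in which they drive each
other. The observer error solves a linear autonomous system, the surge error a scalar linear
equation, and the update law for `θ` turns the tangential error into `x' = -kδ x` plus an observer
error. These components decay exponentially whatever the sway velocity does (`Setting.fast_decay`).
The observer estimate also keeps the normal current estimate below `δ u_rd` with a fixed `δ < 1`
(`Setting.exists_gap`), so that the square root in `g` never degenerates.

The yaw errors satisfy `p' = C_r r + d₁`, `r' = -k₁ r - k₂ C_r p + d₂`, where `d₁` and `d₂` are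
linear in the observer error. Since `|C_r|` stays away from zero, `C_r` has a constant sign, and a
quadratic form with a small cross term of that sign is a strict Lyapunov function (`exists_oscW`).
The obstacle is that `d₂` contains the derivative of `r_d`, which may grow linearly in the sway
velocity `v`, while `v` is itself driven by `r_d`. The core of the proof is therefore a growth
analysis of `r_d`, uniform in `v` and in the normal error `y`, neither of which is bounded
beforehand: the slope of `r_d` in `|v|` is at most `κmax/σ + 1/Δ` up to a multiple of the decaying
tangential error (`LineBounds.exists_rdVec_le`), and its directional derivatives are of order `u_td`
(`LineBounds.exists_fderiv_rdVec_le`).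

These bounds rest on a closed form of the guidance law. With `n` the normal current estimate divided
by `u_td`, the sine and cosine of the line-of-sight angle are algebraic in `y`, `n` and one square
root (`Regular.gI_identity`), and `r_d` becomes an expression in which the order in `u_td` can be
read off term by term. The calculus of `Tame` families does this for values and derivatives at once.

The hypotheses on curvature and look-ahead distance make the sway damping exceed `Xmax (κmax/σ +
1/Δ)`. Hence the sum `V` of `v²` and a multiple of the yaw Lyapunov function satisfies `V' ≤ (-c + C
e^{-μt}) V + K` and is bounded (`Setting.sway_bounded`): every destabilising term that grows with
`v` carries an exponentially decaying factor. With `v` bounded the yaw errors decay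
(`Setting.yaw_decay`). The normal error is damped at a rate at least `a/√(Δ² + y²)` and driven by a
decaying forcing, so it is first bounded and then decays exponentially (`sq_decay_of_los`,
`Setting.ybp_decay`). The resulting estimate `Setting.exp_estimate` contains all stability claims.

For forward completeness, all velocities are bounded, so the solution has a limit at a finite end
time. The limit inherits the closed conditions that make the control law regular, and
Picard–Lindelöf continues the solution (`Setting.forward_complete`). -/

theorem two_mul_le_young {η : ℝ} (hη : 0 < η) (x y : ℝ) : 2 * x * y ≤ η * x ^ 2 + y ^ 2 / η := by
  have h : 0 ≤ (η * x - y) ^ 2 / η := by positivity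
  have h2 : (η * x - y) ^ 2 / η = η * x ^ 2 - 2 * x * y + y ^ 2 / η := by
    field_simp
    ring
  linarith

theorem left_mem_timeInterval {t₀ : ℝ} {T : EReal} (h : (t₀ : EReal) < T) :
    t₀ ∈ timeInterval t₀ T := ⟨le_rfl, h⟩

theorem Icc_subset_timeInterval {t₀ t : ℝ} {T : EReal} (ht : t ∈ timeInterval t₀ T) :
    Set.Icc t₀ t ⊆ timeInterval t₀ T := fun _ hs =>
  ⟨hs.1, (EReal.coe_le_coe_iff.2 hs.2).trans_lt ht.2⟩

theorem le_initial_of_deriv_nonpos {t₀ : ℝ} {T : EReal} {f f' : ℝ → ℝ}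
    (hf : ∀ t ∈ timeInterval t₀ T, HasDerivWithinAt f (f' t) (timeInterval t₀ T) t)
    (h : ∀ t ∈ timeInterval t₀ T, f' t ≤ 0) {t : ℝ} (ht : t ∈ timeInterval t₀ T) :
    f t ≤ f t₀ := by
  have hsub := Icc_subset_timeInterval ht
  refine antitoneOn_of_hasDerivWithinAt_nonpos (f' := f') (convex_Icc t₀ t)
    (fun s hs => ((hf s (hsub hs)).mono hsub).continuousWithinAt) (fun s hs => ?_)
    (fun s hs => ?_) (Set.left_mem_Icc.2 ht.1) (Set.right_mem_Icc.2 ht.1) ht.1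
  · exact (hf s (hsub (interior_subset hs))).mono (interior_subset.trans hsub)
  · exact h s (hsub (interior_subset hs))

theorem hasDerivWithinAt_exp_shift (c t₀ t : ℝ) (s : Set ℝ) :
    HasDerivWithinAt (fun τ => Real.exp (c * (τ - t₀))) (c * Real.exp (c * (t - t₀))) s t := by
  have h : HasDerivAt (fun τ : ℝ => c * (τ - t₀)) c t := by
    simpa using ((hasDerivAt_id t).sub_const t₀).const_mul c
  exact (h.exp.congr_deriv (by ring)).hasDerivWithinAt

/-- Exponential decay of a function driven by a faster exponential. -/
theorem exp_decay_of_deriv_le {t₀ : ℝ} {T : EReal} {f f' : ℝ → ℝ} {c μ K : ℝ}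
    (hcμ : c < μ) (hK : 0 ≤ K)
    (hf : ∀ t ∈ timeInterval t₀ T, HasDerivWithinAt f (f' t) (timeInterval t₀ T) t)
    (h : ∀ t ∈ timeInterval t₀ T, f' t ≤ -c * f t + K * Real.exp (-μ * (t - t₀)))
    {t : ℝ} (ht : t ∈ timeInterval t₀ T) :
    f t ≤ (f t₀ + K / (μ - c)) * Real.exp (-c * (t - t₀)) := by
  have hd : 0 < μ - c := sub_pos.2 hcμ
  -- The second summand has the derivative that cancels the forcing, so the sum is nonincreasing.
  -- The sign of `c` plays no role: `c = 0` gives boundedness under an integrable forcing, which is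
  -- needed later.
  have key := le_initial_of_deriv_nonpos (t₀ := t₀) (T := T)
    (f := fun τ => f τ * Real.exp (c * (τ - t₀)) + K / (μ - c) * Real.exp ((c - μ) * (τ - t₀)))
    (fun τ hτ => ((hf τ hτ).mul (hasDerivWithinAt_exp_shift c t₀ τ _)).add
      ((hasDerivWithinAt_exp_shift (c - μ) t₀ τ _).const_mul (K / (μ - c)))) ?_ ht
  · have h1 : f t * Real.exp (c * (t - t₀)) ≤ f t₀ + K / (μ - c) := by
      have h2 : 0 ≤ K / (μ - c) * Real.exp ((c - μ) * (t - t₀)) := by positivity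
      simp only [sub_self, mul_zero, Real.exp_zero, mul_one] at key
      linarith
    have h3 : f t = f t * Real.exp (c * (t - t₀)) * Real.exp (-c * (t - t₀)) := by
      rw [mul_assoc, ← Real.exp_add]
      simp
    rw [h3]
    gcongr
  · intro τ hτ
    have h1 := h τ hτ
    have hE := Real.exp_pos (c * (τ - t₀))
    have h2 : Real.exp ((c - μ) * (τ - t₀))
        = Real.exp (c * (τ - t₀)) * Real.exp (-μ * (τ - t₀)) := by
      rw [← Real.exp_add]; ring_nf
    have h3 : K / (μ - c) * ((c - μ) * Real.exp ((c - μ) * (τ - t₀)))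
        = -K * Real.exp ((c - μ) * (τ - t₀)) := by
      field_simp
      ring
    rw [h3, h2]
    nlinarith [mul_le_mul_of_nonneg_right h1 hE.le]

/-- Boundedness under a linear differential inequality with an integrable positive part. -/
theorem bounded_of_deriv_le {t₀ : ℝ} {T : EReal} {f f' : ℝ → ℝ} {c μ C K : ℝ}
    (hc : 0 < c) (hμ : 0 < μ) (hC : 0 ≤ C) (hK : 0 ≤ K) (h0 : 0 ≤ f t₀)
    (hf : ∀ t ∈ timeInterval t₀ T, HasDerivWithinAt f (f' t) (timeInterval t₀ T) t)
    (h : ∀ t ∈ timeInterval t₀ T, f' t ≤ (-c + C * Real.exp (-μ * (t - t₀))) * f t + K)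
    {t : ℝ} (ht : t ∈ timeInterval t₀ T) :
    f t ≤ Real.exp (C / μ) * (f t₀ + K / c) := by
  -- Integrating factor of the variable rate. It lies between `exp (c τ)` and `exp (C / μ) * exp (c
  -- τ)`, because the positive part of the rate has integral at most `C / μ`.
  set E : ℝ → ℝ := fun τ => Real.exp (c * (τ - t₀) + C / μ * Real.exp (-μ * (τ - t₀))) with hEdef
  have hE : ∀ τ s, HasDerivWithinAt E ((c - C * Real.exp (-μ * (τ - t₀))) * E τ) s τ := by
    intro τ s
    have h1 : HasDerivAt (fun τ : ℝ => c * (τ - t₀)) c τ := by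
      simpa using ((hasDerivAt_id τ).sub_const t₀).const_mul c
    have h2 := (h1.hasDerivWithinAt (s := s)).add
      ((hasDerivWithinAt_exp_shift (-μ) t₀ τ s).const_mul (C / μ))
    refine h2.exp.congr_deriv ?_
    simp only [hEdef, Pi.add_apply]
    field_simp
    ring
  have hEle : ∀ τ, t₀ ≤ τ → E τ ≤ Real.exp (C / μ) * Real.exp (c * (τ - t₀)) := by
    intro τ hτ
    rw [← Real.exp_add]
    apply Real.exp_le_exp.2
    have h1 : Real.exp (-μ * (τ - t₀)) ≤ 1 := by
      apply Real.exp_le_one_iff.2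
      nlinarith
    have h2 : C / μ * Real.exp (-μ * (τ - t₀)) ≤ C / μ * 1 := by gcongr
    linarith
  have hEge : ∀ τ, Real.exp (c * (τ - t₀)) ≤ E τ := by
    intro τ
    apply Real.exp_le_exp.2
    have : 0 ≤ C / μ * Real.exp (-μ * (τ - t₀)) := by positivity
    linarith
  have key := le_initial_of_deriv_nonpos (t₀ := t₀) (T := T)
    (f := fun τ => f τ * E τ - K * Real.exp (C / μ) / c * Real.exp (c * (τ - t₀)))
    (fun τ hτ => ((hf τ hτ).mul (hE τ _)).sub
      ((hasDerivWithinAt_exp_shift c t₀ τ _).const_mul (K * Real.exp (C / μ) / c))) ?_ ht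
  · simp only [sub_self, mul_zero, Real.exp_zero, mul_one] at key
    have hE0 : E t₀ = Real.exp (C / μ) := by simp [hEdef]
    rw [hE0] at key
    have hx := Real.exp_pos (c * (t - t₀))
    have hx1 : 1 ≤ Real.exp (c * (t - t₀)) := by
      apply Real.one_le_exp
      have := sub_nonneg.2 ht.1
      positivity
    set B := Real.exp (C / μ) * (f t₀ + K / c) with hB
    have hB0 : 0 ≤ B := by positivity
    -- The sign of `f t` is not known, so `E t` can be replaced by its lower bound only after `f t >
    -- B ≥ 0` is supposed.
    by_contra hcon
    push Not at hcon
    have h1 : B * Real.exp (c * (t - t₀)) < f t * E t :=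
      mul_lt_mul hcon (hEge t) hx (hB0.trans hcon.le)
    have h2 : K * Real.exp (C / μ) / c = Real.exp (C / μ) * (K / c) := by ring
    rw [h2] at key
    have h3 : 0 ≤ Real.exp (C / μ) * f t₀ := by positivity
    have h4 := mul_le_mul_of_nonneg_left hx1 h3
    have h5 : 0 ≤ Real.exp (C / μ) * (K / c) := by positivity
    rw [hB, mul_add, add_mul] at h1
    linarith
  · intro τ hτ
    have h1 := mul_le_mul_of_nonneg_right (h τ hτ) (Real.exp_pos
      (c * (τ - t₀) + C / μ * Real.exp (-μ * (τ - t₀)))).le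
    have h2 := mul_le_mul_of_nonneg_left (hEle τ hτ.1) hK
    have h3 : K * Real.exp (C / μ) / c * (c * Real.exp (c * (τ - t₀)))
        = K * (Real.exp (C / μ) * Real.exp (c * (τ - t₀))) := by
      field_simp
    rw [h3]
    change _ ≤ _ * E τ at h1
    change f' τ * E τ ≤ _ at h1
    nlinarith

/-! ## A linear oscillator with a time-varying coupling of constant sign -/

/-- Lyapunov function of the system `p' = c r`, `r' = -k₁ r - k₂ c p`; `s` is the sign of `c`. -/
def oscW (k₂ ε s p r : ℝ) : ℝ := k₂ * p ^ 2 + r ^ 2 + 2 * ε * s * (p * r)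

/-- Without the cross term the derivative controls `r ^ 2` only, since the weights `k₂` and `1` make
the coupling terms cancel. The cross term contributes `-2 * ε * k₂ * (s * c) * p ^ 2`, which is
strictly negative because `s * c ≥ cr`, and its other contributions are small for small `ε`. The
form does not contain `c`, so no bound on the time derivative of the coupling is needed. -/
theorem exists_oscW {k₁ k₂ cr Cm : ℝ} (hk₁ : 0 < k₁) (hk₂ : 0 < k₂) (hcr : 0 < cr)
    (hCm : 0 < Cm) :
    ∃ ε > 0, ∃ rate > 0, ∃ K > 0, ∃ m > 0, ∃ M > 0, ∀ s : ℝ, s ^ 2 = 1 →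
      (∀ p r, m * (p ^ 2 + r ^ 2) ≤ oscW k₂ ε s p r) ∧
      (∀ p r, oscW k₂ ε s p r ≤ M * (p ^ 2 + r ^ 2)) ∧
      ∀ c p r d₁ d₂, cr ≤ s * c → s * c ≤ Cm →
        2 * k₂ * p * (c * r + d₁) + 2 * r * (-k₁ * r - k₂ * c * p + d₂)
          + 2 * ε * s * ((c * r + d₁) * r + p * (-k₁ * r - k₂ * c * p + d₂))
        ≤ -rate * (p ^ 2 + r ^ 2) + K * (d₁ ^ 2 + d₂ ^ 2) := by
  -- `ε * G` is the cost in `r ^ 2` of the cross term: `2 * Cm` comes from `c * r ^ 2`, the rest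
  -- from Young's inequality for `k₁ * p * r`. The first bound on `ε` limits the cost to `k₁ / 2`,
  -- the second keeps the form definite.
  set G := 2 * Cm + 2 * k₁ ^ 2 / (k₂ * cr) with hG
  have hGpos : 0 < G := by positivity
  set ε := min (k₁ / (2 * G)) (√k₂ / 2) with hε
  have hεpos : 0 < ε := lt_min (by positivity) (by positivity)
  have hε1 : ε * G ≤ k₁ / 2 := by
    have : ε ≤ k₁ / (2 * G) := min_le_left _ _
    calc ε * G ≤ k₁ / (2 * G) * G := by gcongr
      _ = k₁ / 2 := by field_simp
  have hε2 : ε ^ 2 ≤ k₂ / 4 := by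
    have h1 : ε ≤ √k₂ / 2 := min_le_right _ _
    have h2 := Real.sq_sqrt hk₂.le
    nlinarith
  clear_value ε
  refine ⟨ε, hεpos, min (ε * k₂ * cr) (3 / 4 * k₁), by positivity,
    max (4 * k₂ / (ε * cr) + 4 * ε ^ 2 / k₁) (2 / k₁ + 4 * ε / (k₂ * cr)), by positivity,
    min (k₂ / 2) (1 / 2), by positivity, max (3 * k₂ / 2) (3 / 2), by positivity, fun s hs => ?_⟩
  have hsq : ∀ p r : ℝ, |2 * ε * s * (p * r)| ≤ k₂ / 2 * p ^ 2 + 1 / 2 * r ^ 2 := by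
    have hr : ∀ r : ℝ, (2 * ε * (s * r)) ^ 2 / (k₂ / 2) / 4 ≤ 1 / 2 * r ^ 2 := by
      intro r
      have : (2 * ε * (s * r)) ^ 2 / (k₂ / 2) / 4 = 2 * ε ^ 2 / k₂ * r ^ 2 := by
        rw [show (2 * ε * (s * r)) ^ 2 = 4 * ε ^ 2 * r ^ 2 * s ^ 2 by ring, hs]
        field_simp
      rw [this]
      have h2 : 2 * ε ^ 2 / k₂ ≤ 1 / 2 := by
        rw [div_le_iff₀ hk₂]; linarith
      gcongr
    intro p r
    have h1 := two_mul_le_young (η := k₂ / 2) (by positivity) p (ε * (s * r))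
    have h2 := two_mul_le_young (η := k₂ / 2) (by positivity) p (-(ε * (s * r)))
    have h3 := hr r
    have h4 : (ε * (s * r)) ^ 2 / (k₂ / 2) = (2 * ε * (s * r)) ^ 2 / (k₂ / 2) / 4 := by ring
    rw [neg_sq] at h2
    rw [abs_le]
    constructor <;> nlinarith
  refine ⟨fun p r => ?_, fun p r => ?_, fun c p r d₁ d₂ h1 h2 => ?_⟩
  · have := (abs_le.1 (hsq p r)).1
    have h1 : min (k₂ / 2) (1 / 2) * p ^ 2 ≤ k₂ / 2 * p ^ 2 := by gcongr; exact min_le_left _ _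
    have h2 : min (k₂ / 2) (1 / 2) * r ^ 2 ≤ 1 / 2 * r ^ 2 := by gcongr; exact min_le_right _ _
    unfold oscW
    linarith
  · have := (abs_le.1 (hsq p r)).2
    have h1 : 3 * k₂ / 2 * p ^ 2 ≤ max (3 * k₂ / 2) (3 / 2) * p ^ 2 := by
      gcongr; exact le_max_left _ _
    have h2 : 3 / 2 * r ^ 2 ≤ max (3 * k₂ / 2) (3 / 2) * r ^ 2 := by gcongr; exact le_max_right _ _
    unfold oscW
    linarith
  · have hc : c = s * (s * c) := by rw [← mul_assoc, ← sq, hs, one_mul]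
    set a := s * c with ha
    have e1 : 2 * k₂ * p * (c * r + d₁) + 2 * r * (-k₁ * r - k₂ * c * p + d₂)
          + 2 * ε * s * ((c * r + d₁) * r + p * (-k₁ * r - k₂ * c * p + d₂))
        = 2 * p * (k₂ * d₁) - 2 * k₁ * r ^ 2 + 2 * r * d₂ + 2 * ε * (a * r ^ 2 - k₂ * a * p ^ 2)
          + 2 * p * (-(ε * k₁ * (s * r))) + 2 * r * (ε * (s * d₁)) + 2 * p * (ε * (s * d₂)) := by
      rw [ha]; ring
    rw [e1]
    have sqs : ∀ b : ℝ, (s * b) ^ 2 = b ^ 2 := fun b => by rw [mul_pow, hs, one_mul]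
    -- The weights spend `ε * k₂ * cr` of the available `2 * ε * k₂ * cr` on `p ^ 2`, and `3 / 4 *
    -- k₁` on `r ^ 2`. Together with the `k₁ / 2` of the cross term, `3 / 4 * k₁` of `2 * k₁`
    -- remains.
    have y1 := two_mul_le_young (η := ε * k₂ * cr / 4) (by positivity) p (k₂ * d₁)
    have y2 := two_mul_le_young (η := k₁ / 2) (by positivity) r d₂
    have y3 := two_mul_le_young (η := ε * k₂ * cr / 2) (by positivity) p (-(ε * k₁ * (s * r)))
    have y4 := two_mul_le_young (η := k₁ / 4) (by positivity) r (ε * (s * d₁))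
    have y5 := two_mul_le_young (η := ε * k₂ * cr / 4) (by positivity) p (ε * (s * d₂))
    have z1 : (k₂ * d₁) ^ 2 / (ε * k₂ * cr / 4) = 4 * k₂ / (ε * cr) * d₁ ^ 2 := by
      field_simp
    have z2 : d₂ ^ 2 / (k₁ / 2) = 2 / k₁ * d₂ ^ 2 := by field_simp
    have z3 : (-(ε * k₁ * (s * r))) ^ 2 / (ε * k₂ * cr / 2)
        = ε * (2 * k₁ ^ 2 / (k₂ * cr)) * r ^ 2 := by
      rw [neg_sq, mul_pow, sqs]; field_simp
    have z4 : (ε * (s * d₁)) ^ 2 / (k₁ / 4) = 4 * ε ^ 2 / k₁ * d₁ ^ 2 := by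
      rw [mul_pow, sqs]; field_simp
    have z5 : (ε * (s * d₂)) ^ 2 / (ε * k₂ * cr / 4) = 4 * ε / (k₂ * cr) * d₂ ^ 2 := by
      rw [mul_pow, sqs]; field_simp
    rw [z1] at y1
    rw [z2] at y2
    rw [z3] at y3
    rw [z4] at y4
    rw [z5] at y5
    have w1 : ε * (a * r ^ 2) ≤ ε * (Cm * r ^ 2) := by gcongr
    have w2 : ε * k₂ * (cr * p ^ 2) ≤ ε * k₂ * (a * p ^ 2) := by gcongr
    have w3 : ε * (2 * Cm) * r ^ 2 + ε * (2 * k₁ ^ 2 / (k₂ * cr)) * r ^ 2 ≤ k₁ / 2 * r ^ 2 := by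
      rw [← add_mul, ← mul_add]; gcongr
    have u1 : min (ε * k₂ * cr) (3 / 4 * k₁) * p ^ 2 ≤ ε * k₂ * cr * p ^ 2 := by
      gcongr; exact min_le_left _ _
    have u2 : min (ε * k₂ * cr) (3 / 4 * k₁) * r ^ 2 ≤ 3 / 4 * k₁ * r ^ 2 := by
      gcongr; exact min_le_right _ _
    have u3 := mul_le_mul_of_nonneg_right (le_max_left (4 * k₂ / (ε * cr) + 4 * ε ^ 2 / k₁)
      (2 / k₁ + 4 * ε / (k₂ * cr))) (sq_nonneg d₁)
    have u4 := mul_le_mul_of_nonneg_right (le_max_right (4 * k₂ / (ε * cr) + 4 * ε ^ 2 / k₁)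
      (2 / k₁ + 4 * ε / (k₂ * cr))) (sq_nonneg d₂)
    linarith

theorem hasDerivWithinAt_oscW {k₂ ε s : ℝ} {p r : ℝ → ℝ} {p' r' t : ℝ} {S : Set ℝ}
    (hp : HasDerivWithinAt p p' S t) (hr : HasDerivWithinAt r r' S t) :
    HasDerivWithinAt (fun τ => oscW k₂ ε s (p τ) (r τ))
      (2 * k₂ * p t * p' + 2 * r t * r' + 2 * ε * s * (p' * r t + p t * r')) S t := by
  have h := (((hp.pow 2).const_mul k₂).add (hr.pow 2)).add ((hp.mul hr).const_mul (2 * ε * s))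
  refine (h.congr_deriv ?_)
  simp
  ring

/-- The error of the observer decays exponentially. -/
theorem exists_observer_decay {k₁ k₂ : ℝ} (hk₁ : 0 < k₁) (hk₂ : 0 < k₂) :
    ∃ C > 0, ∃ μ > 0, ∀ (t₀ : ℝ) (T : EReal) (a w : ℝ → ℝ),
      (∀ t ∈ timeInterval t₀ T, HasDerivWithinAt a (w t - k₁ * a t) (timeInterval t₀ T) t) →
      (∀ t ∈ timeInterval t₀ T, HasDerivWithinAt w (-(k₂ * a t)) (timeInterval t₀ T) t) →
      ∀ t ∈ timeInterval t₀ T,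
        a t ^ 2 + w t ^ 2 ≤ C * (a t₀ ^ 2 + w t₀ ^ 2) * Real.exp (-μ * (t - t₀)) := by
  obtain ⟨ε, hε, rate, hrate, K, hK, m, hm, M, hM, h⟩ :=
    exists_oscW hk₁ hk₂ (cr := 1) (Cm := 1) one_pos one_pos
  obtain ⟨h1, h2, h3⟩ := h 1 (by norm_num)
  set b := max 1 (1 / k₂ ^ 2) with hb
  set d := max 1 (k₂ ^ 2) with hd
  have hb0 : 0 < b := by positivity
  have hd0 : 0 < d := by positivity
  refine ⟨d * (M / m) * b, by positivity, rate / M, by positivity, fun t₀ T a w ha hw t ht => ?_⟩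
  -- In the variables `p = -w / k₂` and `r = a` the observer is the unforced oscillator with
  -- constant coupling `1`.
  have hp : ∀ τ ∈ timeInterval t₀ T,
      HasDerivWithinAt (fun τ => -w τ / k₂) (1 * a τ + 0) (timeInterval t₀ T) τ := fun τ hτ =>
    ((hw τ hτ).neg.div_const k₂).congr_deriv (by field_simp; ring)
  have hr : ∀ τ ∈ timeInterval t₀ T,
      HasDerivWithinAt a (-k₁ * a τ - k₂ * 1 * (-w τ / k₂) + 0) (timeInterval t₀ T) τ :=
    fun τ hτ => (ha τ hτ).congr_deriv (by field_simp; ring)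
  -- There is no forcing, so any exponent above `rate / M` serves for `μ`.
  have key := exp_decay_of_deriv_le (c := rate / M) (μ := rate / M + 1) (K := 0) (by linarith)
    le_rfl (fun τ hτ => hasDerivWithinAt_oscW (k₂ := k₂) (ε := ε) (s := 1) (hp τ hτ) (hr τ hτ))
    (fun τ hτ => ?_) ht
  · have e1 := h1 (-w t / k₂) (a t)
    have e2 := h2 (-w t₀ / k₂) (a t₀)
    set E := Real.exp (-(rate / M) * (t - t₀)) with hE
    have hEpos : 0 < E := Real.exp_pos _
    have f1 : a t ^ 2 + w t ^ 2 ≤ d * ((-w t / k₂) ^ 2 + a t ^ 2) := by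
      have g1 : 1 * a t ^ 2 ≤ d * a t ^ 2 := by gcongr; exact le_max_left _ _
      have g2 : k₂ ^ 2 * (-w t / k₂) ^ 2 ≤ d * (-w t / k₂) ^ 2 := by
        gcongr; exact le_max_right _ _
      have g3 : k₂ ^ 2 * (-w t / k₂) ^ 2 = w t ^ 2 := by field_simp
      linarith
    have f2 : (-w t₀ / k₂) ^ 2 + a t₀ ^ 2 ≤ b * (a t₀ ^ 2 + w t₀ ^ 2) := by
      have g1 : 1 * a t₀ ^ 2 ≤ b * a t₀ ^ 2 := by gcongr; exact le_max_left _ _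
      have g2 : 1 / k₂ ^ 2 * w t₀ ^ 2 ≤ b * w t₀ ^ 2 := by
        gcongr; exact le_max_right _ _
      have g3 : (-w t₀ / k₂) ^ 2 = 1 / k₂ ^ 2 * w t₀ ^ 2 := by field_simp
      linarith
    simp only [zero_div, add_zero] at key
    have f3 : m * ((-w t / k₂) ^ 2 + a t ^ 2) ≤ M * (b * (a t₀ ^ 2 + w t₀ ^ 2)) * E := by
      refine e1.trans (key.trans ?_)
      gcongr
      exact e2.trans (by gcongr)
    calc a t ^ 2 + w t ^ 2 ≤ d * ((-w t / k₂) ^ 2 + a t ^ 2) := f1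
      _ = d / m * (m * ((-w t / k₂) ^ 2 + a t ^ 2)) := by field_simp
      _ ≤ d / m * (M * (b * (a t₀ ^ 2 + w t₀ ^ 2)) * E) := by gcongr
      _ = d * (M / m) * b * (a t₀ ^ 2 + w t₀ ^ 2) * E := by ring
  · refine (h3 1 (-w τ / k₂) (a τ) 0 0 (by norm_num) (by norm_num)).trans ?_
    have e2 := h2 (-w τ / k₂) (a τ)
    have : rate / M * oscW k₂ ε 1 (-w τ / k₂) (a τ)
        ≤ rate / M * (M * ((-w τ / k₂) ^ 2 + a τ ^ 2)) := by gcongr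
    have e3 : rate / M * (M * ((-w τ / k₂) ^ 2 + a τ ^ 2))
        = rate * ((-w τ / k₂) ^ 2 + a τ ^ 2) := by field_simp
    simp only [zero_mul, add_zero]
    linarith

/-! ## Closed form of the guidance law -/

/-- Normal current estimate relative to the desired total speed. -/
def relN (v q N : ℝ) : ℝ := N / ut q v

/-- `√(b² - a c)` divided by the desired total speed. -/
def gQ (Δ v q N y : ℝ) : ℝ := √(y ^ 2 + Δ ^ 2 * (1 - relN v q N ^ 2))

/-- Closed form of `1 / √(Δ² + (y + g)²)`. -/
def gI (Δ v q N y : ℝ) : ℝ := (1 - relN v q N ^ 2) / (y * relN v q N + gQ Δ v q N y)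

/-- The guidance law is regular at these arguments. -/
structure Regular (Δ v q N : ℝ) : Prop where
  Δ_pos : 0 < Δ
  q_pos : 0 < q
  N_lt : N ^ 2 < q ^ 2 + v ^ 2

theorem ut_sq (u v : ℝ) : ut u v ^ 2 = u ^ 2 + v ^ 2 := Real.sq_sqrt (by positivity)

theorem ut_pos {q : ℝ} (v : ℝ) (hq : 0 < q) : 0 < ut q v := Real.sqrt_pos.2 (by positivity)

theorem le_ut_left (q v : ℝ) : q ≤ ut q v := Real.le_sqrt_of_sq_le (by nlinarith)

theorem abs_le_ut_right (q v : ℝ) : |v| ≤ ut q v :=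
  Real.abs_le_sqrt (by nlinarith)

theorem ut_le_add (q v : ℝ) : ut q v ≤ |q| + |v| := by
  refine Real.sqrt_le_iff.2 ⟨by positivity, ?_⟩
  nlinarith [sq_abs q, sq_abs v, mul_nonneg (abs_nonneg q) (abs_nonneg v)]

namespace Regular

variable {Δ v q N : ℝ} (h : Regular Δ v q N)
include h

theorem relN_mul : relN v q N * ut q v = N := div_mul_cancel₀ _ (ut_pos v h.q_pos).ne'

theorem relN_sq_lt : relN v q N ^ 2 < 1 := by
  have := ut_pos v h.q_pos
  rw [relN, div_pow, div_lt_one (by positivity), ut_sq]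
  exact h.N_lt

theorem gQ_sq (y : ℝ) : gQ Δ v q N y ^ 2 = y ^ 2 + Δ ^ 2 * (1 - relN v q N ^ 2) := by
  have := h.relN_sq_lt
  exact Real.sq_sqrt (by nlinarith [sq_nonneg y, sq_nonneg Δ])

theorem gQ_pos (y : ℝ) : 0 < gQ Δ v q N y := by
  have h1 := h.relN_sq_lt
  have h2 := h.Δ_pos
  refine Real.sqrt_pos.2 ?_
  have : 0 < Δ ^ 2 * (1 - relN v q N ^ 2) := mul_pos (by positivity) (by linarith)
  positivity

/-- `Q ^ 2 - (y * n) ^ 2 = (1 - n ^ 2) * (y ^ 2 + Δ ^ 2)` is positive, so `Q` dominates `|y * n|`.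
-/
theorem den_pos (y : ℝ) : 0 < y * relN v q N + gQ Δ v q N y := by
  have h1 := h.relN_sq_lt
  have h2 := h.Δ_pos
  have h3 := h.gQ_pos y
  have h4 := h.gQ_sq y
  have h5 : (y * relN v q N) ^ 2 < gQ Δ v q N y ^ 2 := by
    rw [h4]
    have : 0 < (y ^ 2 + Δ ^ 2) * (1 - relN v q N ^ 2) := mul_pos (by positivity) (by linarith)
    nlinarith
  have h6 := abs_lt_of_sq_lt_sq h5 h3.le
  linarith [(abs_lt.1 h6).1]

theorem gI_pos (y : ℝ) : 0 < gI Δ v q N y :=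
  div_pos (by linarith [h.relN_sq_lt]) (h.den_pos y)

theorem ga_eq : ga v q N = -(ut q v ^ 2 * (1 - relN v q N ^ 2)) := by
  have h1 := h.relN_mul
  rw [ga, ← ut_sq]
  conv_lhs => rw [← h1]
  ring

theorem ga_neg : ga v q N < 0 := by
  have := h.N_lt
  rw [ga]
  linarith

theorem sqrt_disc (y : ℝ) :
    √(gb N y ^ 2 - ga v q N * gc Δ y) = ut q v * gQ Δ v q N y := by
  have h0 := ut_pos v h.q_pos
  have h3 := h.gQ_pos y
  rw [Real.sqrt_eq_iff_mul_self_eq_of_pos (by positivity)]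
  have h4 := h.gQ_sq y
  have h1 := h.relN_mul
  rw [h.ga_eq, gb, gc]
  generalize gQ Δ v q N y = Q at *
  generalize relN v q N = n at *
  subst h1
  linear_combination (ut q v ^ 2) * h4

theorem disc_pos (y : ℝ) : 0 < gb N y ^ 2 - ga v q N * gc Δ y := by
  have h1 : 0 < √(gb N y ^ 2 - ga v q N * gc Δ y) := by
    rw [h.sqrt_disc]
    exact mul_pos (ut_pos v h.q_pos) (h.gQ_pos y)
  exact Real.sqrt_pos.1 h1

theorem g_N_eq (y : ℝ) : g_N Δ v q N y = 1 / (ut q v * gI Δ v q N y) := by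
  have h0 := ut_pos v h.q_pos
  have h2 := h.relN_sq_lt
  have h3 := h.den_pos y
  have h1 := h.relN_mul
  rw [g_N, gS, h.sqrt_disc, h.ga_eq, gb, gI]
  have h4 : 1 - relN v q N ^ 2 ≠ 0 := by linarith
  conv_lhs => rw [show y * N = y * (relN v q N * ut q v) by rw [h1]]
  field_simp

theorem add_g_eq (y : ℝ) : y + g Δ v q N y = y + relN v q N / gI Δ v q N y := by
  have h0 := ut_pos v h.q_pos
  have e : g Δ v q N y = N * g_N Δ v q N y := rfl
  rw [e, h.g_N_eq, relN]
  have := h.gI_pos y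
  field_simp

/-- `gI` is the positive root of this quadratic. It says that `(Δ * gI, y * gI + n)` lies on the
unit circle; this point is the cosine and sine of the line-of-sight angle. The summand `n` in the
sine is what lets the guidance law cancel the estimated normal current. -/
theorem gI_identity (y : ℝ) :
    (y * gI Δ v q N y + relN v q N) ^ 2 + (Δ * gI Δ v q N y) ^ 2 = 1 := by
  have h2 := h.relN_sq_lt
  have h3 := h.den_pos y
  have h4 := h.gQ_sq y
  rw [gI]
  generalize relN v q N = n at *
  generalize gQ Δ v q N y = Q at *
  field_simp
  have h5 : (1 : ℝ) - n ^ 2 ≠ 0 := by linarith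
  linear_combination (n ^ 2 - 1) * h4

theorem sq_add_eq (y : ℝ) : Δ ^ 2 + (y + g Δ v q N y) ^ 2 = (1 / gI Δ v q N y) ^ 2 := by
  have h1 := h.gI_identity y
  have h2 := h.gI_pos y
  rw [h.add_g_eq]
  field_simp
  linear_combination h1

theorem sqrt_los (y : ℝ) :
    √(1 + ((y + g Δ v q N y) / Δ) ^ 2) = 1 / (gI Δ v q N y * Δ) := by
  have h1 := h.sq_add_eq y
  have h2 := h.gI_pos y
  have h3 := h.Δ_pos
  rw [Real.sqrt_eq_iff_mul_self_eq_of_pos (by positivity)]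
  field_simp at h1 ⊢
  linarith

theorem cos_los (y : ℝ) : Real.cos (los Δ v q N y) = Δ * gI Δ v q N y := by
  rw [los, Real.cos_arctan, h.sqrt_los]
  have h2 := h.gI_pos y
  have h3 := h.Δ_pos
  field_simp

theorem sin_los (y : ℝ) : Real.sin (los Δ v q N y) = y * gI Δ v q N y + relN v q N := by
  rw [los, Real.sin_arctan, h.sqrt_los, h.add_g_eq]
  have h2 := h.gI_pos y
  have h3 := h.Δ_pos
  field_simp

theorem losGain_eq (y : ℝ) : losGain Δ v q N y = Δ * gI Δ v q N y ^ 2 := by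
  have h2 := h.gI_pos y
  rw [losGain, h.sq_add_eq]
  field_simp

/-- In `r_d` the partial derivatives of `g` occur only multiplied by `losGain`. In this product and
in those of `losGain_mul_total` and `losGain_mul_VN` the powers of `gI` in the denominator cancel,
and what remains has a visible order in `u_td`. -/
theorem losGain_mul_g_a (y : ℝ) :
    losGain Δ v q N y * g_a Δ v q N y
      = relN v q N / ut q v ^ 2 * (Δ / (2 * gQ Δ v q N y)) := by
  have h0 := ut_pos v h.q_pos
  have h2 := h.relN_sq_lt
  have h3 := h.den_pos y
  have hQ := h.gQ_pos y
  have h4 := h.gQ_sq y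
  have h1 := h.relN_mul
  have hc : gc Δ y * (1 - relN v q N ^ 2)
      = gQ Δ v q N y ^ 2 - y ^ 2 * relN v q N ^ 2 := by
    rw [h4, gc]; ring
  have h5 : 1 - relN v q N ^ 2 ≠ 0 := by linarith
  -- Eliminating `c` through `Q` makes both sides rational in `y`, `n` and `Q`; its numerator
  -- factors as `(Q - y * n) * (Q + y * n)`, which cancels the denominator of `gI`.
  have hc' : gc Δ y = (gQ Δ v q N y ^ 2 - y ^ 2 * relN v q N ^ 2) / (1 - relN v q N ^ 2) := by
    rw [← hc]; field_simp
  rw [h.losGain_eq, g_a, gDa, h.sqrt_disc, h.ga_eq, gb, gI, hc']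
  generalize relN v q N = n at *
  generalize gQ Δ v q N y = Q at *
  generalize ut q v = U at *
  subst h1
  obtain ⟨E, hE⟩ : ∃ E, E = y * n + Q := ⟨_, rfl⟩
  have h6 : E ≠ 0 := hE ▸ h3.ne'
  simp only [← hE]
  field_simp
  rw [hE]
  ring

theorem g_b_eq (y : ℝ) :
    g_b Δ v q N y = relN v q N / (ut q v * gI Δ v q N y * gQ Δ v q N y) := by
  have h0 := ut_pos v h.q_pos
  have hQ := h.gQ_pos y
  have hI := h.gI_pos y
  have e : g_b Δ v q N y = N * (g_N Δ v q N y / √(gb N y ^ 2 - ga v q N * gc Δ y)) := by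
    rw [g_b, g_N, gDb, gS, div_div]
  rw [e, h.g_N_eq, h.sqrt_disc, relN]
  field_simp

theorem losGain_mul_total (y : ℝ) :
    losGain Δ v q N y * (1 + g_c Δ v q N y * (2 * y) + g_b Δ v q N y * N)
      = Δ / gQ Δ v q N y * gI Δ v q N y := by
  have h0 := ut_pos v h.q_pos
  have hQ := h.gQ_pos y
  have hI := h.gI_pos y
  have h3 := h.den_pos y
  have h1 := h.relN_mul
  have h2 := h.relN_sq_lt
  rw [h.losGain_eq, h.g_b_eq, g_c, gDc, h.sqrt_disc]
  rw [gI] at *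
  generalize relN v q N = n at *
  generalize gQ Δ v q N y = Q at *
  generalize ut q v = U at *
  subst h1
  obtain ⟨E, hE⟩ : ∃ E, E = y * n + Q := ⟨_, rfl⟩
  have h6 : E ≠ 0 := hE ▸ h3.ne'
  simp only [← hE]
  have h5 : 1 - n ^ 2 ≠ 0 := by linarith
  field_simp
  rw [hE]
  ring

theorem losGain_mul_VN (y : ℝ) :
    losGain Δ v q N y * (g_N Δ v q N y + g_a Δ v q N y * (2 * N) + g_b Δ v q N y * y)
      = Δ / (gQ Δ v q N y * ut q v) := by
  have h0 := ut_pos v h.q_pos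
  have hQ := h.gQ_pos y
  have hI := h.gI_pos y
  have h3 := h.den_pos y
  have h1 := h.relN_mul
  have h2 := h.relN_sq_lt
  have e : losGain Δ v q N y * (g_N Δ v q N y + g_a Δ v q N y * (2 * N) + g_b Δ v q N y * y)
      = losGain Δ v q N y * (g_N Δ v q N y + g_b Δ v q N y * y)
        + losGain Δ v q N y * g_a Δ v q N y * (2 * N) := by ring
  rw [e, h.losGain_mul_g_a, h.losGain_eq, h.g_b_eq, h.g_N_eq]
  rw [gI] at *
  generalize relN v q N = n at *
  generalize gQ Δ v q N y = Q at *
  generalize ut q v = U at *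
  subst h1
  obtain ⟨E, hE⟩ : ∃ E, E = y * n + Q := ⟨_, rfl⟩
  have h6 : E ≠ 0 := hE ▸ h3.ne'
  simp only [← hE]
  have h5 : 1 - n ^ 2 ≠ 0 := by linarith
  field_simp
  rw [hE]
  ring

end Regular

/-- Cosine and sine of `e - los`, for `ce = cos e` and `se = sin e`. -/
def courseCos (Δ v q N y ce se : ℝ) : ℝ :=
  ce * (Δ * gI Δ v q N y) + se * (y * gI Δ v q N y + relN v q N)

def courseSin (Δ v q N y ce se : ℝ) : ℝ :=
  se * (Δ * gI Δ v q N y) - ce * (y * gI Δ v q N y + relN v q N)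

/-- Cosine and sine of `ψ - γ`. -/
def headCos (Δ v q N y ce se : ℝ) : ℝ :=
  courseCos Δ v q N y ce se * (q / ut q v) + courseSin Δ v q N y ce se * (v / ut q v)

def headSin (Δ v q N y ce se : ℝ) : ℝ :=
  courseSin Δ v q N y ce se * (q / ut q v) - courseCos Δ v q N y ce se * (v / ut q v)

theorem cos_arctan_div {q : ℝ} (v : ℝ) (hq : 0 < q) :
    Real.cos (Real.arctan (v / q)) = q / ut q v := by
  have h : √(1 + (v / q) ^ 2) = ut q v / q := by
    rw [Real.sqrt_eq_iff_mul_self_eq_of_pos (div_pos (ut_pos v hq) hq)]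
    have := ut_sq q v
    field_simp
    linarith
  rw [Real.cos_arctan, h, one_div_div]

theorem sin_arctan_div {q : ℝ} (v : ℝ) (hq : 0 < q) :
    Real.sin (Real.arctan (v / q)) = v / ut q v := by
  have h : √(1 + (v / q) ^ 2) = ut q v / q := by
    rw [Real.sqrt_eq_iff_mul_self_eq_of_pos (div_pos (ut_pos v hq) hq)]
    have := ut_sq q v
    field_simp
    linarith
  rw [Real.sin_arctan, h, div_div_div_cancel_right₀ hq.ne']

namespace Regular

variable {Δ v q N : ℝ} (h : Regular Δ v q N)
include h

theorem cos_course (y e : ℝ) :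
    Real.cos (e - los Δ v q N y) = courseCos Δ v q N y (Real.cos e) (Real.sin e) := by
  rw [Real.cos_sub, h.cos_los, h.sin_los, courseCos]

theorem sin_course (y e : ℝ) :
    Real.sin (e - los Δ v q N y) = courseSin Δ v q N y (Real.cos e) (Real.sin e) := by
  rw [Real.sin_sub, h.cos_los, h.sin_los, courseSin]

theorem cos_relHeading (y e : ℝ) :
    Real.cos (relHeading Δ v q N y e) = headCos Δ v q N y (Real.cos e) (Real.sin e) := by
  rw [relHeading, sub_right_comm, Real.cos_sub, h.cos_course, h.sin_course,
    cos_arctan_div v h.q_pos, sin_arctan_div v h.q_pos, headCos]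

theorem sin_relHeading (y e : ℝ) :
    Real.sin (relHeading Δ v q N y e) = headSin Δ v q N y (Real.cos e) (Real.sin e) := by
  rw [relHeading, sub_right_comm, Real.sin_sub, h.cos_course, h.sin_course,
    cos_arctan_div v h.q_pos, sin_arctan_div v h.q_pos, headSin]

end Regular

/-- Polar form of `u + iv`. It removes the side-slip angle, and with it the discontinuity of
`Complex.arg`, from the update law. -/
theorem ut_mul_cos_add_sideslip (u v φ : ℝ) :
    ut u v * Real.cos (φ + sideslip u v) = u * Real.cos φ - v * Real.sin φ := by
  have h : ut u v = ‖(⟨u, v⟩ : ℂ)‖ := by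
    rw [Complex.norm_def, Complex.normSq_mk, ut, sq, sq]
  have h1 := Complex.norm_mul_cos_arg (⟨u, v⟩ : ℂ)
  have h2 := Complex.norm_mul_sin_arg (⟨u, v⟩ : ℂ)
  simp only at h1 h2
  rw [Real.cos_add, sideslip, h]
  linear_combination Real.cos φ * h1 - Real.sin φ * h2

theorem thetaDot_eq (D : Design) (θ v u A y x φ : ℝ) :
    thetaDot D θ v u A y x φ
      = (u * Real.cos φ - v * Real.sin φ + A + D.k.kδ * x) / (1 - D.P.κ θ * y) := by
  rw [thetaDot, ut_mul_cos_add_sideslip]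

/-- Closed form of `dθ/dt` in terms of the curvature `κ`. -/
def sForm (D : Design) (κ v u q A N y x ce se : ℝ) : ℝ :=
  (u * headCos D.k.Δ v q N y ce se - v * headSin D.k.Δ v q N y ce se + A + D.k.kδ * x)
    / (1 - κ * y)

/-- Closed form of the time derivative of the normal current estimate. -/
def VNForm (D : Design) (κ s A ex ey sγ cγ : ℝ) : ℝ :=
  -(D.k.kx2 * ex) * sγ + D.k.ky2 * ey * cγ - κ * s * A

/-- Closed form of the known part of `dy_{b/p}/dt`. -/
def yForm (D : Design) (κ s v u q N y x ce se : ℝ) : ℝ :=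
  ut q v * courseSin D.k.Δ v q N y ce se + N + (u - q) * headSin D.k.Δ v q N y ce se
    - x * (κ * s)

/-- Closed form of the bracket in the desired yaw rate. -/
def bracketForm (D : Design) (κ s N' yK v u q q' N y : ℝ) : ℝ :=
  -(κ * s) + (D.w.Y u * v * q - q' * v) / ut q v ^ 2
    + D.k.Δ / gQ D.k.Δ v q N y *
      (N' / ut q v - relN v q N / ut q v ^ 2 * (q * q' + v * (D.w.Y u * v))
        + yK * gI D.k.Δ v q N y)

/-- Closed form of `C_r`. -/
def CrForm (D : Design) (v u q N y : ℝ) : ℝ :=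
  1 + D.w.X u * q / ut q v ^ 2
    - relN v q N / ut q v ^ 2 * (D.k.Δ / gQ D.k.Δ v q N y) * (v * D.w.X u)

/-- Closed form of the desired yaw rate. -/
def rdForm (D : Design) (κ sγ cγ v u q q' A N y x ce se ex ey : ℝ) : ℝ :=
  -(bracketForm D κ (sForm D κ v u q A N y x ce se)
    (VNForm D κ (sForm D κ v u q A N y x ce se) A ex ey sγ cγ)
    (yForm D κ (sForm D κ v u q A N y x ce se) v u q N y x ce se) v u q q' N y)
    / CrForm D v u q N y

section

variable {D : Design} {v q N : ℝ} (h : Regular D.k.Δ v q N)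
include h

theorem Cr_eq_form (u y : ℝ) : Cr D v u q N y = CrForm D v u q N y := by
  have h1 := h.losGain_mul_g_a y
  rw [Cr, CrForm, ← ut_sq]
  linear_combination (-(2 * v * D.w.X u)) * h1

/-- The restoring term and the two terms of `G1` with factor `u_td` add up to `u_td * sin (e - los)`
plus `u_td * n`, and `u_td * n` is the normal current estimate. -/
theorem yDotKnown_eq_form (θ u y x e s : ℝ) :
    yDotKnown D θ v u q N y x e s
      = yForm D (D.P.κ θ) s v u q N y x (Real.cos e) (Real.sin e) := by
  have hI := h.gI_pos y
  have h1 := h.relN_mul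
  rw [yDotKnown, G1, yForm, h.sin_relHeading, h.cos_los, h.sin_los, h.sq_add_eq,
    Real.sqrt_sq (by positivity), courseSin]
  field_simp
  linear_combination h1

theorem thetaDot_eq_form (θ u A y x e : ℝ) :
    thetaDot D θ v u A y x (relHeading D.k.Δ v q N y e)
      = sForm D (D.P.κ θ) v u q A N y x (Real.cos e) (Real.sin e) := by
  rw [thetaDot_eq, h.cos_relHeading, h.sin_relHeading, sForm]

/-- The bracket is regrouped by the derivative of the normal current estimate, by `dy/dt` and by the
derivative of `u_td ^ 2`. Each group collects exactly one of the three product formulas with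
`losGain`. -/
theorem rd_eq_form (θ u q' A y x e ex ey : ℝ) :
    rd D θ v u q q' A N y x e ex ey
      = rdForm D (D.P.κ θ) (Real.sin (D.P.γ θ)) (Real.cos (D.P.γ θ)) v u q q' A N y x
          (Real.cos e) (Real.sin e) ex ey := by
  rw [rd]
  rw [rdForm, thetaDot_eq_form h, yDotKnown_eq_form h, Cr_eq_form h]
  set s := sForm D (D.P.κ θ) v u q A N y x (Real.cos e) (Real.sin e)
  have e1 : VNdot D θ A ex ey s
      = VNForm D (D.P.κ θ) s A ex ey (Real.sin (D.P.γ θ)) (Real.cos (D.P.γ θ)) := rfl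
  rw [e1]
  set N' := VNForm D (D.P.κ θ) s A ex ey (Real.sin (D.P.γ θ)) (Real.cos (D.P.γ θ))
  set yK := yForm D (D.P.κ θ) s v u q N y x (Real.cos e) (Real.sin e)
  have k1 := h.losGain_mul_g_a y
  have k2 := h.losGain_mul_total y
  have k3 := h.losGain_mul_VN y
  have hQ := h.gQ_pos y
  have k3' : D.k.Δ / (gQ D.k.Δ v q N y * ut q v) = D.k.Δ / gQ D.k.Δ v q N y / ut q v := by
    rw [div_div]
  have k1' : D.k.Δ / (2 * gQ D.k.Δ v q N y) = D.k.Δ / gQ D.k.Δ v q N y / 2 := by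
    field_simp
  rw [k3'] at k3
  rw [k1'] at k1
  rw [bracketForm, ← ut_sq]
  generalize D.k.Δ / gQ D.k.Δ v q N y = w at *
  rw [div_mul_eq_mul_div, neg_one_mul]
  congr 2
  linear_combination N' * k3 + (-2 * q * q' - 2 * v * (D.w.Y u * v)) * k1 + yK * k2

end

/-! ## Families of functions with weighted bounds on value and derivative -/

/-- The functions `f i` and their derivatives at `0` are of order `w i`, uniformly in `i`. -/
def Tame {ι : Type*} (w : ι → ℝ) (f : ι → ℝ → ℝ) : Prop :=
  ∃ C, 0 ≤ C ∧ ∀ i, DifferentiableAt ℝ (f i) 0 ∧ |f i 0| ≤ C * w i ∧ |deriv (f i) 0| ≤ C * w i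

namespace Tame

variable {ι : Type*} {w w₁ w₂ : ι → ℝ} {f f₁ f₂ : ι → ℝ → ℝ}

theorem weight_congr (h : Tame w₁ f) (hw : ∀ i, w₁ i = w₂ i) : Tame w₂ f := by
  obtain rfl : w₁ = w₂ := funext hw
  exact h

theorem mono (h : Tame w₁ f) (K : ℝ) (hw : ∀ i, w₁ i ≤ K * w₂ i)
    (h0 : ∀ i, 0 ≤ w₂ i) : Tame w₂ f := by
  obtain ⟨C, hC, h⟩ := h
  refine ⟨C * |K|, by positivity, fun i => ?_⟩
  have h2 : C * w₁ i ≤ C * |K| * w₂ i := by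
    rw [mul_assoc]
    have := hw i
    have h3 : K * w₂ i ≤ |K| * w₂ i := mul_le_mul_of_nonneg_right (le_abs_self K) (h0 i)
    exact mul_le_mul_of_nonneg_left (this.trans h3) hC
  exact ⟨(h i).1, (h i).2.1.trans h2, (h i).2.2.trans h2⟩

theorem add (h₁ : Tame w f₁) (h₂ : Tame w f₂) : Tame w (fun i t => f₁ i t + f₂ i t) := by
  obtain ⟨C₁, hC₁, h₁⟩ := h₁
  obtain ⟨C₂, hC₂, h₂⟩ := h₂
  refine ⟨C₁ + C₂, by positivity, fun i => ?_⟩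
  obtain ⟨a1, a2, a3⟩ := h₁ i
  obtain ⟨b1, b2, b3⟩ := h₂ i
  refine ⟨a1.add b1, ?_, ?_⟩
  · rw [add_mul]; exact (abs_add_le _ _).trans (add_le_add a2 b2)
  · rw [deriv_fun_add a1 b1, add_mul]; exact (abs_add_le _ _).trans (add_le_add a3 b3)

theorem neg (h : Tame w f) : Tame w (fun i t => -f i t) := by
  obtain ⟨C, hC, h⟩ := h
  refine ⟨C, hC, fun i => ?_⟩
  obtain ⟨a1, a2, a3⟩ := h i
  refine ⟨a1.neg, by rwa [abs_neg], ?_⟩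
  rwa [deriv.fun_neg, abs_neg]

theorem sub (h₁ : Tame w f₁) (h₂ : Tame w f₂) : Tame w (fun i t => f₁ i t - f₂ i t) := by
  simpa only [sub_eq_add_neg] using h₁.add h₂.neg

theorem mul (h₁ : Tame w₁ f₁) (h₂ : Tame w₂ f₂) :
    Tame (fun i => w₁ i * w₂ i) (fun i t => f₁ i t * f₂ i t) := by
  obtain ⟨C₁, hC₁, h₁⟩ := h₁
  obtain ⟨C₂, hC₂, h₂⟩ := h₂
  refine ⟨2 * (C₁ * C₂), by positivity, fun i => ?_⟩
  obtain ⟨a1, a2, a3⟩ := h₁ i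
  obtain ⟨b1, b2, b3⟩ := h₂ i
  have k : ∀ x y : ℝ, |x| ≤ C₁ * w₁ i → |y| ≤ C₂ * w₂ i →
      |x * y| ≤ C₁ * C₂ * (w₁ i * w₂ i) := by
    intro x y hx hy
    rw [abs_mul]
    calc |x| * |y| ≤ (C₁ * w₁ i) * (C₂ * w₂ i) :=
          mul_le_mul hx hy (abs_nonneg _) ((abs_nonneg _).trans hx)
      _ = _ := by ring
  refine ⟨a1.mul b1, ?_, ?_⟩
  · have := k _ _ a2 b2
    have h0 := (abs_nonneg _).trans this
    linarith
  · rw [deriv_fun_mul a1 b1]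
    have h1 := k _ _ a3 b2
    have h2 := k _ _ a2 b3
    have h3 := abs_add_le (deriv (f₁ i) 0 * f₂ i 0) (f₁ i 0 * deriv (f₂ i) 0)
    linarith

/-- Only the derivative needs an upper bound and only the value a lower one. The value itself may be
much larger than the weight, as happens for `1 - κ y` when `y` is unbounded. -/
theorem inv' {C c : ℝ} (hc : 0 < c) (hC : 0 ≤ C) (hw : ∀ i, 0 < w i)
    (h : ∀ i, DifferentiableAt ℝ (f i) 0 ∧ |deriv (f i) 0| ≤ C * w i ∧ c * w i ≤ |f i 0|) :
    Tame (fun i => (w i)⁻¹) (fun i t => (f i t)⁻¹) := by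
  refine ⟨max (1 / c) (C / c ^ 2), by positivity, fun i => ?_⟩
  obtain ⟨a1, a2, a3⟩ := h i
  have hwi := hw i
  have hne : f i 0 ≠ 0 := fun h0 => by
    rw [h0, abs_zero] at a3
    have := mul_pos hc hwi
    linarith
  refine ⟨a1.inv hne, ?_, ?_⟩
  · rw [abs_inv]
    calc |f i 0|⁻¹ ≤ (c * w i)⁻¹ := inv_anti₀ (by positivity) a3
      _ = 1 / c * (w i)⁻¹ := by rw [mul_inv, one_div]
      _ ≤ _ := by gcongr; exact le_max_left _ _
  · rw [deriv_fun_inv'' a1 hne, abs_div, abs_neg, abs_pow]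
    calc |deriv (f i) 0| / |f i 0| ^ 2 ≤ C * w i / (c * w i) ^ 2 := by gcongr
      _ = C / c ^ 2 * (w i)⁻¹ := by field_simp
      _ ≤ _ := by gcongr; exact le_max_right _ _

theorem inv {c : ℝ} (h : Tame w f) (hc : 0 < c) (hw : ∀ i, 0 < w i)
    (hl : ∀ i, c * w i ≤ |f i 0|) : Tame (fun i => (w i)⁻¹) (fun i t => (f i t)⁻¹) := by
  obtain ⟨C, hC, h⟩ := h
  exact inv' hc hC hw fun i => ⟨(h i).1, (h i).2.2, hl i⟩

theorem sqrt {c : ℝ} (h : Tame (fun i => w i ^ 2) f) (hc : 0 < c) (hw : ∀ i, 0 < w i)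
    (hl : ∀ i, c * w i ^ 2 ≤ f i 0) : Tame w (fun i t => √(f i t)) := by
  obtain ⟨C, hC, h⟩ := h
  refine ⟨max √C (C / (2 * √c)), by positivity, fun i => ?_⟩
  obtain ⟨a1, a2, a3⟩ := h i
  have hwi := hw i
  have hne : 0 < f i 0 := lt_of_lt_of_le (by positivity) (hl i)
  refine ⟨a1.sqrt hne.ne', ?_, ?_⟩
  · rw [abs_of_nonneg (Real.sqrt_nonneg _)]
    calc √(f i 0) ≤ √(C * w i ^ 2) := Real.sqrt_le_sqrt ((le_abs_self _).trans a2)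
      _ = √C * w i := by rw [Real.sqrt_mul hC, Real.sqrt_sq hwi.le]
      _ ≤ _ := by gcongr; exact le_max_left _ _
  · rw [deriv_sqrt a1 hne.ne', abs_div, abs_of_pos (by positivity : 0 < 2 * √(f i 0))]
    have hs : √c * w i ≤ √(f i 0) := by
      rw [← Real.sqrt_sq hwi.le, ← Real.sqrt_mul hc.le]
      exact Real.sqrt_le_sqrt (hl i)
    calc |deriv (f i) 0| / (2 * √(f i 0)) ≤ C * w i ^ 2 / (2 * (√c * w i)) := by gcongr
      _ = C / (2 * √c) * w i := by field_simp
      _ ≤ _ := by gcongr; exact le_max_right _ _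

theorem const (c : ℝ) : Tame (fun _ : ι => (1 : ℝ)) (fun _ _ => c) :=
  ⟨|c|, abs_nonneg c, fun i => ⟨differentiableAt_const c, by simp, by simp⟩⟩

end Tame

/-! ## Lines in the domain of the desired yaw rate -/

/-- A line `h ↦ ξ + h w` in the space of arguments of `r_d`, through a point at which the control
law is regular. -/
structure Line (D : Design) (M δ σ cr q₀ : ℝ) where
  ξ : Fin 12 → ℝ
  w : Fin 12 → ℝ
  w_le : ∀ j, |w j| ≤ 1
  u_le : |ξ 2| ≤ M
  q_ge : q₀ ≤ ξ 3
  q_le : |ξ 3| ≤ M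
  q'_le : |ξ 4| ≤ M
  A_le : |ξ 5| ≤ M
  N_le : |ξ 6| ≤ δ * ξ 3
  x_le : |ξ 8| ≤ M
  ex_le : |ξ 10| ≤ M
  ey_le : |ξ 11| ≤ M
  tube : σ ≤ 1 - D.P.κ (ξ 0) * ξ 7
  Cr_ge : cr ≤ |Cr D (ξ 1) (ξ 2) (ξ 3) (ξ 6) (ξ 7)|
  yw_le : |ξ 7 * w 0| ≤ M

/-- Constants for which `Line` is a family with uniform bounds. -/
structure LineBounds (D : Design) (M δ σ cr q₀ κm κm' : ℝ) : Prop where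
  M_pos : 0 < M
  δ_pos : 0 < δ
  δ_lt : δ < 1
  σ_pos : 0 < σ
  cr_pos : 0 < cr
  q₀_pos : 0 < q₀
  κ_le : ∀ θ, |D.P.κ θ| ≤ κm
  κ'_le : ∀ θ, |deriv D.P.κ θ| ≤ κm'

theorem PlanarPath.contDiff_κ (P : PlanarPath) : ContDiff ℝ ∞ P.κ :=
  (contDiff_infty_iff_deriv.1 P.smooth_γ).2

namespace Line

variable {D : Design} {M δ σ cr q₀ κm κm' : ℝ}

/-- Coordinates along the line. -/
def c (j : Fin 12) (i : Line D M δ σ cr q₀) (t : ℝ) : ℝ := i.ξ j + t * i.w j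

/-- Desired total speed at the base point. -/
def sp (i : Line D M δ σ cr q₀) : ℝ := ut (i.ξ 3) (i.ξ 1)

/-- Distance scale at the base point. -/
def ρ (i : Line D M δ σ cr q₀) : ℝ := √(D.k.Δ ^ 2 + i.ξ 7 ^ 2)

theorem c_zero (j : Fin 12) (i : Line D M δ σ cr q₀) : c j i 0 = i.ξ j := by simp [c]

theorem hasDerivAt_c (j : Fin 12) (i : Line D M δ σ cr q₀) (t : ℝ) :
    HasDerivAt (c j i) (i.w j) t :=
  (((hasDerivAt_id t).mul_const (i.w j)).const_add (i.ξ j)).congr_deriv (one_mul _)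

theorem tame_c {W : Line D M δ σ cr q₀ → ℝ} (j : Fin 12) (K : ℝ) (hK : 0 ≤ K)
    (h1 : ∀ i, |i.ξ j| ≤ K * W i) (h2 : ∀ i, 1 ≤ K * W i) : Tame W (c j) := by
  refine ⟨K, hK, fun i => ⟨(hasDerivAt_c j i 0).differentiableAt, ?_, ?_⟩⟩
  · rw [c_zero]; exact h1 i
  · rw [(hasDerivAt_c j i 0).deriv]; exact (i.w_le j).trans (h2 i)

theorem tame_c_one (j : Fin 12) {K : ℝ}
    (h1 : ∀ i : Line D M δ σ cr q₀, |i.ξ j| ≤ K) :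
    Tame (fun _ : Line D M δ σ cr q₀ => (1 : ℝ)) (c j) :=
  tame_c j (max K 1) (by positivity)
    (fun i => by rw [mul_one]; exact (h1 i).trans (le_max_left _ _))
    (fun i => by rw [mul_one]; exact le_max_right _ _)

section

variable (hb : LineBounds D M δ σ cr q₀ κm κm')
include hb

theorem q_pos (i : Line D M δ σ cr q₀) : 0 < i.ξ 3 := hb.q₀_pos.trans_le i.q_ge

theorem sp_pos (i : Line D M δ σ cr q₀) : 0 < i.sp := ut_pos _ (q_pos hb i)

omit hb in
theorem le_sp (i : Line D M δ σ cr q₀) : q₀ ≤ i.sp := i.q_ge.trans (le_ut_left _ _)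

omit hb in
theorem ρ_pos (i : Line D M δ σ cr q₀) : 0 < i.ρ :=
  Real.sqrt_pos.2 (by have := D.k.Δ_pos; positivity)

omit hb in
theorem ρ_sq (i : Line D M δ σ cr q₀) : i.ρ ^ 2 = D.k.Δ ^ 2 + i.ξ 7 ^ 2 :=
  Real.sq_sqrt (by positivity)

theorem regular (i : Line D M δ σ cr q₀) : Regular D.k.Δ (i.ξ 1) (i.ξ 3) (i.ξ 6) := by
  refine ⟨D.k.Δ_pos, q_pos hb i, ?_⟩
  have h1 := i.N_le
  have h2 := q_pos hb i
  have h3 : |i.ξ 6| < i.ξ 3 := h1.trans_lt (by nlinarith [hb.δ_lt])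
  have h4 : i.ξ 6 ^ 2 < i.ξ 3 ^ 2 := sq_lt_sq' (by linarith [(abs_lt.1 h3).1]) (abs_lt.1 h3).2
  nlinarith [sq_nonneg (i.ξ 1)]

theorem relN_sq_le (i : Line D M δ σ cr q₀) : relN (i.ξ 1) (i.ξ 3) (i.ξ 6) ^ 2 ≤ δ ^ 2 := by
  have h0 := sp_pos hb i
  have h1 := (regular hb i).relN_mul
  have h2 : |i.ξ 6| ≤ δ * i.sp :=
    i.N_le.trans (mul_le_mul_of_nonneg_left (le_ut_left _ _) hb.δ_pos.le)
  have h3 : |relN (i.ξ 1) (i.ξ 3) (i.ξ 6)| ≤ δ := by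
    rw [relN, abs_div, abs_of_pos (ut_pos _ (q_pos hb i))]
    exact (div_le_iff₀ h0).2 h2
  exact sq_le_sq' (abs_le.1 h3).1 (abs_le.1 h3).2

theorem δ_sq_lt : δ ^ 2 < 1 := by nlinarith [hb.δ_lt, hb.δ_pos]

end

end Line

/-- Tameness with a power of the desired total speed as weight. -/
@[nolint unusedArguments]
def LineBounds.TameP {D : Design} {M δ σ cr q₀ κm κm' : ℝ}
    (_ : LineBounds D M δ σ cr q₀ κm κm') (k : ℤ) (f : Line D M δ σ cr q₀ → ℝ → ℝ) : Prop :=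
  Tame (fun i => i.sp ^ k) f

namespace LineBounds

open Line

variable {D : Design} {M δ σ cr q₀ κm κm' : ℝ} {hb : LineBounds D M δ σ cr q₀ κm κm'}

theorem TameP.mul {k l m : ℤ} {f₁ f₂ : Line D M δ σ cr q₀ → ℝ → ℝ} (h₁ : hb.TameP k f₁)
    (h₂ : hb.TameP l f₂) (hm : k + l = m) : hb.TameP m (fun i t => f₁ i t * f₂ i t) := by
  subst hm
  exact (Tame.mul h₁ h₂).weight_congr fun i => (zpow_add₀ (sp_pos hb i).ne' k l).symm

/-- On the whole family `u_td ≥ q₀ > 0`, so a larger power of `u_td` dominates a smaller one up to a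
constant. -/
theorem TameP.mono {k l : ℤ} {f : Line D M δ σ cr q₀ → ℝ → ℝ} (h : hb.TameP k f)
    (hkl : k ≤ l) : hb.TameP l f := by
  refine Tame.mono h ((q₀⁻¹) ^ (l - k)) (fun i => ?_) (fun i => (zpow_pos (sp_pos hb i) l).le)
  have h0 := sp_pos hb i
  have h1 : i.sp ^ l = i.sp ^ (l - k) * i.sp ^ k := by
    rw [← zpow_add₀ h0.ne']; congr 1; ring
  have h2 : 1 ≤ (q₀⁻¹ * i.sp) ^ (l - k) := by
    apply one_le_zpow₀
    · rw [inv_mul_eq_div, le_div_iff₀ hb.q₀_pos, one_mul]; exact le_sp i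
    · omega
  rw [h1, ← mul_assoc, ← mul_zpow]
  nlinarith [zpow_pos h0 k]

theorem TameP.of_one {f : Line D M δ σ cr q₀ → ℝ → ℝ} (h : Tame (fun _ => (1 : ℝ)) f) :
    hb.TameP 0 f := Tame.weight_congr h fun _ => (zpow_zero _).symm

theorem TameP.to_one {f : Line D M δ σ cr q₀ → ℝ → ℝ} (h : hb.TameP 0 f) :
    Tame (fun _ => (1 : ℝ)) f := Tame.weight_congr h fun _ => zpow_zero _

theorem TameP.const (a : ℝ) : hb.TameP 0 (fun _ _ => a) := TameP.of_one (Tame.const a)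

theorem TameP.congr {k : ℤ} {f₁ f₂ : Line D M δ σ cr q₀ → ℝ → ℝ} (h : hb.TameP k f₁)
    (h₂ : ∀ i t, f₁ i t = f₂ i t) : hb.TameP k f₂ := by
  obtain rfl : f₁ = f₂ := funext fun i => funext fun t => h₂ i t
  exact h

theorem TameP.add {k : ℤ} {f₁ f₂ : Line D M δ σ cr q₀ → ℝ → ℝ} (h₁ : hb.TameP k f₁)
    (h₂ : hb.TameP k f₂) : hb.TameP k (fun i t => f₁ i t + f₂ i t) := Tame.add h₁ h₂

theorem TameP.sub {k : ℤ} {f₁ f₂ : Line D M δ σ cr q₀ → ℝ → ℝ} (h₁ : hb.TameP k f₁)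
    (h₂ : hb.TameP k f₂) : hb.TameP k (fun i t => f₁ i t - f₂ i t) := Tame.sub h₁ h₂

theorem TameP.neg {k : ℤ} {f : Line D M δ σ cr q₀ → ℝ → ℝ} (h : hb.TameP k f) :
    hb.TameP k (fun i t => -f i t) := Tame.neg h

theorem TameP.inv {k l : ℤ} {f : Line D M δ σ cr q₀ → ℝ → ℝ} {a : ℝ} (h : hb.TameP k f)
    (ha : 0 < a) (hl : ∀ i, a * i.sp ^ k ≤ |f i 0|) (hkl : l = -k) :
    hb.TameP l (fun i t => (f i t)⁻¹) := by
  subst hkl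
  exact (Tame.inv h ha (fun i => zpow_pos (sp_pos hb i) k) hl).weight_congr
    fun i => (zpow_neg _ _).symm

theorem TameP.abs_le {k : ℤ} {f : Line D M δ σ cr q₀ → ℝ → ℝ} (h : hb.TameP k f) :
    ∃ C, 0 ≤ C ∧ ∀ i, |f i 0| ≤ C * i.sp ^ k := by
  obtain ⟨C, hC, h⟩ := h
  exact ⟨C, hC, fun i => (h i).2.1⟩

section

set_option linter.unusedSectionVars false
variable (hb)
include hb

theorem tame_v : hb.TameP 1 (c 1) := by
  refine tame_c 1 (max 1 q₀⁻¹) (by positivity) (fun i => ?_) (fun i => ?_)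
  · have h0 := sp_pos hb i
    rw [zpow_one]
    calc |i.ξ 1| ≤ 1 * i.sp := by rw [one_mul]; exact abs_le_ut_right _ _
      _ ≤ _ := by gcongr; exact le_max_left _ _
  · have h0 := sp_pos hb i
    rw [zpow_one]
    calc 1 ≤ q₀⁻¹ * i.sp := by
          rw [inv_mul_eq_div, le_div_iff₀ hb.q₀_pos, one_mul]; exact le_sp i
      _ ≤ _ := by gcongr; exact le_max_right _ _

theorem tame_u : hb.TameP 0 (c 2) :=
  .of_one (tame_c_one 2 fun i => i.u_le)

theorem tame_q : hb.TameP 0 (c 3) :=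
  .of_one (tame_c_one 3 fun i => i.q_le)

theorem tame_q' : hb.TameP 0 (c 4) :=
  .of_one (tame_c_one 4 fun i => i.q'_le)

theorem tame_A : hb.TameP 0 (c 5) :=
  .of_one (tame_c_one 5 fun i => i.A_le)

theorem tame_N : hb.TameP 0 (c 6) :=
  .of_one (tame_c_one 6 fun i => i.N_le.trans (by
    have h1 := q_pos hb i
    have h2 := (le_abs_self _).trans i.q_le
    nlinarith [hb.δ_lt]))

theorem tame_x : hb.TameP 0 (c 8) :=
  .of_one (tame_c_one 8 fun i => i.x_le)

theorem tame_ex : hb.TameP 0 (c 10) :=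
  .of_one (tame_c_one 10 fun i => i.ex_le)

theorem tame_ey : hb.TameP 0 (c 11) :=
  .of_one (tame_c_one 11 fun i => i.ey_le)

/-- A bounded function with bounded derivative of a coordinate. -/
theorem tame_comp {f : ℝ → ℝ} {K K' : ℝ} (j : Fin 12) (hf : Differentiable ℝ f)
    (h1 : ∀ a, |f a| ≤ K) (h2 : ∀ a, |deriv f a| ≤ K') :
    hb.TameP 0 (fun i t => f (c j i t)) := by
  have hK := (abs_nonneg _).trans (h1 0)
  refine TameP.of_one ⟨max K K', le_max_of_le_left hK, fun i => ?_⟩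
  have hd : HasDerivAt (fun t => f (c j i t)) (deriv f (c j i 0) * i.w j) 0 :=
    (hf _).hasDerivAt.comp (0 : ℝ) (hasDerivAt_c j i 0)
  refine ⟨hd.differentiableAt, ?_, ?_⟩
  · rw [mul_one]; exact (h1 _).trans (le_max_left _ _)
  · rw [hd.deriv, abs_mul, mul_one]
    calc _ ≤ K' * 1 := mul_le_mul (h2 _) (i.w_le j) (abs_nonneg _) ((abs_nonneg _).trans (h2 0))
      _ ≤ _ := by rw [mul_one]; exact le_max_right _ _

theorem tame_κ : hb.TameP 0
    (fun i t => D.P.κ (c 0 i t)) :=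
  hb.tame_comp 0 (D.P.contDiff_κ.differentiable (by simp)) hb.κ_le hb.κ'_le

theorem tame_sin (j : Fin 12) : hb.TameP 0
    (fun i t => Real.sin (c j i t)) :=
  hb.tame_comp j Real.differentiable_sin Real.abs_sin_le_one
    (fun a => by rw [Real.deriv_sin]; exact Real.abs_cos_le_one a)

theorem tame_cos (j : Fin 12) : hb.TameP 0
    (fun i t => Real.cos (c j i t)) :=
  hb.tame_comp j Real.differentiable_cos Real.abs_cos_le_one
    (fun a => by rw [Real.deriv_cos, abs_neg]; exact Real.abs_sin_le_one a)

theorem tame_sinγ : hb.TameP 0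
    (fun i t => Real.sin (D.P.γ (c 0 i t))) := by
  have hγ := D.P.smooth_γ.differentiable (by simp)
  refine hb.tame_comp (f := fun a => Real.sin (D.P.γ a)) (K' := κm) 0 hγ.sin
    (fun a => Real.abs_sin_le_one _) (fun a => ?_)
  rw [deriv_sin (hγ a), abs_mul]
  calc _ ≤ 1 * κm := mul_le_mul (Real.abs_cos_le_one _) (hb.κ_le a) (abs_nonneg _) zero_le_one
    _ = κm := one_mul _

theorem tame_cosγ : hb.TameP 0
    (fun i t => Real.cos (D.P.γ (c 0 i t))) := by
  have hγ := D.P.smooth_γ.differentiable (by simp)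
  refine hb.tame_comp (f := fun a => Real.cos (D.P.γ a)) (K' := κm) 0 hγ.cos
    (fun a => Real.abs_cos_le_one _) (fun a => ?_)
  rw [deriv_cos (hγ a), abs_mul, abs_neg]
  calc _ ≤ 1 * κm := mul_le_mul (Real.abs_sin_le_one _) (hb.κ_le a) (abs_nonneg _) zero_le_one
    _ = κm := one_mul _

theorem tame_ut : hb.TameP 1 (fun i t => ut (c 3 i t) (c 1 i t)) := by
  have hq : hb.TameP 1 (c 3) := hb.tame_q.mono (by norm_num)
  have h1 := hq.mul hq (m := 2) rfl
  have h2 := hb.tame_v.mul hb.tame_v (m := 2) rfl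
  have h3 := Tame.sqrt (c := 1) (w := fun i : Line D M δ σ cr q₀ => i.sp)
    ((Tame.add h1 h2).weight_congr fun i => by norm_cast) one_pos (sp_pos hb) (fun i => ?_)
  · have e : (fun (i : Line D M δ σ cr q₀) t => ut (c 3 i t) (c 1 i t))
        = fun i t => √(c 3 i t * c 3 i t + c 1 i t * c 1 i t) := by
      funext i t
      rw [ut, sq, sq]
    rw [e]
    exact h3.weight_congr fun i => (zpow_one _).symm
  · rw [c_zero, c_zero, one_mul, sp, ut_sq]
    exact le_of_eq (by ring)

theorem tame_inv_ut : hb.TameP (-1) (fun i t => (ut (c 3 i t) (c 1 i t))⁻¹) := by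
  refine hb.tame_ut.inv one_pos (fun i => ?_) rfl
  rw [c_zero, c_zero, zpow_one, one_mul]
  exact le_abs_self _

theorem tame_relN : hb.TameP (-1) (fun i t => relN (c 1 i t) (c 3 i t) (c 6 i t)) :=
  (hb.tame_N.mul hb.tame_inv_ut (by norm_num)).congr fun _ _ => (div_eq_mul_inv _ _).symm

theorem tame_one_sub_sq :
    hb.TameP 0 (fun i t => 1 - relN (c 1 i t) (c 3 i t) (c 6 i t) ^ 2) := by
  have h := hb.tame_relN.mono (l := 0) (by norm_num)
  exact ((TameP.const 1).sub (h.mul h (m := 0) rfl)).congr fun i t => by rw [sq]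

/-- The normal error is unrestricted in the family, so it is measured against `ρ = √(Δ² + y²)`. In
the control law these powers of `ρ` are compensated by those of `gI` and `1 / gQ`, which leaves
weights in `u_td` alone. -/
theorem tame_y : Tame Line.ρ (c (D := D) (M := M) (δ := δ) (σ := σ) (cr := cr) (q₀ := q₀) 7) := by
  have hΔ := D.k.Δ_pos
  refine tame_c 7 (max 1 D.k.Δ⁻¹) (by positivity) (fun i => ?_) (fun i => ?_)
  · have h0 := i.ρ_pos
    calc |i.ξ 7| ≤ 1 * i.ρ := by
          rw [one_mul]; exact Real.abs_le_sqrt (by nlinarith)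
      _ ≤ _ := by gcongr; exact le_max_left _ _
  · have h0 := i.ρ_pos
    calc 1 ≤ D.k.Δ⁻¹ * i.ρ := by
          rw [inv_mul_eq_div, le_div_iff₀ hΔ, one_mul]
          exact Real.le_sqrt_of_sq_le (by nlinarith [sq_nonneg (i.ξ 7)])
      _ ≤ _ := by gcongr; exact le_max_right _ _

theorem one_le_ρ (i : Line D M δ σ cr q₀) : 1 ≤ D.k.Δ⁻¹ * i.ρ := by
  rw [inv_mul_eq_div, le_div_iff₀ D.k.Δ_pos, one_mul]
  exact Real.le_sqrt_of_sq_le (by nlinarith [sq_nonneg (i.ξ 7)])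

theorem gQ_sq_ge (i : Line D M δ σ cr q₀) :
    (1 - δ ^ 2) * i.ρ ^ 2
      ≤ i.ξ 7 ^ 2 + D.k.Δ ^ 2 * (1 - relN (i.ξ 1) (i.ξ 3) (i.ξ 6) ^ 2) := by
  have h1 := relN_sq_le hb i
  rw [ρ_sq]
  nlinarith [sq_nonneg (i.ξ 7), sq_nonneg D.k.Δ, mul_nonneg (sq_nonneg D.k.Δ) (sub_nonneg.2 h1),
    mul_nonneg (sq_nonneg δ) (sq_nonneg (i.ξ 7))]

theorem tame_gQ : Tame Line.ρ (fun (i : Line D M δ σ cr q₀) t =>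
    gQ D.k.Δ (c 1 i t) (c 3 i t) (c 6 i t) (c 7 i t)) := by
  have h1 : Tame (fun i : Line D M δ σ cr q₀ => i.ρ ^ 2) (fun i t => c 7 i t * c 7 i t) :=
    (hb.tame_y.mul hb.tame_y).weight_congr fun i => (sq _).symm
  have h2 : Tame (fun i : Line D M δ σ cr q₀ => i.ρ ^ 2) (fun i t =>
      D.k.Δ ^ 2 * (1 - relN (c 1 i t) (c 3 i t) (c 6 i t) ^ 2)) := by
    refine (((TameP.const (D.k.Δ ^ 2)).mul hb.tame_one_sub_sq (m := 0) rfl).to_one).mono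
      ((D.k.Δ⁻¹) ^ 2) (fun i => ?_) (fun i => by positivity)
    rw [← mul_pow]
    exact one_le_pow₀ (hb.one_le_ρ i)
  have h3 := (h1.add h2).sqrt (c := 1 - δ ^ 2) (by linarith [δ_sq_lt hb]) Line.ρ_pos
    (fun i => by
      have := hb.gQ_sq_ge i
      simp only [c_zero]
      linarith)
  simp only [← sq] at h3
  exact h3

theorem gQ_ge (i : Line D M δ σ cr q₀) :
    √(1 - δ ^ 2) * i.ρ ≤ gQ D.k.Δ (i.ξ 1) (i.ξ 3) (i.ξ 6) (i.ξ 7) := by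
  refine Real.le_sqrt_of_sq_le ?_
  rw [mul_pow, Real.sq_sqrt (by linarith [δ_sq_lt hb])]
  exact hb.gQ_sq_ge i

theorem gQ_le (i : Line D M δ σ cr q₀) :
    gQ D.k.Δ (i.ξ 1) (i.ξ 3) (i.ξ 6) (i.ξ 7) ≤ i.ρ := by
  refine Real.sqrt_le_sqrt ?_
  nlinarith [mul_nonneg (sq_nonneg D.k.Δ) (sq_nonneg (relN (i.ξ 1) (i.ξ 3) (i.ξ 6)))]

/-- `(Q - y * n) * (Q + y * n) = (1 - n ^ 2) * ρ ^ 2`, and the first factor is at most `2 * ρ`. Thus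
the sum stays comparable to `ρ` even when `y * n` is negative. -/
theorem den_ge (i : Line D M δ σ cr q₀) :
    (1 - δ ^ 2) / 2 * i.ρ ≤ i.ξ 7 * relN (i.ξ 1) (i.ξ 3) (i.ξ 6)
      + gQ D.k.Δ (i.ξ 1) (i.ξ 3) (i.ξ 6) (i.ξ 7) := by
  have h0 := i.ρ_pos
  have hr := regular hb i
  have h1 := hr.den_pos (i.ξ 7)
  have h2 := hr.gQ_sq (i.ξ 7)
  have h3 := hb.gQ_le i
  have h4 := relN_sq_le hb i
  have h5 := hr.relN_sq_lt
  have h6 := i.ρ_sq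
  set n := relN (i.ξ 1) (i.ξ 3) (i.ξ 6)
  set Q := gQ D.k.Δ (i.ξ 1) (i.ξ 3) (i.ξ 6) (i.ξ 7)
  have h7 : Q - i.ξ 7 * n ≤ 2 * i.ρ := by
    have : |i.ξ 7 * n| ≤ i.ρ := by
      refine abs_le_of_sq_le_sq ?_ h0.le
      rw [h6, mul_pow]
      nlinarith [sq_nonneg (i.ξ 7), sq_nonneg D.k.Δ]
    linarith [(abs_le.1 this).1]
  have h8 : (Q - i.ξ 7 * n) * (i.ξ 7 * n + Q) = (1 - n ^ 2) * i.ρ ^ 2 := by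
    rw [h6]; linear_combination h2
  have h9 : (1 - δ ^ 2) * i.ρ ^ 2 ≤ 2 * i.ρ * (i.ξ 7 * n + Q) := by
    calc (1 - δ ^ 2) * i.ρ ^ 2 ≤ (1 - n ^ 2) * i.ρ ^ 2 := by gcongr
      _ = (Q - i.ξ 7 * n) * (i.ξ 7 * n + Q) := h8.symm
      _ ≤ _ := by gcongr
  have h10 : i.ρ * ((1 - δ ^ 2) / 2 * i.ρ) ≤ i.ρ * (i.ξ 7 * n + Q) := by linarith
  exact le_of_mul_le_mul_left h10 h0

theorem tame_gI : Tame (fun i => (Line.ρ i)⁻¹) (fun (i : Line D M δ σ cr q₀) t =>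
    gI D.k.Δ (c 1 i t) (c 3 i t) (c 6 i t) (c 7 i t)) := by
  have h1 := (hb.tame_y.mul (hb.tame_relN.mono (l := 0) (by norm_num)).to_one).weight_congr
    fun i => mul_one _
  have h2 := (h1.add hb.tame_gQ).inv (c := (1 - δ ^ 2) / 2) (by linarith [δ_sq_lt hb])
    Line.ρ_pos (fun i => by
      simp only [c_zero]
      exact (hb.den_ge i).trans (le_abs_self _))
  exact (hb.tame_one_sub_sq.to_one.mul h2).weight_congr fun i => one_mul _

theorem of_inv_ρ {f : Line D M δ σ cr q₀ → ℝ → ℝ} (h : Tame (fun i => (Line.ρ i)⁻¹) f) :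
    hb.TameP 0 f := by
  refine TameP.of_one (h.mono D.k.Δ⁻¹ (fun i => ?_) fun _ => zero_le_one)
  rw [mul_one]
  refine inv_anti₀ D.k.Δ_pos (Real.le_sqrt_of_sq_le ?_)
  nlinarith [sq_nonneg (i.ξ 7)]

theorem tame_gI' : hb.TameP 0 (fun i t => gI D.k.Δ (c 1 i t) (c 3 i t) (c 6 i t) (c 7 i t)) :=
  hb.of_inv_ρ hb.tame_gI

theorem tame_Δ_div_gQ :
    hb.TameP 0 (fun i t => D.k.Δ / gQ D.k.Δ (c 1 i t) (c 3 i t) (c 6 i t) (c 7 i t)) := by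
  have h1 := hb.tame_gQ.inv (c := √(1 - δ ^ 2)) (Real.sqrt_pos.2 (by linarith [δ_sq_lt hb]))
    Line.ρ_pos (fun i => by
      simp only [c_zero]
      exact (hb.gQ_ge i).trans (le_abs_self _))
  exact (TameP.const D.k.Δ).mul (hb.of_inv_ρ h1) rfl

theorem tame_sinLos : hb.TameP 0 (fun i t =>
    c 7 i t * gI D.k.Δ (c 1 i t) (c 3 i t) (c 6 i t) (c 7 i t)
      + relN (c 1 i t) (c 3 i t) (c 6 i t)) :=
  (TameP.of_one ((hb.tame_y.mul hb.tame_gI).weight_congr fun i =>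
    mul_inv_cancel₀ i.ρ_pos.ne')).add (hb.tame_relN.mono (by norm_num))

theorem tame_cosLos : hb.TameP 0 (fun i t =>
    D.k.Δ * gI D.k.Δ (c 1 i t) (c 3 i t) (c 6 i t) (c 7 i t)) :=
  (TameP.const D.k.Δ).mul hb.tame_gI' rfl

theorem tame_courseCos : hb.TameP 0 (fun i t =>
    courseCos D.k.Δ (c 1 i t) (c 3 i t) (c 6 i t) (c 7 i t)
      (Real.cos (c 9 i t)) (Real.sin (c 9 i t))) :=
  ((hb.tame_cos 9).mul hb.tame_cosLos rfl).add ((hb.tame_sin 9).mul hb.tame_sinLos rfl)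

theorem tame_courseSin : hb.TameP 0 (fun i t =>
    courseSin D.k.Δ (c 1 i t) (c 3 i t) (c 6 i t) (c 7 i t)
      (Real.cos (c 9 i t)) (Real.sin (c 9 i t))) :=
  ((hb.tame_sin 9).mul hb.tame_cosLos rfl).sub ((hb.tame_cos 9).mul hb.tame_sinLos rfl)

theorem tame_q_div : hb.TameP 0 (fun i t => c 3 i t / ut (c 3 i t) (c 1 i t)) :=
  ((hb.tame_q.mul hb.tame_inv_ut (m := -1) rfl).mono (by norm_num)).congr
    fun _ _ => (div_eq_mul_inv _ _).symm

theorem tame_v_div : hb.TameP 0 (fun i t => c 1 i t / ut (c 3 i t) (c 1 i t)) :=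
  (hb.tame_v.mul hb.tame_inv_ut (m := 0) rfl).congr fun _ _ => (div_eq_mul_inv _ _).symm

theorem tame_headCos : hb.TameP 0 (fun i t =>
    headCos D.k.Δ (c 1 i t) (c 3 i t) (c 6 i t) (c 7 i t)
      (Real.cos (c 9 i t)) (Real.sin (c 9 i t))) :=
  (hb.tame_courseCos.mul hb.tame_q_div rfl).add (hb.tame_courseSin.mul hb.tame_v_div rfl)

theorem tame_headSin : hb.TameP 0 (fun i t =>
    headSin D.k.Δ (c 1 i t) (c 3 i t) (c 6 i t) (c 7 i t)
      (Real.cos (c 9 i t)) (Real.sin (c 9 i t))) :=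
  (hb.tame_courseSin.mul hb.tame_q_div rfl).sub (hb.tame_courseCos.mul hb.tame_v_div rfl)

/-- Along a line the derivative of `1 - κ y` contains `κ' * y` times the `θ`-component of the
direction. Since `y` is not bounded, this is where `Line.yw_le` is needed. -/
theorem tame_inv_tube : hb.TameP 0 (fun i t => (1 - D.P.κ (c 0 i t) * c 7 i t)⁻¹) := by
  have hd : ∀ i : Line D M δ σ cr q₀, HasDerivAt (fun t => 1 - D.P.κ (c 0 i t) * c 7 i t)
      (-(deriv D.P.κ (i.ξ 0) * i.w 0 * i.ξ 7 + D.P.κ (i.ξ 0) * i.w 7)) 0 := by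
    intro i
    have h1 := ((D.P.contDiff_κ.differentiable (by simp)) (c 0 i 0)).hasDerivAt.comp (0 : ℝ)
      (hasDerivAt_c 0 i 0)
    have h2 := (h1.mul (hasDerivAt_c 7 i 0)).const_sub 1
    simp only [Function.comp, c_zero] at h2
    exact h2
  have h := Tame.inv' (w := fun _ : Line D M δ σ cr q₀ => (1 : ℝ))
    (f := fun i t => 1 - D.P.κ (c 0 i t) * c 7 i t) (C := κm' * M + κm) (c := σ) hb.σ_pos
    (by
      have h1 := (abs_nonneg _).trans (hb.κ_le 0)
      have h2 := (abs_nonneg _).trans (hb.κ'_le 0)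
      have h3 := hb.M_pos
      positivity) (fun _ => one_pos) (fun i => ⟨(hd i).differentiableAt, ?_, ?_⟩)
  · exact TameP.of_one (h.weight_congr fun _ => inv_one)
  · rw [(hd i).deriv, abs_neg, mul_one]
    refine (abs_add_le _ _).trans (add_le_add ?_ ?_)
    · rw [mul_assoc, abs_mul, mul_comm (i.w 0)]
      exact mul_le_mul (hb.κ'_le _) i.yw_le (abs_nonneg _)
        ((abs_nonneg _).trans (hb.κ'_le 0))
    · rw [abs_mul]
      calc _ ≤ κm * 1 := mul_le_mul (hb.κ_le _) (i.w_le 7) (abs_nonneg _)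
            ((abs_nonneg _).trans (hb.κ_le 0))
        _ = κm := mul_one _
  · simp only [c_zero, mul_one]
    exact i.tube.trans (le_abs_self _)

theorem tame_s : hb.TameP 1 (fun i t =>
    sForm D (D.P.κ (c 0 i t)) (c 1 i t) (c 2 i t) (c 3 i t) (c 5 i t) (c 6 i t) (c 7 i t)
      (c 8 i t) (Real.cos (c 9 i t)) (Real.sin (c 9 i t))) := by
  have h1 : hb.TameP 1 _ := (((((hb.tame_u.mul hb.tame_headCos (m := 0) rfl).mono
    (by norm_num)).sub (hb.tame_v.mul hb.tame_headSin rfl)).add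
    (hb.tame_A.mono (by norm_num))).add
    (((TameP.const D.k.kδ).mul hb.tame_x (m := 0) rfl).mono (by norm_num)))
  exact (h1.mul hb.tame_inv_tube rfl).congr fun _ _ => (div_eq_mul_inv _ _).symm

theorem tame_VN {s : Line D M δ σ cr q₀ → ℝ → ℝ} (hs : hb.TameP 1 s) : hb.TameP 1 (fun i t =>
    VNForm D (D.P.κ (c 0 i t)) (s i t) (c 5 i t) (c 10 i t) (c 11 i t)
      (Real.sin (D.P.γ (c 0 i t))) (Real.cos (D.P.γ (c 0 i t)))) :=
  (((((TameP.const D.k.kx2).mul hb.tame_ex (m := 0) rfl).neg.mul hb.tame_sinγ (m := 0) rfl).add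
    (((TameP.const D.k.ky2).mul hb.tame_ey (m := 0) rfl).mul hb.tame_cosγ (m := 0) rfl)).mono
    (by norm_num)).sub ((hb.tame_κ.mul hs rfl).mul hb.tame_A rfl)

theorem tame_yForm {s : Line D M δ σ cr q₀ → ℝ → ℝ} (hs : hb.TameP 1 s) :
    hb.TameP 1 (fun i t =>
      yForm D (D.P.κ (c 0 i t)) (s i t) (c 1 i t) (c 2 i t) (c 3 i t) (c 6 i t) (c 7 i t)
        (c 8 i t) (Real.cos (c 9 i t)) (Real.sin (c 9 i t))) :=
  (((hb.tame_ut.mul hb.tame_courseSin rfl).add (hb.tame_N.mono (by norm_num))).add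
    (((hb.tame_u.sub hb.tame_q).mul hb.tame_headSin (m := 0) rfl).mono (by norm_num))).sub
    (hb.tame_x.mul (hb.tame_κ.mul hs rfl) rfl)

theorem tame_X : hb.TameP 0 (fun i t => D.w.X (c 2 i t)) :=
  ((TameP.const _).mul hb.tame_u rfl).add (TameP.const _)

theorem tame_Y : hb.TameP 0 (fun i t => D.w.Y (c 2 i t)) :=
  ((TameP.const _).mul hb.tame_u rfl).sub (TameP.const _)

theorem tame_inv_ut_sq : hb.TameP (-2) (fun i t => (ut (c 3 i t) (c 1 i t) ^ 2)⁻¹) :=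
  (hb.tame_inv_ut.mul hb.tame_inv_ut rfl).congr fun i t => by rw [← mul_inv, sq]

/-- The part of the bracket that stays bounded for large sway velocities. -/
theorem tame_bracket_rest {N' : Line D M δ σ cr q₀ → ℝ → ℝ} (hN : hb.TameP 1 N') :
    hb.TameP 0 (fun i t =>
      (D.w.Y (c 2 i t) * c 1 i t * c 3 i t - c 4 i t * c 1 i t) / ut (c 3 i t) (c 1 i t) ^ 2
      + D.k.Δ / gQ D.k.Δ (c 1 i t) (c 3 i t) (c 6 i t) (c 7 i t) *
        (N' i t / ut (c 3 i t) (c 1 i t)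
          - relN (c 1 i t) (c 3 i t) (c 6 i t) / ut (c 3 i t) (c 1 i t) ^ 2
            * (c 3 i t * c 4 i t + c 1 i t * (D.w.Y (c 2 i t) * c 1 i t)))) := by
  have h1 := ((hb.tame_Y.mul hb.tame_v (m := 1) rfl).mul hb.tame_q (m := 1) rfl).sub
    (hb.tame_q'.mul hb.tame_v (m := 1) rfl)
  have h2 := (h1.mul hb.tame_inv_ut_sq (m := -1) rfl).mono (l := 0) (by norm_num)
  have h3 := hN.mul hb.tame_inv_ut (m := 0) rfl
  have h4 := ((hb.tame_q.mul hb.tame_q' (m := 0) rfl).mono (l := 2) (by norm_num)).add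
    (hb.tame_v.mul (hb.tame_Y.mul hb.tame_v (m := 1) rfl) (m := 2) rfl)
  have h5 := ((hb.tame_relN.mul hb.tame_inv_ut_sq (m := -3) rfl).mul h4 (m := -1) rfl).mono
    (l := 0) (by norm_num)
  exact (h2.add (hb.tame_Δ_div_gQ.mul (h3.sub h5) (m := 0) rfl)).congr
    fun i t => by simp only [div_eq_mul_inv]

theorem tame_bracket {s N' yK : Line D M δ σ cr q₀ → ℝ → ℝ} (hs : hb.TameP 1 s)
    (hN : hb.TameP 1 N') (hy : hb.TameP 1 yK) : hb.TameP 1 (fun i t =>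
      bracketForm D (D.P.κ (c 0 i t)) (s i t) (N' i t) (yK i t) (c 1 i t) (c 2 i t) (c 3 i t)
        (c 4 i t) (c 6 i t) (c 7 i t)) := by
  have h1 := (hb.tame_bracket_rest hN).mono (l := 1) (by norm_num)
  have h2 := hb.tame_Δ_div_gQ.mul (hy.mul hb.tame_gI' (m := 1) rfl) (m := 1) rfl
  exact (((hb.tame_κ.mul hs (m := 1) rfl).neg.add h1).add h2).congr fun i t => by
    rw [bracketForm]; ring

/-- `C_r` tends to `1` quadratically as the speed grows. For this reason the division by `C_r` does
not change the slope of `r_d` in the sway velocity. -/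
theorem tame_Cr_sub_one : hb.TameP (-2) (fun i t =>
    CrForm D (c 1 i t) (c 2 i t) (c 3 i t) (c 6 i t) (c 7 i t) - 1) := by
  have h1 := (hb.tame_X.mul hb.tame_q (m := 0) rfl).mul hb.tame_inv_ut_sq (m := -2) rfl
  have h2 := ((hb.tame_relN.mul hb.tame_inv_ut_sq (m := -3) rfl).mul hb.tame_Δ_div_gQ
    (m := -3) rfl).mul (hb.tame_v.mul hb.tame_X (m := 1) rfl) (m := -2) rfl
  exact (h1.sub h2).congr fun i t => by rw [CrForm]; simp only [div_eq_mul_inv]; ring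

theorem tame_Cr : hb.TameP 0 (fun i t =>
    CrForm D (c 1 i t) (c 2 i t) (c 3 i t) (c 6 i t) (c 7 i t)) :=
  ((hb.tame_Cr_sub_one.mono (l := 0) (by norm_num)).add (TameP.const 1)).congr
    fun i t => sub_add_cancel _ _

theorem Cr_ge (i : Line D M δ σ cr q₀) :
    cr ≤ |CrForm D (i.ξ 1) (i.ξ 2) (i.ξ 3) (i.ξ 6) (i.ξ 7)| := by
  rw [← Cr_eq_form (regular hb i)]
  exact i.Cr_ge

theorem tame_rdForm : hb.TameP 1 (fun i t =>
    rdForm D (D.P.κ (c 0 i t)) (Real.sin (D.P.γ (c 0 i t))) (Real.cos (D.P.γ (c 0 i t)))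
      (c 1 i t) (c 2 i t) (c 3 i t) (c 4 i t) (c 5 i t) (c 6 i t) (c 7 i t) (c 8 i t)
      (Real.cos (c 9 i t)) (Real.sin (c 9 i t)) (c 10 i t) (c 11 i t)) := by
  have h1 := hb.tame_bracket hb.tame_s (hb.tame_VN hb.tame_s) (hb.tame_yForm hb.tame_s)
  have h2 := hb.tame_Cr.inv hb.cr_pos (fun i => by
    simp only [c_zero, zpow_zero, mul_one]
    exact hb.Cr_ge i) (l := 0) rfl
  exact (h1.neg.mul h2 (m := 1) rfl).congr fun _ _ => (div_eq_mul_inv _ _).symm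

end

end LineBounds

/-! ## Smoothness of the desired yaw rate -/

/-- The arguments of `r_d` at which the control law is well defined. -/
structure Good (D : Design) (ξ : Fin 12 → ℝ) : Prop where
  reg : Regular D.k.Δ (ξ 1) (ξ 3) (ξ 6)
  tube : 1 - D.P.κ (ξ 0) * ξ 7 ≠ 0
  Cr : Cr D (ξ 1) (ξ 2) (ξ 3) (ξ 6) (ξ 7) ≠ 0

section Smooth

variable {E : Type*} [NormedAddCommGroup E] [NormedSpace ℝ E] {n : WithTop ℕ∞} {p : E}
  {Δ : ℝ} {v q N y ce se : E → ℝ}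

theorem contDiffAt_ut (hv : ContDiffAt ℝ n v p) (hq : ContDiffAt ℝ n q p) (h0 : 0 < q p) :
    ContDiffAt ℝ n (fun a => ut (q a) (v a)) p :=
  ((hq.pow 2).add (hv.pow 2)).sqrt (by have := sq_nonneg (v p); positivity)

variable (h : Regular Δ (v p) (q p) (N p)) (hv : ContDiffAt ℝ n v p) (hq : ContDiffAt ℝ n q p)
  (hN : ContDiffAt ℝ n N p) (hy : ContDiffAt ℝ n y p) (hc : ContDiffAt ℝ n ce p)
  (hs : ContDiffAt ℝ n se p)

include h hv hq hN

theorem contDiffAt_relN : ContDiffAt ℝ n (fun a => relN (v a) (q a) (N a)) p :=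
  hN.div (contDiffAt_ut hv hq h.q_pos) (ut_pos _ h.q_pos).ne'

include hy

theorem contDiffAt_gQ : ContDiffAt ℝ n (fun a => gQ Δ (v a) (q a) (N a) (y a)) p := by
  have h1 := h.gQ_pos (y p)
  refine ((hy.pow 2).add (contDiffAt_const.mul
    (contDiffAt_const.sub ((contDiffAt_relN h hv hq hN).pow 2)))).sqrt ?_
  exact (Real.sqrt_pos.1 h1).ne'

theorem contDiffAt_gI : ContDiffAt ℝ n (fun a => gI Δ (v a) (q a) (N a) (y a)) p :=
  (contDiffAt_const.sub ((contDiffAt_relN h hv hq hN).pow 2)).div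
    ((hy.mul (contDiffAt_relN h hv hq hN)).add (contDiffAt_gQ h hv hq hN hy))
    (h.den_pos (y p)).ne'

include hc hs

theorem contDiffAt_courseCos :
    ContDiffAt ℝ n (fun a => courseCos Δ (v a) (q a) (N a) (y a) (ce a) (se a)) p :=
  (hc.mul (contDiffAt_const.mul (contDiffAt_gI h hv hq hN hy))).add
    (hs.mul ((hy.mul (contDiffAt_gI h hv hq hN hy)).add (contDiffAt_relN h hv hq hN)))

theorem contDiffAt_courseSin :
    ContDiffAt ℝ n (fun a => courseSin Δ (v a) (q a) (N a) (y a) (ce a) (se a)) p :=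
  (hs.mul (contDiffAt_const.mul (contDiffAt_gI h hv hq hN hy))).sub
    (hc.mul ((hy.mul (contDiffAt_gI h hv hq hN hy)).add (contDiffAt_relN h hv hq hN)))

theorem contDiffAt_headCos :
    ContDiffAt ℝ n (fun a => headCos Δ (v a) (q a) (N a) (y a) (ce a) (se a)) p :=
  ((contDiffAt_courseCos h hv hq hN hy hc hs).mul
    (hq.div (contDiffAt_ut hv hq h.q_pos) (ut_pos _ h.q_pos).ne')).add
  ((contDiffAt_courseSin h hv hq hN hy hc hs).mul
    (hv.div (contDiffAt_ut hv hq h.q_pos) (ut_pos _ h.q_pos).ne'))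

theorem contDiffAt_headSin :
    ContDiffAt ℝ n (fun a => headSin Δ (v a) (q a) (N a) (y a) (ce a) (se a)) p :=
  ((contDiffAt_courseSin h hv hq hN hy hc hs).mul
    (hq.div (contDiffAt_ut hv hq h.q_pos) (ut_pos _ h.q_pos).ne')).sub
  ((contDiffAt_courseCos h hv hq hN hy hc hs).mul
    (hv.div (contDiffAt_ut hv hq h.q_pos) (ut_pos _ h.q_pos).ne'))

end Smooth

theorem contDiff_X (w : Vessel) {n : WithTop ℕ∞} : ContDiff ℝ n w.X := by
  unfold Vessel.X
  fun_prop

theorem contDiff_Y (w : Vessel) {n : WithTop ℕ∞} : ContDiff ℝ n w.Y := by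
  unfold Vessel.Y
  fun_prop

/-- The closed form of `r_d` on `ℝ¹²`. -/
def rdFormVec (D : Design) (ξ : Fin 12 → ℝ) : ℝ :=
  rdForm D (D.P.κ (ξ 0)) (Real.sin (D.P.γ (ξ 0))) (Real.cos (D.P.γ (ξ 0)))
      (ξ 1) (ξ 2) (ξ 3) (ξ 4) (ξ 5) (ξ 6) (ξ 7) (ξ 8)
      (Real.cos (ξ 9)) (Real.sin (ξ 9)) (ξ 10) (ξ 11)

theorem rdVec_eq_form {D : Design} {ξ : Fin 12 → ℝ} (h : Regular D.k.Δ (ξ 1) (ξ 3) (ξ 6)) :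
    rdVec D ξ = rdFormVec D ξ := rd_eq_form h _ _ _ _ _ _ _ _ _

theorem isOpen_regular (Δ : ℝ) :
    IsOpen {ξ : Fin 12 → ℝ | Regular Δ (ξ 1) (ξ 3) (ξ 6)} := by
  by_cases hΔ : 0 < Δ
  · have e : {ξ : Fin 12 → ℝ | Regular Δ (ξ 1) (ξ 3) (ξ 6)}
        = {ξ | 0 < ξ 3} ∩ {ξ | ξ 6 ^ 2 < ξ 3 ^ 2 + ξ 1 ^ 2} := by
      ext ξ
      exact ⟨fun h => ⟨h.q_pos, h.N_lt⟩, fun h => ⟨hΔ, h.1, h.2⟩⟩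
    rw [e]
    exact (isOpen_lt (by fun_prop) (by fun_prop)).inter (isOpen_lt (by fun_prop) (by fun_prop))
  · convert isOpen_empty
    ext ξ
    simp only [Set.mem_ofPred_eq, Set.mem_empty_iff_false, iff_false]
    exact fun h => hΔ h.Δ_pos

theorem contDiffAt_CrForm {D : Design} {ξ : Fin 12 → ℝ} (h : Regular D.k.Δ (ξ 1) (ξ 3) (ξ 6))
    {n : WithTop ℕ∞} : ContDiffAt ℝ n
      (fun ξ : Fin 12 → ℝ => CrForm D (ξ 1) (ξ 2) (ξ 3) (ξ 6) (ξ 7)) ξ := by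
  have c : ∀ j, ContDiffAt ℝ n (fun ξ : Fin 12 → ℝ => ξ j) ξ := fun j => by fun_prop
  have hut := contDiffAt_ut (c 1) (c 3) h.q_pos
  have hut0 := (ut_pos (ξ 1) h.q_pos).ne'
  have hX : ContDiffAt ℝ n (fun ξ : Fin 12 → ℝ => D.w.X (ξ 2)) ξ :=
    (contDiff_X D.w).contDiffAt.comp ξ (c 2)
  exact (contDiffAt_const.add ((hX.mul (c 3)).div (hut.pow 2) (pow_ne_zero 2 hut0))).sub
    ((((contDiffAt_relN h (c 1) (c 3) (c 6)).div (hut.pow 2) (pow_ne_zero 2 hut0)).mul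
      (contDiffAt_const.div (contDiffAt_gQ h (c 1) (c 3) (c 6) (c 7)) (h.gQ_pos _).ne')).mul
      ((c 1).mul hX))

theorem eventually_regular {D : Design} {ξ : Fin 12 → ℝ}
    (h : Regular D.k.Δ (ξ 1) (ξ 3) (ξ 6)) :
    ∀ᶠ η : Fin 12 → ℝ in nhds ξ, Regular D.k.Δ (η 1) (η 3) (η 6) :=
  (isOpen_regular D.k.Δ).eventually_mem h

theorem contDiffAt_Cr {D : Design} {ξ : Fin 12 → ℝ} (h : Regular D.k.Δ (ξ 1) (ξ 3) (ξ 6))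
    {n : WithTop ℕ∞} : ContDiffAt ℝ n
      (fun ξ : Fin 12 → ℝ => Cr D (ξ 1) (ξ 2) (ξ 3) (ξ 6) (ξ 7)) ξ :=
  (contDiffAt_CrForm h).congr_of_eventuallyEq
    ((eventually_regular h).mono fun _ hη => Cr_eq_form hη _ _)

theorem Good.contDiffAt_sForm {D : Design} {ξ : Fin 12 → ℝ} (h : Good D ξ) :
    ContDiffAt ℝ ∞ (fun ξ : Fin 12 → ℝ => sForm D (D.P.κ (ξ 0)) (ξ 1) (ξ 2) (ξ 3) (ξ 5) (ξ 6)
      (ξ 7) (ξ 8) (Real.cos (ξ 9)) (Real.sin (ξ 9))) ξ := by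
  have c : ∀ j, ContDiffAt ℝ ∞ (fun ξ : Fin 12 → ℝ => ξ j) ξ := fun j => by fun_prop
  have hκ : ContDiffAt ℝ ∞ (fun ξ : Fin 12 → ℝ => D.P.κ (ξ 0)) ξ :=
    D.P.contDiff_κ.contDiffAt.comp ξ (c 0)
  have hC := contDiffAt_headCos h.reg (c 1) (c 3) (c 6) (c 7) (c 9).cos (c 9).sin
  have hS := contDiffAt_headSin h.reg (c 1) (c 3) (c 6) (c 7) (c 9).cos (c 9).sin
  exact (((((c 2).mul hC).sub ((c 1).mul hS)).add (c 5)).add (contDiffAt_const.mul (c 8))).div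
    (contDiffAt_const.sub (hκ.mul (c 7))) h.tube

/-- The closed form is smooth where its denominators do not vanish, and it agrees with `r_d` on the
open set of regular arguments. Hence derivatives of `r_d` may be computed from it. -/
theorem Good.contDiffAt_rdVec {D : Design} {ξ : Fin 12 → ℝ} (h : Good D ξ) :
    ContDiffAt ℝ ∞ (rdVec D) ξ := by
  refine ContDiffAt.congr_of_eventuallyEq ?_
    ((eventually_regular h.reg).mono fun _ hη => rdVec_eq_form hη)
  have c : ∀ j, ContDiffAt ℝ ∞ (fun ξ : Fin 12 → ℝ => ξ j) ξ := fun j => by fun_prop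
  have hut := contDiffAt_ut (c 1) (c 3) h.reg.q_pos
  have hut0 := (ut_pos (ξ 1) h.reg.q_pos).ne'
  have hκ : ContDiffAt ℝ ∞ (fun ξ : Fin 12 → ℝ => D.P.κ (ξ 0)) ξ :=
    D.P.contDiff_κ.contDiffAt.comp ξ (c 0)
  have hγ : ContDiffAt ℝ ∞ (fun ξ : Fin 12 → ℝ => D.P.γ (ξ 0)) ξ :=
    D.P.smooth_γ.contDiffAt.comp ξ (c 0)
  have hY : ContDiffAt ℝ ∞ (fun ξ : Fin 12 → ℝ => D.w.Y (ξ 2)) ξ :=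
    (contDiff_Y D.w).contDiffAt.comp ξ (c 2)
  have hn := contDiffAt_relN h.reg (c 1) (c 3) (c 6)
  have hs := h.contDiffAt_sForm
  have hVN : ContDiffAt ℝ ∞ (fun ξ : Fin 12 → ℝ => VNForm D (D.P.κ (ξ 0))
      (sForm D (D.P.κ (ξ 0)) (ξ 1) (ξ 2) (ξ 3) (ξ 5) (ξ 6) (ξ 7) (ξ 8)
        (Real.cos (ξ 9)) (Real.sin (ξ 9))) (ξ 5) (ξ 10) (ξ 11)
      (Real.sin (D.P.γ (ξ 0))) (Real.cos (D.P.γ (ξ 0)))) ξ :=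
    (((contDiffAt_const.mul (c 10)).neg.mul hγ.sin).add
      ((contDiffAt_const.mul (c 11)).mul hγ.cos)).sub ((hκ.mul hs).mul (c 5))
  have hyK : ContDiffAt ℝ ∞ (fun ξ : Fin 12 → ℝ => yForm D (D.P.κ (ξ 0))
      (sForm D (D.P.κ (ξ 0)) (ξ 1) (ξ 2) (ξ 3) (ξ 5) (ξ 6) (ξ 7) (ξ 8)
        (Real.cos (ξ 9)) (Real.sin (ξ 9))) (ξ 1) (ξ 2) (ξ 3) (ξ 6) (ξ 7) (ξ 8)
        (Real.cos (ξ 9)) (Real.sin (ξ 9))) ξ :=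
    (((hut.mul (contDiffAt_courseSin h.reg (c 1) (c 3) (c 6) (c 7) (c 9).cos (c 9).sin)).add
      (c 6)).add (((c 2).sub (c 3)).mul
      (contDiffAt_headSin h.reg (c 1) (c 3) (c 6) (c 7) (c 9).cos (c 9).sin))).sub
      ((c 8).mul (hκ.mul hs))
  have hB := ((hκ.mul hs).neg.add ((((hY.mul (c 1)).mul (c 3)).sub ((c 4).mul (c 1))).div
    (hut.pow 2) (pow_ne_zero 2 hut0))).add
    ((contDiffAt_const.div (contDiffAt_gQ h.reg (c 1) (c 3) (c 6) (c 7)) (h.reg.gQ_pos _).ne'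
      (f := fun _ => D.k.Δ)).mul
      (((hVN.div hut hut0).sub ((hn.div (hut.pow 2) (pow_ne_zero 2 hut0)).mul
        (((c 3).mul (c 4)).add ((c 1).mul (hY.mul (c 1)))))).add
        (hyK.mul (contDiffAt_gI h.reg (c 1) (c 3) (c 6) (c 7)))))
  have hCr : CrForm D (ξ 1) (ξ 2) (ξ 3) (ξ 6) (ξ 7) ≠ 0 := by
    rw [← Cr_eq_form h.reg]
    exact h.Cr
  exact hB.neg.div (contDiffAt_CrForm h.reg) hCr

/-! ## Bounds for the desired yaw rate -/

namespace LineBounds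

open Line

variable {D : Design} {M δ σ cr q₀ κm κm' : ℝ} (hb : LineBounds D M δ σ cr q₀ κm κm')
include hb

theorem good (i : Line D M δ σ cr q₀) : Good D i.ξ where
  reg := regular hb i
  tube := (hb.σ_pos.trans_le i.tube).ne'
  Cr := abs_pos.1 (hb.cr_pos.trans_le i.Cr_ge)

/-- The derivative at `0` of the closed form along a line is the directional derivative of `r_d`.
The family consists of lines so that this bound is uniform in base point and direction
simultaneously. -/
theorem exists_fderiv_rdVec_le :
    ∃ C, 0 ≤ C ∧ ∀ i : Line D M δ σ cr q₀, |fderiv ℝ (rdVec D) i.ξ i.w| ≤ C * i.sp := by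
  obtain ⟨C, hC, h⟩ := hb.tame_rdForm
  refine ⟨C, hC, fun i => ?_⟩
  have h1 := (h i).2.2
  simp only [zpow_one] at h1
  have hd := ((hb.good i).contDiffAt_rdVec.differentiableAt (by simp)).hasFDerivAt
  have hl : HasDerivAt (fun t : ℝ => i.ξ + t • i.w) i.w 0 := by
    simpa using ((hasDerivAt_id (0 : ℝ)).smul_const i.w).const_add i.ξ
  have hp : i.ξ + (0 : ℝ) • i.w = i.ξ := by simp
  have hcomp := (hp.symm ▸ hd : HasFDerivAt (rdVec D) (fderiv ℝ (rdVec D) i.ξ)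
    (i.ξ + (0 : ℝ) • i.w)).comp_hasDerivAt (0 : ℝ) hl
  have hcont : Filter.Tendsto (fun t : ℝ => i.ξ + t • i.w) (nhds 0) (nhds i.ξ) := by
    have := hl.continuousAt.tendsto
    rwa [hp] at this
  have hev : (fun t : ℝ => rdFormVec D (i.ξ + t • i.w)) =ᶠ[nhds 0]
      (rdVec D ∘ fun t : ℝ => i.ξ + t • i.w) :=
    (hcont.eventually (eventually_regular (hb.good i).reg)).mono
      fun t ht => (rdVec_eq_form ht).symm
  have h2 := (hcomp.congr_of_eventuallyEq hev).deriv
  have h3 : deriv (fun t : ℝ => rdFormVec D (i.ξ + t • i.w)) 0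
      = fderiv ℝ (rdVec D) i.ξ i.w := h2
  rw [← h3]
  exact h1

theorem exists_thetaDot_le : ∃ C, 0 ≤ C ∧ ∀ i : Line D M δ σ cr q₀,
    |thetaDot D (i.ξ 0) (i.ξ 1) (i.ξ 2) (i.ξ 5) (i.ξ 7) (i.ξ 8)
      (relHeading D.k.Δ (i.ξ 1) (i.ξ 3) (i.ξ 6) (i.ξ 7) (i.ξ 9))| ≤ C * i.sp := by
  obtain ⟨C, hC, h⟩ := hb.tame_s.abs_le
  refine ⟨C, hC, fun i => ?_⟩
  have h1 := h i
  simp only [c_zero, zpow_one] at h1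
  rw [thetaDot_eq_form (regular hb i)]
  exact h1

theorem exists_Cr_le : ∃ C, 0 < C ∧ ∀ i : Line D M δ σ cr q₀,
    |PathFollowing.Cr D (i.ξ 1) (i.ξ 2) (i.ξ 3) (i.ξ 6) (i.ξ 7)| ≤ C := by
  obtain ⟨C, hC, h⟩ := hb.tame_Cr.abs_le
  refine ⟨C + 1, by positivity, fun i => ?_⟩
  have h1 := h i
  simp only [c_zero, zpow_zero, mul_one] at h1
  rw [Cr_eq_form (regular hb i)]
  linarith

theorem exists_total_le : ∃ C, 0 ≤ C ∧ ∀ i : Line D M δ σ cr q₀,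
    |losGain D.k.Δ (i.ξ 1) (i.ξ 3) (i.ξ 6) (i.ξ 7)
      * (1 + g_c D.k.Δ (i.ξ 1) (i.ξ 3) (i.ξ 6) (i.ξ 7) * (2 * i.ξ 7)
        + g_b D.k.Δ (i.ξ 1) (i.ξ 3) (i.ξ 6) (i.ξ 7) * i.ξ 6)| ≤ C := by
  obtain ⟨C, hC, h⟩ := (hb.tame_Δ_div_gQ.mul hb.tame_gI' (m := 0) rfl).abs_le
  refine ⟨C, hC, fun i => ?_⟩
  have h1 := h i
  simp only [c_zero, zpow_zero, mul_one] at h1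
  rw [(regular hb i).losGain_mul_total]
  exact h1

/-- Restoring strength of the line-of-sight term. -/
theorem exists_los_rate : ∃ a, 0 < a ∧ ∀ i : Line D M δ σ cr q₀,
    a / i.ρ ≤ ut (i.ξ 3) (i.ξ 1)
      / √(D.k.Δ ^ 2 + (i.ξ 7 + g D.k.Δ (i.ξ 1) (i.ξ 3) (i.ξ 6) (i.ξ 7)) ^ 2) := by
  refine ⟨q₀ * ((1 - δ ^ 2) / 2), mul_pos hb.q₀_pos (by linarith [δ_sq_lt hb]), fun i => ?_⟩
  have hr := regular hb i
  have hI := hr.gI_pos (i.ξ 7)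
  have hρ := i.ρ_pos
  rw [hr.sq_add_eq, Real.sqrt_sq (by positivity), div_div_eq_mul_div, div_one, mul_div_assoc]
  refine mul_le_mul (le_sp i) ?_ (div_nonneg (by linarith [δ_sq_lt hb]) hρ.le) (sp_pos hb i).le
  have h1 := hr.den_pos (i.ξ 7)
  have h2 := hb.gQ_le i
  have h4 := relN_sq_le hb i
  have h5 := hr.relN_sq_lt
  have h6 := i.ρ_sq
  rw [gI, div_div, div_le_div_iff₀ (by positivity) h1]
  set n := relN (i.ξ 1) (i.ξ 3) (i.ξ 6)
  set Q := gQ D.k.Δ (i.ξ 1) (i.ξ 3) (i.ξ 6) (i.ξ 7)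
  have h7 : i.ξ 7 * n + Q ≤ 2 * i.ρ := by
    have : |i.ξ 7 * n| ≤ i.ρ := by
      refine abs_le_of_sq_le_sq ?_ hρ.le
      rw [h6, mul_pow]
      nlinarith [sq_nonneg (i.ξ 7), sq_nonneg D.k.Δ]
    linarith [(abs_le.1 this).2]
  have h8 := δ_sq_lt hb
  calc (1 - δ ^ 2) * (i.ξ 7 * n + Q) ≤ (1 - n ^ 2) * (2 * i.ρ) := by gcongr
    _ = _ := by ring

omit hb in
theorem one_sub_cos_le (e : ℝ) : |1 - Real.cos e| ≤ |e| := by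
  have h : Real.cos e = 2 * Real.cos (e / 2) ^ 2 - 1 := by
    rw [← Real.cos_two_mul]
    ring_nf
  have h1 := Real.sin_sq_add_cos_sq (e / 2)
  have h2 : 1 - Real.cos e = 2 * Real.sin (e / 2) ^ 2 := by linarith
  have h3 : |Real.sin (e / 2)| ≤ |e / 2| := Real.abs_sin_le_abs
  have h4 := Real.abs_sin_le_one (e / 2)
  rw [h2, abs_of_nonneg (by positivity), ← sq_abs]
  rw [abs_div, abs_two] at h3
  nlinarith [abs_nonneg (Real.sin (e / 2))]

/-- Every summand has a factor that vanishes with the tangential, yaw or surge error, and its other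
factors grow at most like `u_td`. There is no factor `y`, so these errors drive the normal error as
a forcing with a coefficient that does not depend on it. -/
theorem exists_G1_le : ∃ C, 0 ≤ C ∧ ∀ i : Line D M δ σ cr q₀,
    |G1 D (i.ξ 0) (i.ξ 1) (i.ξ 2) (i.ξ 3) (i.ξ 6) (i.ξ 7) (i.ξ 8) (i.ξ 9)
      (thetaDot D (i.ξ 0) (i.ξ 1) (i.ξ 2) (i.ξ 5) (i.ξ 7) (i.ξ 8)
        (relHeading D.k.Δ (i.ξ 1) (i.ξ 3) (i.ξ 6) (i.ξ 7) (i.ξ 9)))|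
      ≤ C * i.sp * (|i.ξ 8| + |i.ξ 9| + |i.ξ 2 - i.ξ 3|) := by
  obtain ⟨C, hC, h⟩ := hb.exists_thetaDot_le
  have hκ0 : 0 ≤ κm := (abs_nonneg _).trans (hb.κ_le 0)
  have hq₀ := hb.q₀_pos
  refine ⟨2 + 1 / q₀ + κm * C, by positivity, fun i => ?_⟩
  have h1 := h i
  set s := thetaDot D (i.ξ 0) (i.ξ 1) (i.ξ 2) (i.ξ 5) (i.ξ 7) (i.ξ 8)
        (relHeading D.k.Δ (i.ξ 1) (i.ξ 3) (i.ξ 6) (i.ξ 7) (i.ξ 9))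
  have hsp := sp_pos hb i
  have e0 : ut (i.ξ 3) (i.ξ 1) = i.sp := rfl
  have a1 : |ut (i.ξ 3) (i.ξ 1) * (1 - Real.cos (i.ξ 9))
      * Real.sin (los D.k.Δ (i.ξ 1) (i.ξ 3) (i.ξ 6) (i.ξ 7))| ≤ i.sp * |i.ξ 9| := by
    rw [e0, abs_mul, abs_mul, abs_of_pos hsp]
    calc _ ≤ i.sp * |i.ξ 9| * 1 :=
          mul_le_mul (mul_le_mul_of_nonneg_left (one_sub_cos_le _) hsp.le)
            (Real.abs_sin_le_one _) (abs_nonneg _) (by positivity)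
      _ = _ := mul_one _
  have a2 : |(i.ξ 2 - i.ξ 3) * Real.sin (relHeading D.k.Δ (i.ξ 1) (i.ξ 3) (i.ξ 6) (i.ξ 7)
      (i.ξ 9))| ≤ 1 / q₀ * i.sp * |i.ξ 2 - i.ξ 3| := by
    rw [abs_mul]
    have : 1 ≤ 1 / q₀ * i.sp := by
      rw [one_div_mul_eq_div, le_div_iff₀ hq₀, one_mul]; exact le_sp i
    calc _ ≤ |i.ξ 2 - i.ξ 3| * 1 := by gcongr; exact Real.abs_sin_le_one _
      _ = 1 * |i.ξ 2 - i.ξ 3| := mul_comm _ _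
      _ ≤ _ := by gcongr
  have a3 : |ut (i.ξ 3) (i.ξ 1) * Real.cos (los D.k.Δ (i.ξ 1) (i.ξ 3) (i.ξ 6) (i.ξ 7))
      * Real.sin (i.ξ 9)| ≤ i.sp * |i.ξ 9| := by
    rw [e0, abs_mul, abs_mul, abs_of_pos hsp]
    calc _ ≤ i.sp * 1 * |i.ξ 9| :=
          mul_le_mul (mul_le_mul_of_nonneg_left (Real.abs_cos_le_one _) hsp.le)
            Real.abs_sin_le_abs (abs_nonneg _) (by positivity)
      _ = _ := by rw [mul_one]
  have a4 : |i.ξ 8 * (D.P.κ (i.ξ 0) * s)| ≤ κm * C * i.sp * |i.ξ 8| := by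
    rw [abs_mul, abs_mul]
    calc _ ≤ |i.ξ 8| * (κm * (C * i.sp)) := by gcongr; exact hb.κ_le _
      _ = _ := by ring
  rw [G1]
  refine (abs_sub _ _).trans ?_
  have b1 := abs_add_le (ut (i.ξ 3) (i.ξ 1) * (1 - Real.cos (i.ξ 9))
      * Real.sin (los D.k.Δ (i.ξ 1) (i.ξ 3) (i.ξ 6) (i.ξ 7)))
      ((i.ξ 2 - i.ξ 3) * Real.sin (relHeading D.k.Δ (i.ξ 1) (i.ξ 3) (i.ξ 6) (i.ξ 7) (i.ξ 9)))
  have b2 := abs_add_le (ut (i.ξ 3) (i.ξ 1) * (1 - Real.cos (i.ξ 9))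
      * Real.sin (los D.k.Δ (i.ξ 1) (i.ξ 3) (i.ξ 6) (i.ξ 7)) +
      (i.ξ 2 - i.ξ 3) * Real.sin (relHeading D.k.Δ (i.ξ 1) (i.ξ 3) (i.ξ 6) (i.ξ 7) (i.ξ 9)))
      (ut (i.ξ 3) (i.ξ 1) * Real.cos (los D.k.Δ (i.ξ 1) (i.ξ 3) (i.ξ 6) (i.ξ 7))
      * Real.sin (i.ξ 9))
  have c1 : 0 ≤ 1 / q₀ * i.sp * (|i.ξ 8| + |i.ξ 9|) := by positivity
  have c2 : 0 ≤ κm * C * i.sp * (|i.ξ 9| + |i.ξ 2 - i.ξ 3|) := by positivity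
  have c3 : 0 ≤ 2 * i.sp * (|i.ξ 8| + |i.ξ 2 - i.ξ 3|) := by positivity
  linarith

set_option maxHeartbeats 1000000 in
/-- Growth of the desired yaw rate in the sway velocity. -/
theorem exists_rdVec_le : ∃ C, 0 ≤ C ∧ ∀ i : Line D M δ σ cr q₀,
    |rdVec D i.ξ| ≤ (κm / σ + 1 / D.k.Δ + C * |i.ξ 8|) * |i.ξ 1| + C := by
  obtain ⟨C₁, hC₁, h₁⟩ := (hb.tame_bracket_rest (hb.tame_VN hb.tame_s)).abs_le
  obtain ⟨C₂, hC₂, h₂⟩ := (hb.tame_yForm hb.tame_s).abs_le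
  obtain ⟨C₃, hC₃, h₃⟩ := hb.tame_Cr_sub_one.abs_le
  obtain ⟨C₄, hC₄, h₄⟩ :=
    (hb.tame_bracket hb.tame_s (hb.tame_VN hb.tame_s) (hb.tame_yForm hb.tame_s)).abs_le
  obtain ⟨C₅, hC₅, h₅⟩ := hb.tame_relN.abs_le
  have hκ0 : 0 ≤ κm := (abs_nonneg _).trans (hb.κ_le 0)
  have hq₀ := hb.q₀_pos
  have hΔ := D.k.Δ_pos
  have hσ := hb.σ_pos
  have hcr := hb.cr_pos
  have hM := hb.M_pos
  have hkδ := D.k.kδ_pos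
  have hδ : 0 < 1 - δ ^ 2 := by linarith [δ_sq_lt hb]
  -- `U` bounds the part of the numerator of `dθ/dt` that does not contain the sway velocity: surge,
  -- tangential current estimate and `kδ * x`.
  set U := 2 * M + D.k.kδ * M with hU
  have hU0 : 0 < U := by positivity
  refine ⟨κm * U / σ + C₁ + (4 * M + M * κm * U / σ) / D.k.Δ
    + C₅ ^ 2 / (1 - δ ^ 2) / D.k.Δ * C₂ / q₀ + C₄ * C₃ / cr / q₀ + κm / σ / D.k.Δ,
    by positivity, fun i => ?_⟩
  have hr := regular hb i
  have hsp := sp_pos hb i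
  have hsq := le_sp i
  have g1 := h₁ i
  have g2 := h₂ i
  have g3 := h₃ i
  have g4 := h₄ i
  have g5 := h₅ i
  simp only [c_zero, zpow_zero, mul_one, zpow_one] at g1 g2 g3 g4 g5
  rw [rdVec_eq_form hr, rdFormVec, rdForm]
  set s := sForm D (D.P.κ (i.ξ 0)) (i.ξ 1) (i.ξ 2) (i.ξ 3) (i.ξ 5) (i.ξ 6) (i.ξ 7) (i.ξ 8)
    (Real.cos (i.ξ 9)) (Real.sin (i.ξ 9)) with hs
  set N' := VNForm D (D.P.κ (i.ξ 0)) s (i.ξ 5) (i.ξ 10) (i.ξ 11) (Real.sin (D.P.γ (i.ξ 0)))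
    (Real.cos (D.P.γ (i.ξ 0)))
  set yK := yForm D (D.P.κ (i.ξ 0)) s (i.ξ 1) (i.ξ 2) (i.ξ 3) (i.ξ 6) (i.ξ 7) (i.ξ 8)
    (Real.cos (i.ξ 9)) (Real.sin (i.ξ 9)) with hyK
  set B := bracketForm D (D.P.κ (i.ξ 0)) s N' yK (i.ξ 1) (i.ξ 2) (i.ξ 3) (i.ξ 4) (i.ξ 6) (i.ξ 7)
    with hB
  set K := CrForm D (i.ξ 1) (i.ξ 2) (i.ξ 3) (i.ξ 6) (i.ξ 7)
  have hK : cr ≤ |K| := hb.Cr_ge i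
  have hK0 : K ≠ 0 := abs_pos.1 (hcr.trans_le hK)
  -- the size of `dθ/dt`
  have q1 : |s| ≤ (|i.ξ 1| + U) / σ := by
    rw [hs, sForm, abs_div]
    have e1 : |headCos D.k.Δ (i.ξ 1) (i.ξ 3) (i.ξ 6) (i.ξ 7) (Real.cos (i.ξ 9))
        (Real.sin (i.ξ 9))| ≤ 1 := by
      rw [← hr.cos_relHeading]; exact Real.abs_cos_le_one _
    have e2 : |headSin D.k.Δ (i.ξ 1) (i.ξ 3) (i.ξ 6) (i.ξ 7) (Real.cos (i.ξ 9))
        (Real.sin (i.ξ 9))| ≤ 1 := by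
      rw [← hr.sin_relHeading]; exact Real.abs_sin_le_one _
    have e3 := i.tube.trans (le_abs_self _)
    refine div_le_div₀ (by positivity) ?_ hσ e3
    refine (abs_add_le _ _).trans ?_
    refine (add_le_add_left ((abs_add_le _ _).trans (add_le_add_left (abs_sub _ _) _)) _).trans ?_
    rw [abs_mul, abs_mul, abs_mul, abs_of_pos hkδ]
    have f1 : |i.ξ 2| * |headCos D.k.Δ (i.ξ 1) (i.ξ 3) (i.ξ 6) (i.ξ 7) (Real.cos (i.ξ 9))
        (Real.sin (i.ξ 9))| ≤ M * 1 := mul_le_mul i.u_le e1 (abs_nonneg _) hM.le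
    have f2 : |i.ξ 1| * |headSin D.k.Δ (i.ξ 1) (i.ξ 3) (i.ξ 6) (i.ξ 7) (Real.cos (i.ξ 9))
        (Real.sin (i.ξ 9))| ≤ |i.ξ 1| * 1 := by gcongr
    have f3 : D.k.kδ * |i.ξ 8| ≤ D.k.kδ * M := by gcongr; exact i.x_le
    have f4 := i.A_le
    linarith
  -- the size of `dy/dt`
  have q2 : |yK| ≤ |i.ξ 1| + 4 * M + |i.ξ 8| * (κm * ((|i.ξ 1| + U) / σ)) := by
    rw [hyK, yForm]
    have e1 : |courseSin D.k.Δ (i.ξ 1) (i.ξ 3) (i.ξ 6) (i.ξ 7) (Real.cos (i.ξ 9))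
        (Real.sin (i.ξ 9))| ≤ 1 := by
      rw [← hr.sin_course]; exact Real.abs_sin_le_one _
    have e2 : |headSin D.k.Δ (i.ξ 1) (i.ξ 3) (i.ξ 6) (i.ξ 7) (Real.cos (i.ξ 9))
        (Real.sin (i.ξ 9))| ≤ 1 := by
      rw [← hr.sin_relHeading]; exact Real.abs_sin_le_one _
    refine (abs_sub _ _).trans (add_le_add ?_ ?_)
    · refine (abs_add_le _ _).trans ?_
      refine (add_le_add_left (abs_add_le _ _) _).trans ?_
      rw [abs_mul, abs_mul, abs_of_pos (ut_pos _ (q_pos hb i))]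
      have f1 : ut (i.ξ 3) (i.ξ 1) * |courseSin D.k.Δ (i.ξ 1) (i.ξ 3) (i.ξ 6) (i.ξ 7)
          (Real.cos (i.ξ 9)) (Real.sin (i.ξ 9))| ≤ (M + |i.ξ 1|) * 1 :=
        mul_le_mul ((ut_le_add _ _).trans (by gcongr; exact i.q_le)) e1 (abs_nonneg _)
          (by positivity)
      have f2 : |i.ξ 2 - i.ξ 3| ≤ M + M :=
        (abs_sub _ _).trans (add_le_add i.u_le i.q_le)
      have f3 : |i.ξ 2 - i.ξ 3| * |headSin D.k.Δ (i.ξ 1) (i.ξ 3) (i.ξ 6) (i.ξ 7)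
          (Real.cos (i.ξ 9)) (Real.sin (i.ξ 9))| ≤ (M + M) * 1 :=
        mul_le_mul f2 e2 (abs_nonneg _) (by positivity)
      have f4 : |i.ξ 6| ≤ M := by
        have := (le_abs_self _).trans i.q_le
        have h0 := q_pos hb i
        nlinarith [i.N_le, hb.δ_lt]
      linarith
    · rw [abs_mul, abs_mul]
      gcongr
      exact hb.κ_le _
  -- the gain in front of `dy/dt`
  have q3 : |D.k.Δ / gQ D.k.Δ (i.ξ 1) (i.ξ 3) (i.ξ 6) (i.ξ 7)
      * gI D.k.Δ (i.ξ 1) (i.ξ 3) (i.ξ 6) (i.ξ 7)|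
      ≤ 1 / D.k.Δ + C₅ ^ 2 / (1 - δ ^ 2) / D.k.Δ * (i.sp ^ 2)⁻¹ := by
    have hQ := hr.gQ_pos (i.ξ 7)
    have hI := hr.gI_pos (i.ξ 7)
    have e1 := hr.gI_identity (i.ξ 7)
    have e2 : D.k.Δ * gI D.k.Δ (i.ξ 1) (i.ξ 3) (i.ξ 6) (i.ξ 7) ≤ 1 := by
      nlinarith [sq_nonneg (i.ξ 7 * gI D.k.Δ (i.ξ 1) (i.ξ 3) (i.ξ 6) (i.ξ 7)
        + relN (i.ξ 1) (i.ξ 3) (i.ξ 6))]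
    have e3 := hr.relN_sq_lt
    have e4 := relN_sq_le hb i
    have e5 : relN (i.ξ 1) (i.ξ 3) (i.ξ 6) ^ 2 ≤ C₅ ^ 2 * (i.sp ^ 2)⁻¹ := by
      have := pow_le_pow_left₀ (abs_nonneg _) g5 2
      rw [sq_abs, mul_pow, zpow_neg, zpow_one, inv_pow] at this
      exact this
    have e6 := hr.gQ_sq (i.ξ 7)
    set n := relN (i.ξ 1) (i.ξ 3) (i.ξ 6)
    set Q := gQ D.k.Δ (i.ξ 1) (i.ξ 3) (i.ξ 6) (i.ξ 7)
    set I := gI D.k.Δ (i.ξ 1) (i.ξ 3) (i.ξ 6) (i.ξ 7)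
    have hn : 0 < 1 - n ^ 2 := by linarith
    -- Here `Q ^ 2 ≥ Δ ^ 2 * (1 - n ^ 2) ≥ (Δ * (1 - n ^ 2)) ^ 2`. As `Δ * gI ≤ 1`, the gain exceeds
    -- `1 / Δ` by at most a term of order `n ^ 2`, hence of order `u_td ^ (-2)`, which stays bounded
    -- after multiplication by `dy/dt`.
    have e7 : D.k.Δ * (1 - n ^ 2) ≤ Q := by
      refine (le_abs_self _).trans (abs_le_of_sq_le_sq ?_ hQ.le)
      rw [e6]
      have : (1 - n ^ 2) ^ 2 ≤ 1 - n ^ 2 := by nlinarith [sq_nonneg n]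
      rw [mul_pow]
      linarith [sq_nonneg (i.ξ 7), mul_le_mul_of_nonneg_left this (sq_nonneg D.k.Δ)]
    rw [abs_of_pos (by positivity), div_mul_eq_mul_div]
    calc D.k.Δ * I / Q ≤ 1 / (D.k.Δ * (1 - n ^ 2)) := by gcongr
      _ = 1 / D.k.Δ + n ^ 2 / (1 - n ^ 2) / D.k.Δ := by field_simp; ring
      _ ≤ 1 / D.k.Δ + C₅ ^ 2 * (i.sp ^ 2)⁻¹ / (1 - δ ^ 2) / D.k.Δ := by gcongr
      _ = _ := by ring
  -- the bracket
  have q4 : |B| ≤ κm * ((|i.ξ 1| + U) / σ) + C₁ + 1 / D.k.Δ * |yK|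
      + C₅ ^ 2 / (1 - δ ^ 2) / D.k.Δ * C₂ / q₀ := by
    have e1 : B = -(D.P.κ (i.ξ 0) * s)
        + ((D.w.Y (i.ξ 2) * i.ξ 1 * i.ξ 3 - i.ξ 4 * i.ξ 1) / ut (i.ξ 3) (i.ξ 1) ^ 2
          + D.k.Δ / gQ D.k.Δ (i.ξ 1) (i.ξ 3) (i.ξ 6) (i.ξ 7) *
            (N' / ut (i.ξ 3) (i.ξ 1) - relN (i.ξ 1) (i.ξ 3) (i.ξ 6) / ut (i.ξ 3) (i.ξ 1) ^ 2
              * (i.ξ 3 * i.ξ 4 + i.ξ 1 * (D.w.Y (i.ξ 2) * i.ξ 1))))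
        + D.k.Δ / gQ D.k.Δ (i.ξ 1) (i.ξ 3) (i.ξ 6) (i.ξ 7)
          * gI D.k.Δ (i.ξ 1) (i.ξ 3) (i.ξ 6) (i.ξ 7) * yK := by
      rw [hB, bracketForm]; ring
    rw [e1]
    refine (abs_add_le _ _).trans ?_
    refine (add_le_add_left (abs_add_le _ _) _).trans ?_
    rw [abs_neg, abs_mul, abs_mul _ yK]
    have f1 : |D.P.κ (i.ξ 0)| * |s| ≤ κm * ((|i.ξ 1| + U) / σ) := by
      gcongr
      exact hb.κ_le _
    have f2 := mul_le_mul_of_nonneg_right q3 (abs_nonneg yK)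
    have f3 : C₅ ^ 2 / (1 - δ ^ 2) / D.k.Δ * (i.sp ^ 2)⁻¹ * |yK|
        ≤ C₅ ^ 2 / (1 - δ ^ 2) / D.k.Δ * C₂ / q₀ := by
      calc _ ≤ C₅ ^ 2 / (1 - δ ^ 2) / D.k.Δ * (i.sp ^ 2)⁻¹ * (C₂ * i.sp) := by gcongr
        _ = C₅ ^ 2 / (1 - δ ^ 2) / D.k.Δ * C₂ / i.sp := by field_simp
        _ ≤ _ := by gcongr
    rw [add_mul] at f2
    linarith
  -- division by `C_r`
  have q5 : |-B / K| ≤ |B| + C₄ * C₃ / cr / q₀ := by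
    -- The bracket is of order `u_td` and `C_r - 1` of order `u_td ^ (-2)`, so the correction is
    -- bounded and `cr` enters the constant but not the slope.
    have e1 : -B / K = -B + B * (K - 1) / K := by field_simp; ring
    rw [e1]
    refine (abs_add_le _ _).trans ?_
    rw [abs_neg, abs_div, abs_mul]
    refine add_le_add_right ?_ _
    have e2 : i.sp ^ (-2 : ℤ) = (i.sp ^ 2)⁻¹ := by rw [zpow_neg]; rfl
    rw [e2] at g3
    calc |B| * |K - 1| / |K| ≤ C₄ * i.sp * (C₃ * (i.sp ^ 2)⁻¹) / cr := by gcongr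
      _ = C₄ * C₃ / cr / i.sp := by field_simp
      _ ≤ _ := by gcongr
  refine q5.trans ?_
  have q6 := mul_le_mul_of_nonneg_left q2 (by positivity : 0 ≤ 1 / D.k.Δ)
  set C₆ := C₅ ^ 2 / (1 - δ ^ 2) / D.k.Δ * C₂ / q₀
  set C₇ := C₄ * C₃ / cr / q₀
  have hC₆ : 0 ≤ C₆ := by positivity
  have hC₇ : 0 ≤ C₇ := by positivity
  have e1 : κm * ((|i.ξ 1| + U) / σ) = κm / σ * |i.ξ 1| + κm * U / σ := by ring
  have e2 : 1 / D.k.Δ * (|i.ξ 1| + 4 * M + |i.ξ 8| * (κm * ((|i.ξ 1| + U) / σ)))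
      = 1 / D.k.Δ * |i.ξ 1| + 4 * M / D.k.Δ + κm / σ / D.k.Δ * (|i.ξ 8| * |i.ξ 1|)
        + |i.ξ 8| * (κm * U / σ / D.k.Δ) := by ring
  have e3 : |i.ξ 8| * (κm * U / σ / D.k.Δ) ≤ M * (κm * U / σ / D.k.Δ) := by
    gcongr; exact i.x_le
  have e4 : 0 ≤ (κm * U / σ + C₁ + (4 * M + M * κm * U / σ) / D.k.Δ + C₆ + C₇)
      * (|i.ξ 8| * |i.ξ 1|) := by positivity
  have e5 : (4 * M + M * κm * U / σ) / D.k.Δ = 4 * M / D.k.Δ + M * (κm * U / σ / D.k.Δ) := by ring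
  have e6 : 0 ≤ κm / σ / D.k.Δ := by positivity
  have e7 : 0 ≤ κm / σ / D.k.Δ * (|i.ξ 8| * |i.ξ 1|) := by positivity
  rw [e1] at q4
  rw [e2] at q6
  rw [e5] at e4 ⊢
  generalize κm / σ / D.k.Δ = a₁ at *
  generalize κm / σ = a₂ at *
  have e8 : ∀ b : ℝ, (a₂ + 1 / D.k.Δ + b * |i.ξ 8|) * |i.ξ 1|
      = a₂ * |i.ξ 1| + 1 / D.k.Δ * |i.ξ 1| + b * (|i.ξ 8| * |i.ξ 1|) := fun b => by ring
  rw [e8]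
  linarith

end LineBounds

/-! ## Error dynamics along closed-loop solutions -/

namespace State

variable (z : State) (D : Design) (q Vx Vy : ℝ)

/-- Estimation error of the tangential current component. -/
def VTe : ℝ := (Vx - z.Vxh) * Real.cos (D.P.γ z.θ) + (Vy - z.Vyh) * Real.sin (D.P.γ z.θ)

/-- Estimation error of the normal current component. -/
def VNe : ℝ := -(Vx - z.Vxh) * Real.sin (D.P.γ z.θ) + (Vy - z.Vyh) * Real.cos (D.P.γ z.θ)

/-- Coefficient of the current estimation error in the yaw angle error dynamics. -/
def total : ℝ :=
  losGain D.k.Δ z.v q (z.VN D) (z.ybp D)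
    * (1 + g_c D.k.Δ z.v q (z.VN D) (z.ybp D) * (2 * z.ybp D)
      + g_b D.k.Δ z.v q (z.VN D) (z.ybp D) * z.VN D)

/-- The unknown part of the time derivative of `rdArg`. -/
def rdArgUnknown : Fin 12 → ℝ :=
  ![0, 0, 0, 0, 0, 0, 0, z.VNe D Vx Vy, z.VTe D Vx Vy, z.total D q * z.VNe D Vx Vy,
    Vx - z.Vxh, Vy - z.Vyh]

theorem VT_sq_add_VN_sq : z.VT D ^ 2 + z.VN D ^ 2 = z.Vxh ^ 2 + z.Vyh ^ 2 := by
  have := Real.sin_sq_add_cos_sq (D.P.γ z.θ)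
  rw [VT, VN]
  linear_combination (z.Vxh ^ 2 + z.Vyh ^ 2) * this

theorem VTe_sq_add_VNe_sq :
    z.VTe D Vx Vy ^ 2 + z.VNe D Vx Vy ^ 2 = (Vx - z.Vxh) ^ 2 + (Vy - z.Vyh) ^ 2 := by
  have := Real.sin_sq_add_cos_sq (D.P.γ z.θ)
  rw [VTe, VNe]
  linear_combination ((Vx - z.Vxh) ^ 2 + (Vy - z.Vyh) ^ 2) * this

theorem xbp_sq_add_ybp_sq :
    z.xbp D ^ 2 + z.ybp D ^ 2 = (z.x - D.P.xP z.θ) ^ 2 + (z.y - D.P.yP z.θ) ^ 2 := by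
  have := Real.sin_sq_add_cos_sq (D.P.γ z.θ)
  rw [xbp, ybp]
  linear_combination ((z.x - D.P.xP z.θ) ^ 2 + (z.y - D.P.yP z.θ) ^ 2) * this

theorem relHeading_eq : relHeading D.k.Δ z.v q (z.VN D) (z.ybp D) (z.ePsi D q)
    = z.ψ - D.P.γ z.θ := by
  rw [relHeading, ePsi, psiD]
  ring

end State

theorem hasDerivWithinAt_gOf {N a b c : ℝ → ℝ} {N' a' b' c' t : ℝ} {S : Set ℝ}
    (hN : HasDerivWithinAt N N' S t) (ha : HasDerivWithinAt a a' S t)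
    (hb : HasDerivWithinAt b b' S t) (hc : HasDerivWithinAt c c' S t)
    (h0 : a t ≠ 0) (hd : 0 < b t ^ 2 - a t * c t) :
    HasDerivWithinAt (fun τ => gOf (N τ) (a τ) (b τ) (c τ))
      (N' * gS (a t) (b t) (c t) + gDa (N t) (a t) (b t) (c t) * a'
        + gDb (N t) (a t) (b t) (c t) * b' + gDc (N t) (a t) (b t) (c t) * c') S t := by
  have h1 := ((hb.pow 2).sub (ha.mul hc)).sqrt (by simpa using hd.ne')
  have h2 := hN.mul ((hb.add h1).div ha.neg (by simpa using h0))
  refine h2.congr_deriv ?_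
  have hs : √(b t ^ 2 - a t * c t) ≠ 0 := (Real.sqrt_pos.2 hd).ne'
  simp only [gS, gDa, gDb, gDc, Pi.neg_apply, Pi.add_apply, Pi.sub_apply, Pi.mul_apply,
    Pi.pow_apply, Pi.div_apply, Nat.cast_ofNat, Nat.add_one_sub_one, pow_one]
  generalize √(b t ^ 2 - a t * c t) = R at *
  field_simp
  ring

section Dynamics

variable {D : Design} {Vx Vy : ℝ} {urd : ℝ → ℝ} {t₀ : ℝ} {T : EReal} {z : ℝ → State}
  (h : IsSolution D Vx Vy urd t₀ T z) {t : ℝ} (ht : t ∈ timeInterval t₀ T)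
include h ht

namespace IsSolution

theorem hasDeriv_ex : HasDerivWithinAt (fun τ => (z τ).ex)
    (Vx - (z t).Vxh - D.k.kx1 * (z t).ex) (timeInterval t₀ T) t :=
  ((h.x_eq t ht).sub (h.xh_eq t ht)).congr_deriv (by ring)

theorem hasDeriv_ey : HasDerivWithinAt (fun τ => (z τ).ey)
    (Vy - (z t).Vyh - D.k.ky1 * (z t).ey) (timeInterval t₀ T) t :=
  ((h.y_eq t ht).sub (h.yh_eq t ht)).congr_deriv (by ring)

theorem hasDeriv_wx : HasDerivWithinAt (fun τ => Vx - (z τ).Vxh)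
    (-(D.k.kx2 * (z t).ex)) (timeInterval t₀ T) t := (h.Vxh_eq t ht).const_sub Vx

theorem hasDeriv_wy : HasDerivWithinAt (fun τ => Vy - (z τ).Vyh)
    (-(D.k.ky2 * (z t).ey)) (timeInterval t₀ T) t := (h.Vyh_eq t ht).const_sub Vy

theorem hasDeriv_γ : HasDerivWithinAt (fun τ => D.P.γ (z τ).θ)
    (D.P.κ (z t).θ * (z t).thetaRate D) (timeInterval t₀ T) t :=
  ((D.P.smooth_γ.differentiable (by simp)) (z t).θ).hasDerivAt.comp_hasDerivWithinAt t
    (h.θ_eq t ht)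

theorem hasDeriv_xP : HasDerivWithinAt (fun τ => D.P.xP (z τ).θ)
    (Real.cos (D.P.γ (z t).θ) * (z t).thetaRate D) (timeInterval t₀ T) t :=
  (D.P.hasDerivAt_xP (z t).θ).comp_hasDerivWithinAt t (h.θ_eq t ht)

theorem hasDeriv_yP : HasDerivWithinAt (fun τ => D.P.yP (z τ).θ)
    (Real.sin (D.P.γ (z t).θ) * (z t).thetaRate D) (timeInterval t₀ T) t :=
  (D.P.hasDerivAt_yP (z t).θ).comp_hasDerivWithinAt t (h.θ_eq t ht)

/-- By kinematics, `x' = u cos (ψ - γ) - v sin (ψ - γ) + V_T - (1 - κ y) dθ/dt`. The update law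
makes the last product equal to all known terms plus `kδ * x`, which leaves only the current
estimation error. -/
theorem hasDeriv_xbp : HasDerivWithinAt (fun τ => (z τ).xbp D)
    (-D.k.kδ * (z t).xbp D + (z t).VTe D Vx Vy) (timeInterval t₀ T) t := by
  have hγ := h.hasDeriv_γ ht
  have h1 := (hγ.cos.mul ((h.x_eq t ht).sub (h.hasDeriv_xP ht))).add
    (hγ.sin.mul ((h.y_eq t ht).sub (h.hasDeriv_yP ht)))
  refine h1.congr_deriv ?_
  have hs : (z t).thetaRate D * (1 - D.P.κ (z t).θ * (z t).ybp D)
      = (z t).u * Real.cos ((z t).ψ - D.P.γ (z t).θ)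
        - (z t).v * Real.sin ((z t).ψ - D.P.γ (z t).θ) + (z t).VT D + D.k.kδ * (z t).xbp D := by
    rw [State.thetaRate, thetaDot_eq, div_mul_cancel₀ _ (h.curv_ne t ht)]
  rw [Real.cos_sub, Real.sin_sub, State.VT] at hs
  have hsc := Real.sin_sq_add_cos_sq (D.P.γ (z t).θ)
  simp only [State.VTe, Pi.sub_apply]
  have hy : (z t).ybp D = -Real.sin (D.P.γ (z t).θ) * ((z t).x - D.P.xP (z t).θ)
      + Real.cos (D.P.γ (z t).θ) * ((z t).y - D.P.yP (z t).θ) := rfl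
  linear_combination -hs - (z t).thetaRate D * hsc
    - (z t).thetaRate D * D.P.κ (z t).θ * hy

theorem hasDeriv_VT : HasDerivWithinAt (fun τ => (z τ).VT D)
    (VTdot D (z t).θ ((z t).VN D) (z t).ex (z t).ey ((z t).thetaRate D))
    (timeInterval t₀ T) t := by
  have hγ := h.hasDeriv_γ ht
  refine (((h.Vxh_eq t ht).mul hγ.cos).add ((h.Vyh_eq t ht).mul hγ.sin)).congr_deriv ?_
  rw [VTdot, State.VN]
  ring

theorem hasDeriv_VN : HasDerivWithinAt (fun τ => (z τ).VN D)
    (VNdot D (z t).θ ((z t).VT D) (z t).ex (z t).ey ((z t).thetaRate D))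
    (timeInterval t₀ T) t := by
  have hγ := h.hasDeriv_γ ht
  refine (((h.Vxh_eq t ht).neg.mul hγ.sin).add ((h.Vyh_eq t ht).mul hγ.cos)).congr_deriv ?_
  simp only [VNdot, State.VT, Pi.neg_apply]
  ring

theorem hasDeriv_eU (hurd : ContDiff ℝ 2 urd) : HasDerivWithinAt (fun τ => (z τ).u - urd τ)
    (-(D.w.d11 / D.w.m11 + D.k.ku) * ((z t).u - urd t)) (timeInterval t₀ T) t := by
  refine ((h.u_eq t ht).sub ((hurd.differentiable (by simp)) t).hasDerivAt.hasDerivWithinAt).congr_deriv ?_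
  rw [State.tauU]
  ring

variable (hreg : Regular D.k.Δ (z t).v (urd t) ((z t).VN D))
include hreg

theorem good : Good D ((z t).rdArg D (urd t) (deriv urd t)) :=
  ⟨hreg, h.curv_ne t ht, h.Cr_ne t ht⟩

theorem hasDeriv_ybp : HasDerivWithinAt (fun τ => (z τ).ybp D)
    (yDotKnown D (z t).θ (z t).v (z t).u (urd t) ((z t).VN D) ((z t).ybp D) ((z t).xbp D)
      ((z t).ePsi D (urd t)) ((z t).thetaRate D) + (z t).VNe D Vx Vy) (timeInterval t₀ T) t := by
  have hγ := h.hasDeriv_γ ht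
  have h1 := (hγ.sin.neg.mul ((h.x_eq t ht).sub (h.hasDeriv_xP ht))).add
    (hγ.cos.mul ((h.y_eq t ht).sub (h.hasDeriv_yP ht)))
  refine h1.congr_deriv ?_
  have hut := ut_pos (z t).v hreg.q_pos
  have hS := hreg.sin_relHeading ((z t).ybp D) ((z t).ePsi D (urd t))
  have hC := hreg.cos_relHeading ((z t).ybp D) ((z t).ePsi D (urd t))
  rw [State.relHeading_eq] at hS hC
  rw [yDotKnown_eq_form hreg, yForm, ← hS]
  -- Rotation by `arctan (v / u_rd)`: the normal velocity of a vessel with surge `u_rd` and sway `v`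
  -- is `u_td` times the sine of its course relative to the path.
  have key : ut (urd t) (z t).v * courseSin D.k.Δ (z t).v (urd t) ((z t).VN D) ((z t).ybp D)
      (Real.cos ((z t).ePsi D (urd t))) (Real.sin ((z t).ePsi D (urd t)))
      = urd t * Real.sin ((z t).ψ - D.P.γ (z t).θ) + (z t).v * Real.cos ((z t).ψ - D.P.γ (z t).θ) := by
    rw [hS, hC, headSin, headCos]
    have := ut_sq (urd t) (z t).v
    field_simp
    linear_combination courseSin D.k.Δ (z t).v (urd t) ((z t).VN D) ((z t).ybp D)
      (Real.cos ((z t).ePsi D (urd t))) (Real.sin ((z t).ePsi D (urd t))) * this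
  rw [key, Real.sin_sub, Real.cos_sub]
  simp only [State.VNe, State.VN, State.xbp, Pi.sub_apply, Pi.neg_apply]
  ring

theorem hasDeriv_los (hC2 : ContDiff ℝ 2 urd) : HasDerivWithinAt
    (fun τ => los D.k.Δ (z τ).v (urd τ) ((z τ).VN D) ((z τ).ybp D))
    (losGain D.k.Δ (z t).v (urd t) ((z t).VN D) ((z t).ybp D) *
      (yDotKnown D (z t).θ (z t).v (z t).u (urd t) ((z t).VN D) ((z t).ybp D) ((z t).xbp D)
        ((z t).ePsi D (urd t)) ((z t).thetaRate D) + (z t).VNe D Vx Vy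
      + (VNdot D (z t).θ ((z t).VT D) (z t).ex (z t).ey ((z t).thetaRate D)
          * g_N D.k.Δ (z t).v (urd t) ((z t).VN D) ((z t).ybp D)
        + g_a D.k.Δ (z t).v (urd t) ((z t).VN D) ((z t).ybp D)
          * (2 * (z t).VN D * VNdot D (z t).θ ((z t).VT D) (z t).ex (z t).ey ((z t).thetaRate D)
            - (2 * urd t * deriv urd t
              + 2 * (z t).v * (D.w.X (z t).u * (z t).r + D.w.Y (z t).u * (z t).v)))
        + g_b D.k.Δ (z t).v (urd t) ((z t).VN D) ((z t).ybp D)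
          * ((yDotKnown D (z t).θ (z t).v (z t).u (urd t) ((z t).VN D) ((z t).ybp D)
              ((z t).xbp D) ((z t).ePsi D (urd t)) ((z t).thetaRate D) + (z t).VNe D Vx Vy)
              * (z t).VN D
            + (z t).ybp D
              * VNdot D (z t).θ ((z t).VT D) (z t).ex (z t).ey ((z t).thetaRate D))
        + g_c D.k.Δ (z t).v (urd t) ((z t).VN D) ((z t).ybp D)
          * (2 * (z t).ybp D * (yDotKnown D (z t).θ (z t).v (z t).u (urd t) ((z t).VN D)
              ((z t).ybp D) ((z t).xbp D) ((z t).ePsi D (urd t)) ((z t).thetaRate D)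
              + (z t).VNe D Vx Vy))))) (timeInterval t₀ T) t := by
  have hurd : HasDerivWithinAt urd (deriv urd t) (timeInterval t₀ T) t :=
    ((hC2.differentiable (by simp)) t).hasDerivAt.hasDerivWithinAt
  have hN := h.hasDeriv_VN ht
  have hy := h.hasDeriv_ybp ht hreg
  have hv := h.v_eq t ht
  set N' := VNdot D (z t).θ ((z t).VT D) (z t).ex (z t).ey ((z t).thetaRate D)
  set y' := yDotKnown D (z t).θ (z t).v (z t).u (urd t) ((z t).VN D) ((z t).ybp D) ((z t).xbp D)
        ((z t).ePsi D (urd t)) ((z t).thetaRate D) + (z t).VNe D Vx Vy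
  have hga : HasDerivWithinAt (fun τ => ga (z τ).v (urd τ) ((z τ).VN D))
      (2 * (z t).VN D * N' - (2 * urd t * deriv urd t
              + 2 * (z t).v * (D.w.X (z t).u * (z t).r + D.w.Y (z t).u * (z t).v)))
      (timeInterval t₀ T) t :=
    ((hN.pow 2).sub ((hurd.pow 2).add (hv.pow 2))).congr_deriv (by simp)
  have hgb : HasDerivWithinAt (fun τ => gb ((z τ).VN D) ((z τ).ybp D))
      (y' * (z t).VN D + (z t).ybp D * N') (timeInterval t₀ T) t := hy.mul hN
  have hgc : HasDerivWithinAt (fun τ => gc D.k.Δ ((z τ).ybp D))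
      (2 * (z t).ybp D * y') (timeInterval t₀ T) t :=
    ((hy.pow 2).const_add (D.k.Δ ^ 2)).congr_deriv (by simp)
  have hg := hasDerivWithinAt_gOf hN hga hgb hgc hreg.ga_neg.ne (hreg.disc_pos _)
  have hΔ := D.k.Δ_pos
  refine ((hy.add hg).div_const D.k.Δ).arctan.congr_deriv ?_
  rw [losGain]
  simp only [Pi.add_apply]
  have e : gOf ((z t).VN D) (ga (z t).v (urd t) ((z t).VN D)) (gb ((z t).VN D) ((z t).ybp D))
    (gc D.k.Δ ((z t).ybp D)) = g D.k.Δ (z t).v (urd t) ((z t).VN D) ((z t).ybp D) := rfl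
  rw [e]
  simp only [g_N, g_a, g_b, g_c]
  field_simp

/-- The yaw rate enters through `ψ' = r` and, via the sway equation, through `arctan (v / u_rd)` and
through `g`. `C_r` is its total coefficient, and `r_d` is chosen so that `-C_r * r_d` collects all
other known terms. -/
theorem hasDeriv_ePsi (hC2 : ContDiff ℝ 2 urd) : HasDerivWithinAt
    (fun τ => (z τ).ePsi D (urd τ))
    ((z t).CrVal D (urd t) * (z t).eR D (urd t) (deriv urd t)
      + (z t).total D (urd t) * (z t).VNe D Vx Vy) (timeInterval t₀ T) t := by
  have hurd : HasDerivWithinAt urd (deriv urd t) (timeInterval t₀ T) t :=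
    ((hC2.differentiable (by simp)) t).hasDerivAt.hasDerivWithinAt
  have hv := h.v_eq t ht
  have h1 := (h.ψ_eq t ht).sub (((h.hasDeriv_γ ht).sub
    ((hv.div hurd hreg.q_pos.ne').arctan)).sub (h.hasDeriv_los ht hreg hC2))
  refine h1.congr_deriv ?_
  have hCr : Cr D (z t).v (z t).u (urd t) ((z t).VN D) ((z t).ybp D) ≠ 0 := h.Cr_ne t ht
  have hq := hreg.q_pos
  have hp : 0 < urd t ^ 2 + (z t).v ^ 2 := by positivity
  have e1 : 1 / (1 + ((z t).v / urd t) ^ 2) * (((D.w.X (z t).u * (z t).r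
      + D.w.Y (z t).u * (z t).v) * urd t - (z t).v * deriv urd t) / urd t ^ 2)
      = ((D.w.X (z t).u * (z t).r + D.w.Y (z t).u * (z t).v) * urd t - (z t).v * deriv urd t)
        / (urd t ^ 2 + (z t).v ^ 2) := by
    field_simp
  simp only [Pi.div_apply]
  rw [e1]
  have hrd : (z t).CrVal D (urd t) * rdVec D ((z t).rdArg D (urd t) (deriv urd t))
      = -(-(D.P.κ (z t).θ * (z t).thetaRate D)
      + (D.w.Y (z t).u * (z t).v * urd t - deriv urd t * (z t).v) / (urd t ^ 2 + (z t).v ^ 2)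
      + losGain D.k.Δ (z t).v (urd t) ((z t).VN D) ((z t).ybp D) *
        (VNdot D (z t).θ ((z t).VT D) (z t).ex (z t).ey ((z t).thetaRate D)
            * g_N D.k.Δ (z t).v (urd t) ((z t).VN D) ((z t).ybp D)
          + g_a D.k.Δ (z t).v (urd t) ((z t).VN D) ((z t).ybp D) * (2 * (z t).VN D
            * VNdot D (z t).θ ((z t).VT D) (z t).ex (z t).ey ((z t).thetaRate D)
              - 2 * urd t * deriv urd t - 2 * (z t).v * (D.w.Y (z t).u * (z t).v))
          + g_b D.k.Δ (z t).v (urd t) ((z t).VN D) ((z t).ybp D)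
            * (VNdot D (z t).θ ((z t).VT D) (z t).ex (z t).ey ((z t).thetaRate D) * (z t).ybp D)
          + (1 + g_c D.k.Δ (z t).v (urd t) ((z t).VN D) ((z t).ybp D) * (2 * (z t).ybp D)
              + g_b D.k.Δ (z t).v (urd t) ((z t).VN D) ((z t).ybp D) * (z t).VN D)
              * yDotKnown D (z t).θ (z t).v (z t).u (urd t) ((z t).VN D) ((z t).ybp D)
                ((z t).xbp D) ((z t).ePsi D (urd t)) ((z t).thetaRate D))) := by
    have e2 : rdVec D ((z t).rdArg D (urd t) (deriv urd t))
        = rd D (z t).θ (z t).v (z t).u (urd t) (deriv urd t) ((z t).VT D) ((z t).VN D)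
          ((z t).ybp D) ((z t).xbp D) ((z t).ePsi D (urd t)) (z t).ex (z t).ey := rfl
    rw [e2, rd, State.relHeading_eq, State.CrVal]
    simp only [← State.thetaRate.eq_1]
    field_simp
  rw [State.eR, mul_sub ((z t).CrVal D (urd t)), hrd]
  rw [State.CrVal, Cr, State.total]
  field_simp
  ring

theorem hasDeriv_rdArg (hC2 : ContDiff ℝ 2 urd) : HasDerivWithinAt
    (fun τ => (z τ).rdArg D (urd τ) (deriv urd τ))
    ((z t).rdArgRate D (urd t) (deriv urd t) (deriv (deriv urd) t)
      + (z t).rdArgUnknown D (urd t) Vx Vy) (timeInterval t₀ T) t := by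
  have hurd : HasDerivWithinAt urd (deriv urd t) (timeInterval t₀ T) t :=
    ((hC2.differentiable (by simp)) t).hasDerivAt.hasDerivWithinAt
  have hurd' : HasDerivWithinAt (deriv urd) (deriv (deriv urd) t) (timeInterval t₀ T) t := by
    have h1 : ContDiff ℝ 1 (deriv urd) :=
      (contDiff_succ_iff_deriv (n := 1) (f := urd)).1 hC2 |>.2.2
    exact ((h1.differentiable (by simp)) t).hasDerivAt.hasDerivWithinAt
  rw [hasDerivWithinAt_pi]
  intro j
  fin_cases j
  · exact (h.θ_eq t ht).congr_deriv (add_zero _).symm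
  · exact (h.v_eq t ht).congr_deriv (add_zero _).symm
  · exact (h.u_eq t ht).congr_deriv (add_zero _).symm
  · exact hurd.congr_deriv (add_zero _).symm
  · exact hurd'.congr_deriv (add_zero _).symm
  · exact (h.hasDeriv_VT ht).congr_deriv (add_zero _).symm
  · exact (h.hasDeriv_VN ht).congr_deriv (add_zero _).symm
  · exact h.hasDeriv_ybp ht hreg
  · exact h.hasDeriv_xbp ht
  · exact h.hasDeriv_ePsi ht hreg hC2
  · exact (h.hasDeriv_ex ht).congr_deriv (by
      change _ = -D.k.kx1 * (z t).ex + (Vx - (z t).Vxh); ring)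
  · exact (h.hasDeriv_ey ht).congr_deriv (by
      change _ = -D.k.ky1 * (z t).ey + (Vy - (z t).Vyh); ring)

/-- The yaw controller cancels the derivative of `r_d` along the known rates. What survives is its
derivative in the unknown direction, which is linear in the current estimation error. -/
theorem hasDeriv_eR (hC2 : ContDiff ℝ 2 urd) : HasDerivWithinAt
    (fun τ => (z τ).eR D (urd τ) (deriv urd τ))
    (-D.k.k1 * (z t).eR D (urd t) (deriv urd t)
      - D.k.k2 * (z t).CrVal D (urd t) * (z t).ePsi D (urd t)
      + -fderiv ℝ (rdVec D) ((z t).rdArg D (urd t) (deriv urd t))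
          ((z t).rdArgUnknown D (urd t) Vx Vy)) (timeInterval t₀ T) t := by
  have h1 := (((h.good ht hreg).contDiffAt_rdVec.differentiableAt (by simp)).hasFDerivAt).comp_hasDerivWithinAt
    t (h.hasDeriv_rdArg ht hreg hC2)
  refine ((h.r_eq t ht).sub h1).congr_deriv ?_
  rw [map_add, State.tauR]
  ring

end IsSolution

end Dynamics

/-! ## Uniform estimates -/

/-- The standing assumptions on the design, the current and the desired surge velocity. -/
structure Setting (D : Design) (Vx Vy Vmax : ℝ) (urd : ℝ → ℝ) (t₀ Xmax Ymin κmax κmax' Mq σ cr : ℝ) :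
    Prop where
  hVmax : 0 < Vmax
  hV : √(Vx ^ 2 + Vy ^ 2) ≤ Vmax
  hurd : ContDiff ℝ 2 urd
  hurd_bdd : ∀ t ≥ t₀, |urd t| ≤ Mq ∧ |deriv urd t| ≤ Mq ∧ |deriv (deriv urd) t| ≤ Mq
  hurd_gt : ∀ t ≥ t₀, 2 * Vmax < urd t
  hY : ∀ t ≥ t₀, ∀ u ∈ Set.Icc (-Vmax) (urd t), D.w.Y u ≤ -Ymin
  hXmax : 0 < Xmax
  hX : ∀ t ≥ t₀, |D.w.X (urd t)| ≤ Xmax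
  hκ : ∀ θ, |D.P.κ θ| ≤ κmax
  hκ' : ∀ θ, |deriv D.P.κ θ| ≤ κmax'
  hσ : 0 < σ
  hσ_pos : 0 < Ymin - Xmax * κmax * (1 / σ)
  hΔ : 4 * Xmax / (Ymin - Xmax * κmax * (1 / σ)) < D.k.Δ
  hcr : 0 < cr

/-- Triangle inequality in the plane, through Cauchy–Schwarz. -/
theorem sub_sq_add_sub_sq_le {a b c d A B : ℝ} (hA : 0 ≤ A) (hB : 0 ≤ B)
    (h1 : a ^ 2 + b ^ 2 ≤ A ^ 2) (h2 : c ^ 2 + d ^ 2 ≤ B ^ 2) :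
    (a - c) ^ 2 + (b - d) ^ 2 ≤ (A + B) ^ 2 := by
  have h3 : (a * c + b * d) ^ 2 ≤ (A * B) ^ 2 := by
    calc (a * c + b * d) ^ 2 ≤ (a ^ 2 + b ^ 2) * (c ^ 2 + d ^ 2) := by
          nlinarith [sq_nonneg (a * d - b * c)]
      _ ≤ A ^ 2 * B ^ 2 := by gcongr
      _ = _ := by ring
  have h4 := abs_le_of_sq_le_sq h3 (by positivity)
  nlinarith [(abs_le.1 h4).1]

/-- Squared norm of the error of the observer. -/
def State.obs (Vx Vy : ℝ) (z : State) : ℝ :=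
  z.ex ^ 2 + z.ey ^ 2 + (Vx - z.Vxh) ^ 2 + (Vy - z.Vyh) ^ 2

/-- Squared norm of the error components that do not depend on the yaw dynamics. -/
def State.fast (D : Design) (q Vx Vy : ℝ) (z : State) : ℝ :=
  z.xbp D ^ 2 + (z.u - q) ^ 2 + z.obs Vx Vy

theorem State.obs_nonneg (Vx Vy : ℝ) (z : State) : 0 ≤ z.obs Vx Vy := by
  unfold State.obs
  positivity

theorem State.fast_nonneg (D : Design) (q Vx Vy : ℝ) (z : State) : 0 ≤ z.fast D q Vx Vy := by
  have := z.obs_nonneg Vx Vy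
  unfold State.fast
  positivity

theorem State.errNorm_sq (D : Design) (q q' Vx Vy : ℝ) (z : State) :
    z.errNorm D q q' Vx Vy ^ 2
      = z.fast D q Vx Vy + z.ybp D ^ 2 + (z.ePsi D q ^ 2 + z.eR D q q' ^ 2) := by
  rw [State.errNorm, Real.sq_sqrt (by positivity), State.fast, State.obs]
  ring

theorem State.errNorm_nonneg (D : Design) (q q' Vx Vy : ℝ) (z : State) :
    0 ≤ z.errNorm D q q' Vx Vy := Real.sqrt_nonneg _

theorem State.obs_le_errNorm_sq (D : Design) (q q' Vx Vy : ℝ) (z : State) :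
    z.obs Vx Vy ≤ z.errNorm D q q' Vx Vy ^ 2 := by
  rw [State.errNorm_sq, State.fast]
  nlinarith [sq_nonneg (z.xbp D), sq_nonneg (z.u - q), sq_nonneg (z.ybp D),
    sq_nonneg (z.ePsi D q), sq_nonneg (z.eR D q q')]

theorem exists_exp_le {K μ ε : ℝ} (hμ : 0 < μ) (hε : 0 < ε) :
    ∃ τ₁ ≥ 0, ∀ τ ≥ τ₁, K * Real.exp (-μ * τ) ≤ ε := by
  have h1 : Filter.Tendsto (fun τ : ℝ => K * Real.exp (-μ * τ)) Filter.atTop (nhds (K * 0)) := by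
    refine (Real.tendsto_exp_atBot.comp ?_).const_mul K
    exact Filter.tendsto_id.const_mul_atTop_of_neg (by linarith)
  rw [mul_zero] at h1
  obtain ⟨τ₁, h⟩ := Filter.eventually_atTop.1 (h1.eventually_le_const hε)
  exact ⟨max τ₁ 0, le_max_right _ _, fun τ hτ => h τ ((le_max_left _ _).trans hτ)⟩

/-! ### Observer, surge and tangential errors -/

namespace Setting

set_option linter.unusedSectionVars false
variable {D : Design} {Vx Vy Vmax : ℝ} {urd : ℝ → ℝ} {t₀ Xmax Ymin κmax κmax' Mq σ cr : ℝ}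
  (S : Setting D Vx Vy Vmax urd t₀ Xmax Ymin κmax κmax' Mq σ cr)
include S

theorem V_sq_le : Vx ^ 2 + Vy ^ 2 ≤ Vmax ^ 2 := (Real.sqrt_le_left S.hVmax.le).1 S.hV

theorem Mq_pos : 0 < Mq := by
  have h1 := S.hurd_gt t₀ le_rfl
  have h2 := (S.hurd_bdd t₀ le_rfl).1
  have := S.hVmax
  linarith [le_abs_self (urd t₀)]

theorem κmax_nonneg : 0 ≤ κmax := (abs_nonneg _).trans (S.hκ 0)

theorem q_pos {t : ℝ} (ht : t₀ ≤ t) : 0 < urd t := by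
  have := S.hurd_gt t ht
  have := S.hVmax
  linarith

theorem obs_decay : ∃ C > 0, ∃ μ > 0, ∀ T z, InTube D Vx Vy Vmax urd σ cr t₀ T z →
    ∀ t ∈ timeInterval t₀ T,
      (z t).obs Vx Vy ≤ C * (z t₀).obs Vx Vy * Real.exp (-μ * (t - t₀)) := by
  obtain ⟨C₁, hC₁, μ₁, hμ₁, h₁⟩ := exists_observer_decay D.k.kx1_pos D.k.kx2_pos
  obtain ⟨C₂, hC₂, μ₂, hμ₂, h₂⟩ := exists_observer_decay D.k.ky1_pos D.k.ky2_pos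
  refine ⟨max C₁ C₂, by positivity, min μ₁ μ₂, by positivity, fun T z hz t ht => ?_⟩
  have e1 := h₁ t₀ T (fun τ => (z τ).ex) (fun τ => Vx - (z τ).Vxh)
    (fun τ hτ => hz.sol.hasDeriv_ex hτ) (fun τ hτ => hz.sol.hasDeriv_wx hτ) t ht
  have e2 := h₂ t₀ T (fun τ => (z τ).ey) (fun τ => Vy - (z τ).Vyh)
    (fun τ hτ => hz.sol.hasDeriv_ey hτ) (fun τ hτ => hz.sol.hasDeriv_wy hτ) t ht
  have hτ := sub_nonneg.2 ht.1
  have f1 : Real.exp (-μ₁ * (t - t₀)) ≤ Real.exp (-(min μ₁ μ₂) * (t - t₀)) := by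
    gcongr; exact min_le_left _ _
  have f2 : Real.exp (-μ₂ * (t - t₀)) ≤ Real.exp (-(min μ₁ μ₂) * (t - t₀)) := by
    gcongr; exact min_le_right _ _
  have g1 : C₁ * ((z t₀).ex ^ 2 + (Vx - (z t₀).Vxh) ^ 2) * Real.exp (-μ₁ * (t - t₀))
      ≤ max C₁ C₂ * ((z t₀).ex ^ 2 + (Vx - (z t₀).Vxh) ^ 2)
        * Real.exp (-(min μ₁ μ₂) * (t - t₀)) := by
    gcongr; exact le_max_left _ _
  have g2 : C₂ * ((z t₀).ey ^ 2 + (Vy - (z t₀).Vyh) ^ 2) * Real.exp (-μ₂ * (t - t₀))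
      ≤ max C₁ C₂ * ((z t₀).ey ^ 2 + (Vy - (z t₀).Vyh) ^ 2)
        * Real.exp (-(min μ₁ μ₂) * (t - t₀)) := by
    gcongr; exact le_max_right _ _
  rw [State.obs, State.obs]
  linarith

/-- Without a bound on the other errors, this makes the time after which the observer is accurate
common to all considered solutions. -/
theorem obs_init_le {T : EReal} {z : ℝ → State} (hz : InTube D Vx Vy Vmax urd σ cr t₀ T z) :
    (z t₀).obs Vx Vy ≤ Vmax ^ 2 / max D.k.kx2 D.k.ky2 + Vmax ^ 2 := by
  have h := hz.observer_init
  have k1 := D.k.kx2_pos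
  have k2 := D.k.ky2_pos
  set m := max D.k.kx2 D.k.ky2 with hm
  have hm0 : 0 < m := lt_max_of_lt_left k1
  have e1 : (Vx - (z t₀).Vxh) ^ 2 ≤ m * ((Vx - (z t₀).Vxh) ^ 2 / D.k.kx2) := by
    rw [← mul_div_assoc, le_div_iff₀ k1, mul_comm]
    gcongr; exact le_max_left _ _
  have e2 : (Vy - (z t₀).Vyh) ^ 2 ≤ m * ((Vy - (z t₀).Vyh) ^ 2 / D.k.ky2) := by
    rw [← mul_div_assoc, le_div_iff₀ k2, mul_comm]
    gcongr; exact le_max_right _ _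
  have e3 : (z t₀).ex ^ 2 + (z t₀).ey ^ 2 ≤ Vmax ^ 2 / m := by
    rw [le_div_iff₀ hm0]
    nlinarith [sq_nonneg (Vx - (z t₀).Vxh), sq_nonneg (Vy - (z t₀).Vyh)]
  have e4 : 0 ≤ m * ((z t₀).ex ^ 2 + (z t₀).ey ^ 2) := by positivity
  rw [State.obs]
  linarith

/-- The weights `1 / kx2` and `1 / ky2` make the mixed terms in the derivative of the observer
energy cancel, so the energy never increases. The admissible initial energy is the level below which
the current error is at most `Vmax`. -/
theorem current_error_le {T : EReal} {z : ℝ → State}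
    (hz : InTube D Vx Vy Vmax urd σ cr t₀ T z) {t : ℝ} (ht : t ∈ timeInterval t₀ T) :
    (Vx - (z t).Vxh) ^ 2 + (Vy - (z t).Vyh) ^ 2 ≤ Vmax ^ 2 := by
  have h := hz.observer_init
  have k1 := D.k.kx2_pos
  have k2 := D.k.ky2_pos
  set m := max D.k.kx2 D.k.ky2 with hm
  have hm0 : 0 < m := lt_max_of_lt_left k1
  have key := le_initial_of_deriv_nonpos (t₀ := t₀) (T := T)
    (f := fun τ => (z τ).ex ^ 2 + (z τ).ey ^ 2 + (Vx - (z τ).Vxh) ^ 2 / D.k.kx2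
      + (Vy - (z τ).Vyh) ^ 2 / D.k.ky2)
    (fun τ hτ => ((((hz.sol.hasDeriv_ex hτ).pow 2).add ((hz.sol.hasDeriv_ey hτ).pow 2)).add
      (((hz.sol.hasDeriv_wx hτ).pow 2).div_const D.k.kx2)).add
      (((hz.sol.hasDeriv_wy hτ).pow 2).div_const D.k.ky2)) (fun τ hτ => ?_) ht
  · have e1 : (Vx - (z t).Vxh) ^ 2 ≤ m * ((Vx - (z t).Vxh) ^ 2 / D.k.kx2) := by
      rw [← mul_div_assoc, le_div_iff₀ k1, mul_comm]
      gcongr; exact le_max_left _ _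
    have e2 : (Vy - (z t).Vyh) ^ 2 ≤ m * ((Vy - (z t).Vyh) ^ 2 / D.k.ky2) := by
      rw [← mul_div_assoc, le_div_iff₀ k2, mul_comm]
      gcongr; exact le_max_right _ _
    have e3 := mul_le_mul_of_nonneg_left key hm0.le
    have e4 : 0 ≤ m * ((z t).ex ^ 2 + (z t).ey ^ 2) := by positivity
    linarith
  · have a1 := mul_nonneg D.k.kx1_pos.le (sq_nonneg (z τ).ex)
    have a2 := mul_nonneg D.k.ky1_pos.le (sq_nonneg (z τ).ey)
    have : (2 * (z τ).ex * (Vx - (z τ).Vxh - D.k.kx1 * (z τ).ex)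
        + 2 * (z τ).ey * (Vy - (z τ).Vyh - D.k.ky1 * (z τ).ey)
        + 2 * (Vx - (z τ).Vxh) * -(D.k.kx2 * (z τ).ex) / D.k.kx2
        + 2 * (Vy - (z τ).Vyh) * -(D.k.ky2 * (z τ).ey) / D.k.ky2)
        = -2 * (D.k.kx1 * (z τ).ex ^ 2) - 2 * (D.k.ky1 * (z τ).ey ^ 2) := by
      field_simp
      ring
    simp only [Nat.cast_ofNat, Nat.add_one_sub_one, pow_one]
    linarith

theorem estimate_le {z : State} {W : ℝ} (hW : 0 ≤ W)
    (h : (Vx - z.Vxh) ^ 2 + (Vy - z.Vyh) ^ 2 ≤ W ^ 2) :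
    |z.VT D| ≤ Vmax + W ∧ |z.VN D| ≤ Vmax + W := by
  have h1 := sub_sq_add_sub_sq_le S.hVmax.le hW S.V_sq_le h
  rw [sub_sub_cancel, sub_sub_cancel, ← z.VT_sq_add_VN_sq D] at h1
  have h2 : 0 ≤ Vmax + W := by have := S.hVmax; positivity
  exact ⟨abs_le_of_sq_le_sq (by nlinarith [sq_nonneg (z.VN D)]) h2,
    abs_le_of_sq_le_sq (by nlinarith [sq_nonneg (z.VT D)]) h2⟩

/-- The estimate is below `2 * Vmax < u_rd` at all times, but `u_rd` may approach `2 * Vmax` at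
infinity. The uniform factor comes from compactness for early times and from the decay of the
observer error for late ones. -/
theorem exists_gap : ∃ δ, 0 < δ ∧ δ < 1 ∧ ∀ T z, InTube D Vx Vy Vmax urd σ cr t₀ T z →
    ∀ t ∈ timeInterval t₀ T, |(z t).VN D| ≤ δ * urd t := by
  have hVm := S.hVmax
  obtain ⟨C, hC, μ, hμ, h⟩ := S.obs_decay
  -- After time `τ₁` the current error is at most `Vmax / 2`, so the estimate is at most `3 / 2 *
  -- Vmax`, which is less than `3 / 4 * u_rd`.
  obtain ⟨τ₁, hτ₁, hexp⟩ := exists_exp_le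
    (K := C * (Vmax ^ 2 / max D.k.kx2 D.k.ky2 + Vmax ^ 2)) (μ := μ) (ε := (Vmax / 2) ^ 2) hμ
    (by positivity)
  obtain ⟨s, hs, hmin⟩ := isCompact_Icc.exists_isMinOn
    (Set.nonempty_Icc.2 (by linarith : t₀ ≤ t₀ + τ₁)) S.hurd.continuous.continuousOn
  have hqs := S.hurd_gt s hs.1
  have hqs0 := S.q_pos hs.1
  refine ⟨max (3 / 4) (2 * Vmax / urd s), by positivity, max_lt (by norm_num)
    ((div_lt_one hqs0).2 hqs), fun T z hz t ht => ?_⟩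
  have hq := S.q_pos ht.1
  rcases le_total (t - t₀) τ₁ with hle | hle
  · have h1 := (S.estimate_le hVm.le (S.current_error_le hz ht)).2
    have h2 : urd s ≤ urd t := hmin ⟨ht.1, by linarith⟩
    calc |(z t).VN D| ≤ 2 * Vmax := by linarith
      _ = 2 * Vmax / urd s * urd s := by field_simp
      _ ≤ max (3 / 4) (2 * Vmax / urd s) * urd t := by gcongr; exact le_max_right _ _
  · have h1 := h T z hz t ht
    have h2 : C * (z t₀).obs Vx Vy * Real.exp (-μ * (t - t₀))
        ≤ C * (Vmax ^ 2 / max D.k.kx2 D.k.ky2 + Vmax ^ 2) * Real.exp (-μ * (t - t₀)) := by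
      gcongr; exact S.obs_init_le hz
    have h3 := (h1.trans h2).trans (hexp _ hle)
    have h4 : (Vx - (z t).Vxh) ^ 2 + (Vy - (z t).Vyh) ^ 2 ≤ (Vmax / 2) ^ 2 := by
      rw [State.obs] at h3
      nlinarith [sq_nonneg (z t).ex, sq_nonneg (z t).ey]
    have h5 := (S.estimate_le (by positivity) h4).2
    calc |(z t).VN D| ≤ 3 / 4 * (2 * Vmax) := by linarith
      _ ≤ max (3 / 4) (2 * Vmax / urd s) * urd t := by
        gcongr
        · exact le_max_left _ _
        · exact (S.hurd_gt t ht.1).le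

theorem regular {T : EReal} {z : ℝ → State} (hz : InTube D Vx Vy Vmax urd σ cr t₀ T z) {t : ℝ}
    (ht : t ∈ timeInterval t₀ T) : Regular D.k.Δ (z t).v (urd t) ((z t).VN D) := by
  obtain ⟨δ, hδ, hδ1, h⟩ := S.exists_gap
  have hq := S.q_pos ht.1
  have h1 : |(z t).VN D| < urd t := (h T z hz t ht).trans_lt (by nlinarith)
  have h4 : (z t).VN D ^ 2 < urd t ^ 2 := sq_lt_sq' (by linarith [(abs_lt.1 h1).1]) (abs_lt.1 h1).2
  exact ⟨D.k.Δ_pos, hq, by nlinarith [sq_nonneg (z t).v]⟩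

/-- Exponential decay of the error components that do not depend on the yaw dynamics. -/
theorem fast_decay : ∃ C > 0, ∃ μ > 0, ∀ T z, InTube D Vx Vy Vmax urd σ cr t₀ T z →
    ∀ t ∈ timeInterval t₀ T, (z t).fast D (urd t) Vx Vy
      ≤ C * (z t₀).errNorm D (urd t₀) (deriv urd t₀) Vx Vy ^ 2 * Real.exp (-μ * (t - t₀)) := by
  obtain ⟨C, hC, μ, hμ, h⟩ := S.obs_decay
  have hku := D.k.ku_pos
  have hkδ := D.k.kδ_pos
  have hd : 0 ≤ D.w.d11 / D.w.m11 := div_nonneg D.w.d11_nonneg D.w.m11_pos.le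
  -- Half of the damping `2 * kδ` absorbs the mixed term with the current error. The decay of the
  -- square must also be strictly slower than that of the observer error.
  set c := min D.k.kδ (μ / 2) with hc
  have hc0 : 0 < c := by positivity
  have hcμ : c < μ := (min_le_right _ _).trans_lt (by linarith)
  set ν := min (2 * D.k.ku) c with hν
  refine ⟨1 + C / D.k.kδ / (μ - c) + 1 + C, by
    have := sub_pos.2 hcμ
    positivity, ν, by positivity, fun T z hz t ht => ?_⟩
  set A := (z t₀).errNorm D (urd t₀) (deriv urd t₀) Vx Vy ^ 2 with hA
  have hA0 : 0 ≤ A := by positivity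
  have h0 : (z t₀).obs Vx Vy ≤ A := State.obs_le_errNorm_sq _ _ _ _ _ _
  have hx0 : (z t₀).xbp D ^ 2 ≤ A := by
    rw [hA, State.errNorm_sq, State.fast]
    have := (z t₀).obs_nonneg Vx Vy
    nlinarith [sq_nonneg ((z t₀).u - urd t₀), sq_nonneg ((z t₀).ybp D),
      sq_nonneg ((z t₀).ePsi D (urd t₀)), sq_nonneg ((z t₀).eR D (urd t₀) (deriv urd t₀))]
  have hu0 : ((z t₀).u - urd t₀) ^ 2 ≤ A := by
    rw [hA, State.errNorm_sq, State.fast]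
    have := (z t₀).obs_nonneg Vx Vy
    nlinarith [sq_nonneg ((z t₀).xbp D), sq_nonneg ((z t₀).ybp D),
      sq_nonneg ((z t₀).ePsi D (urd t₀)), sq_nonneg ((z t₀).eR D (urd t₀) (deriv urd t₀))]
  have hobs : ∀ τ ∈ timeInterval t₀ T, (z τ).obs Vx Vy ≤ C * A * Real.exp (-μ * (τ - t₀)) :=
    fun τ hτ => (h T z hz τ hτ).trans (by gcongr)
  have hu := exp_decay_of_deriv_le (c := 2 * D.k.ku) (μ := 2 * D.k.ku + 1) (K := 0)
    (by linarith) le_rfl (fun τ hτ => (hz.sol.hasDeriv_eU hτ S.hurd).pow 2) (fun τ hτ => by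
      simp only [Nat.cast_ofNat, Nat.add_one_sub_one, pow_one, Pi.pow_apply]
      nlinarith [mul_nonneg hd (sq_nonneg ((z τ).u - urd τ))]) ht
  have hx := exp_decay_of_deriv_le (c := c) (μ := μ) (K := C / D.k.kδ * A) hcμ
    (by positivity) (fun τ hτ => (hz.sol.hasDeriv_xbp hτ).pow 2) (fun τ hτ => by
      simp only [Nat.cast_ofNat, Nat.add_one_sub_one, pow_one, Pi.pow_apply]
      have e1 := two_mul_le_young hkδ ((z τ).xbp D) ((z τ).VTe D Vx Vy)
      have e2 : (z τ).VTe D Vx Vy ^ 2 ≤ C * A * Real.exp (-μ * (τ - t₀)) := by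
        refine le_trans ?_ (hobs τ hτ)
        have := (z τ).VTe_sq_add_VNe_sq D Vx Vy
        rw [State.obs]
        nlinarith [sq_nonneg ((z τ).VNe D Vx Vy), sq_nonneg (z τ).ex, sq_nonneg (z τ).ey]
      have e3 : (z τ).VTe D Vx Vy ^ 2 / D.k.kδ
          ≤ C / D.k.kδ * A * Real.exp (-μ * (τ - t₀)) := by
        rw [div_le_iff₀ hkδ]
        calc _ ≤ _ := e2
          _ = _ := by field_simp
      have e4 : c * (z τ).xbp D ^ 2 ≤ D.k.kδ * (z τ).xbp D ^ 2 := by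
        gcongr; exact min_le_left _ _
      nlinarith) ht
  have ho := hobs t ht
  have hτ := sub_nonneg.2 ht.1
  have hμc := sub_pos.2 hcμ
  simp only [zero_div, add_zero, Pi.pow_apply] at hu hx
  have f1 : Real.exp (-(2 * D.k.ku) * (t - t₀)) ≤ Real.exp (-ν * (t - t₀)) := by
    gcongr; exact min_le_left _ _
  have f2 : Real.exp (-c * (t - t₀)) ≤ Real.exp (-ν * (t - t₀)) := by
    gcongr; exact min_le_right _ _
  have f3 : Real.exp (-μ * (t - t₀)) ≤ Real.exp (-ν * (t - t₀)) := by
    gcongr; exact (min_le_right _ _).trans hcμ.le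
  have g1 : ((z t).u - urd t) ^ 2 ≤ A * Real.exp (-ν * (t - t₀)) := hu.trans (by gcongr)
  have g2 : (z t).xbp D ^ 2 ≤ (A + C / D.k.kδ * A / (μ - c)) * Real.exp (-ν * (t - t₀)) :=
    hx.trans (by gcongr)
  have g3 : (z t).obs Vx Vy ≤ C * A * Real.exp (-ν * (t - t₀)) := ho.trans (by gcongr)
  rw [State.fast]
  calc _ ≤ (A + C / D.k.kδ * A / (μ - c)) * Real.exp (-ν * (t - t₀))
        + A * Real.exp (-ν * (t - t₀)) + C * A * Real.exp (-ν * (t - t₀)) := by linarith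
    _ = _ := by ring

end Setting

/-- Bounds that hold along solutions with bounded initial error. -/
structure Pointwise (D : Design) (Vx Vy q q' κmax σ C a : ℝ) (z : State) : Prop where
  Cr_le : |z.CrVal D q| ≤ C
  total_le : |z.total D q| ≤ C
  fderiv_le : |fderiv ℝ (rdVec D) (z.rdArg D q q') (z.rdArgUnknown D q Vx Vy)|
    ≤ C * (1 + |z.v|) * √(z.obs Vx Vy)
  theta_le : |z.thetaRate D| ≤ C * (1 + |z.v|)
  G1_le : |G1 D z.θ z.v z.u q (z.VN D) (z.ybp D) (z.xbp D) (z.ePsi D q) (z.thetaRate D)|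
    ≤ C * (1 + |z.v|) * (|z.xbp D| + |z.ePsi D q| + |z.u - q|)
  rd_le : |rdVec D (z.rdArg D q q')|
    ≤ (κmax / σ + 1 / D.k.Δ + C * |z.xbp D|) * |z.v| + C
  los_rate : a / √(D.k.Δ ^ 2 + z.ybp D ^ 2)
    ≤ ut q z.v / √(D.k.Δ ^ 2 + (z.ybp D + g D.k.Δ z.v q (z.VN D) (z.ybp D)) ^ 2)

theorem State.abs_le_sqrt_fast (D : Design) (q Vx Vy : ℝ) (z : State) :
    |z.xbp D| ≤ √(z.fast D q Vx Vy) ∧ |z.u - q| ≤ √(z.fast D q Vx Vy) ∧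
    |z.ex| ≤ √(z.fast D q Vx Vy) ∧ |z.ey| ≤ √(z.fast D q Vx Vy) := by
  have e : z.fast D q Vx Vy = z.xbp D ^ 2 + (z.u - q) ^ 2 + (z.ex ^ 2 + z.ey ^ 2
      + (Vx - z.Vxh) ^ 2 + (Vy - z.Vyh) ^ 2) := rfl
  have h1 := sq_nonneg (z.xbp D)
  have h2 := sq_nonneg (z.u - q)
  have h3 := sq_nonneg z.ex
  have h4 := sq_nonneg z.ey
  have h5 := sq_nonneg (Vx - z.Vxh)
  have h6 := sq_nonneg (Vy - z.Vyh)
  refine ⟨?_, ?_, ?_, ?_⟩ <;> refine Real.abs_le_sqrt ?_ <;> linarith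

theorem State.current_le_sqrt_obs (D : Design) (Vx Vy : ℝ) (z : State) :
    |z.VNe D Vx Vy| ≤ √(z.obs Vx Vy) ∧ |z.VTe D Vx Vy| ≤ √(z.obs Vx Vy) ∧
    |Vx - z.Vxh| ≤ √(z.obs Vx Vy) ∧ |Vy - z.Vyh| ≤ √(z.obs Vx Vy) := by
  have e := z.VTe_sq_add_VNe_sq D Vx Vy
  have e2 : z.obs Vx Vy = z.ex ^ 2 + z.ey ^ 2 + (Vx - z.Vxh) ^ 2 + (Vy - z.Vyh) ^ 2 := rfl
  have h1 := sq_nonneg (z.VTe D Vx Vy)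
  have h2 := sq_nonneg (z.VNe D Vx Vy)
  have h3 := sq_nonneg z.ex
  have h4 := sq_nonneg z.ey
  have h5 := sq_nonneg (Vx - z.Vxh)
  have h6 := sq_nonneg (Vy - z.Vyh)
  refine ⟨?_, ?_, ?_, ?_⟩ <;> refine Real.abs_le_sqrt ?_ <;> linarith

/-! ### Uniform bounds on the control law along solutions -/

namespace Setting

set_option linter.unusedSectionVars false
variable {D : Design} {Vx Vy Vmax : ℝ} {urd : ℝ → ℝ} {t₀ Xmax Ymin κmax κmax' Mq σ cr : ℝ}
  (S : Setting D Vx Vy Vmax urd t₀ Xmax Ymin κmax κmax' Mq σ cr)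
include S

theorem fast_bounded (R : ℝ) : ∃ B > 0, ∀ T z, InTube D Vx Vy Vmax urd σ cr t₀ T z →
    (z t₀).errNorm D (urd t₀) (deriv urd t₀) Vx Vy ≤ R →
    ∀ t ∈ timeInterval t₀ T, √((z t).fast D (urd t) Vx Vy) ≤ B := by
  obtain ⟨C, hC, μ, hμ, h⟩ := S.fast_decay
  refine ⟨√(C * R ^ 2) + 1, by positivity, fun T z hz hR t ht => ?_⟩
  have h1 := h T z hz t ht
  have h0 := (z t₀).errNorm_nonneg D (urd t₀) (deriv urd t₀) Vx Vy
  have h2 : Real.exp (-μ * (t - t₀)) ≤ 1 := by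
    apply Real.exp_le_one_iff.2
    nlinarith [sub_nonneg.2 ht.1]
  have h3 : (z t).fast D (urd t) Vx Vy ≤ C * R ^ 2 := by
    refine h1.trans ?_
    calc _ ≤ C * R ^ 2 * 1 := by gcongr
      _ = _ := mul_one _
  have := Real.sqrt_le_sqrt h3
  linarith

/-- The base points met along solutions belong to the family for every admissible direction. `M` is
left free above `M₀` because the bound for the yaw control later needs an `M` that also exceeds a
bound on the normal error, while `δ` must not change. -/
theorem exists_lines (R : ℝ) : ∃ δ M₀, ∀ M ≥ M₀,
    LineBounds D M δ σ cr (2 * Vmax) κmax κmax' ∧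
    ∀ T z, InTube D Vx Vy Vmax urd σ cr t₀ T z →
    (z t₀).errNorm D (urd t₀) (deriv urd t₀) Vx Vy ≤ R →
    ∀ t ∈ timeInterval t₀ T, ∀ w : Fin 12 → ℝ, (∀ j, |w j| ≤ 1) → |(z t).ybp D * w 0| ≤ M →
    ∃ i : Line D M δ σ cr (2 * Vmax), i.ξ = (z t).rdArg D (urd t) (deriv urd t) ∧ i.w = w := by
  obtain ⟨δ, hδ, hδ1, hgap⟩ := S.exists_gap
  obtain ⟨B, hB, hfast⟩ := S.fast_bounded R
  have hVm := S.hVmax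
  have hMq := S.Mq_pos
  refine ⟨δ, B + Mq + 2 * Vmax, fun M hM => ⟨⟨by linarith, hδ, hδ1, S.hσ, S.hcr, by linarith,
    S.hκ, S.hκ'⟩, fun T z hz hR t ht w hw hyw => ?_⟩⟩
  have hf := hfast T z hz hR t ht
  obtain ⟨f1, f2, f3, f4⟩ := (z t).abs_le_sqrt_fast D (urd t) Vx Vy
  obtain ⟨q1, q2, -⟩ := S.hurd_bdd t ht.1
  have hVT := (S.estimate_le (D := D) hVm.le (S.current_error_le hz ht)).1
  refine ⟨⟨(z t).rdArg D (urd t) (deriv urd t), w, hw, ?_, (S.hurd_gt t ht.1).le, ?_, ?_, ?_,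
    hgap T z hz t ht, ?_, ?_, ?_, hz.tube t ht, hz.Cr_away t ht, hyw⟩, rfl, rfl⟩
  · change |(z t).u| ≤ M
    have e : (z t).u = ((z t).u - urd t) + urd t := by ring
    rw [e]
    exact (abs_add_le _ _).trans (by linarith)
  · change |urd t| ≤ M
    linarith
  · change |deriv urd t| ≤ M
    linarith
  · change |(z t).VT D| ≤ M
    linarith
  · change |(z t).xbp D| ≤ M
    linarith
  · change |(z t).ex| ≤ M
    linarith
  · change |(z t).ey| ≤ M
    linarith

theorem sp_le {t : ℝ} (ht : t₀ ≤ t) (v : ℝ) : ut (urd t) v ≤ (Mq + 1) * (1 + |v|) := by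
  have h1 := ut_le_add (urd t) v
  have h2 := (S.hurd_bdd t ht).1
  have h3 := S.Mq_pos
  nlinarith [abs_nonneg v]

theorem exists_pointwise (R : ℝ) : ∃ C > 0, ∃ a > 0,
    ∀ T z, InTube D Vx Vy Vmax urd σ cr t₀ T z →
    (z t₀).errNorm D (urd t₀) (deriv urd t₀) Vx Vy ≤ R →
    ∀ t ∈ timeInterval t₀ T,
      Pointwise D Vx Vy (urd t) (deriv urd t) κmax σ C a (z t) := by
  obtain ⟨δ, M, hM⟩ := S.exists_lines R
  obtain ⟨hb, hline⟩ := hM M le_rfl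
  obtain ⟨C₁, hC₁, h₁⟩ := hb.exists_Cr_le
  obtain ⟨C₂, hC₂, h₂⟩ := hb.exists_total_le
  obtain ⟨C₃, hC₃, h₃⟩ := hb.exists_fderiv_rdVec_le
  obtain ⟨C₄, hC₄, h₄⟩ := hb.exists_thetaDot_le
  obtain ⟨C₅, hC₅, h₅⟩ := hb.exists_G1_le
  obtain ⟨C₆, hC₆, h₆⟩ := hb.exists_rdVec_le
  obtain ⟨a, ha, h₇⟩ := hb.exists_los_rate
  have hMq := S.Mq_pos
  set K := C₁ + C₂ + C₃ * (Mq + 1) * (1 + C₂) + C₄ * (Mq + 1) + C₅ * (Mq + 1) + C₆ with hK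
  have k3 : 0 ≤ C₃ * (Mq + 1) * (1 + C₂) := by positivity
  have k4 : 0 ≤ C₄ * (Mq + 1) := by positivity
  have k5 : 0 ≤ C₅ * (Mq + 1) := by positivity
  refine ⟨K, by positivity, a, ha, fun T z hz hR t ht => ?_⟩
  -- Bounds without a derivative do not depend on the direction, so the constant line suffices.
  obtain ⟨i, hξ, -⟩ := hline T z hz hR t ht 0 (by simp) (by simpa using hb.M_pos.le)
  have hrel : relHeading D.k.Δ (z t).v (urd t) ((z t).VN D) ((z t).ybp D)
      ((z t).ePsi D (urd t)) = (z t).ψ - D.P.γ (z t).θ := State.relHeading_eq _ _ _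
  have hsp : i.sp ≤ (Mq + 1) * (1 + |(z t).v|) := by
    have : i.sp = ut (urd t) (z t).v := by rw [Line.sp, hξ]; rfl
    rw [this]
    exact S.sp_le ht.1 _
  have hv := abs_nonneg (z t).v
  have htot : |(z t).total D (urd t)| ≤ C₂ := by
    have := h₂ i
    rw [hξ] at this
    exact this
  refine ⟨?_, htot.trans (by linarith), ?_, ?_, ?_, ?_, ?_⟩
  · have := h₁ i
    rw [hξ] at this
    exact le_trans this (by linarith)
  · set W := √((z t).obs Vx Vy) with hW
    have hW0 : 0 ≤ W := Real.sqrt_nonneg _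
    obtain ⟨f1, f2, f3, f4⟩ := (z t).current_le_sqrt_obs D Vx Vy
    have hcomp : ∀ j, |(z t).rdArgUnknown D (urd t) Vx Vy j| ≤ (1 + C₂) * W := by
      have h0 : |(0 : ℝ)| ≤ (1 + C₂) * W := by rw [abs_zero]; positivity
      have hle : W ≤ (1 + C₂) * W := by nlinarith
      intro j
      fin_cases j
      · exact h0
      · exact h0
      · exact h0
      · exact h0
      · exact h0
      · exact h0
      · exact h0
      · exact f1.trans hle
      · exact f2.trans hle
      · change |(z t).total D (urd t) * (z t).VNe D Vx Vy| ≤ _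
        rw [abs_mul]
        calc _ ≤ C₂ * W := by gcongr
          _ ≤ _ := by nlinarith
      · exact f3.trans hle
      · exact f4.trans hle
    rcases hW0.eq_or_lt with h0 | hpos
    · have : (z t).rdArgUnknown D (urd t) Vx Vy = 0 := by
        funext j
        have := hcomp j
        rw [← h0, mul_zero] at this
        exact abs_nonpos_iff.1 this
      rw [this, map_zero, abs_zero, ← h0, mul_zero]
    -- The derivative is linear in the direction, so the unknown direction is scaled to components
    -- of modulus at most `1`. Its `θ`-component is zero, so no bound on the normal error is
    -- required.
    · set s := (1 + C₂) * W with hs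
      have hs0 : 0 < s := by positivity
      obtain ⟨i, hξ, hw⟩ := hline T z hz hR t ht (s⁻¹ • (z t).rdArgUnknown D (urd t) Vx Vy)
        (fun j => by
          rw [Pi.smul_apply, smul_eq_mul, abs_mul, abs_of_pos (inv_pos.2 hs0),
            inv_mul_le_iff₀ hs0, mul_one]
          exact hcomp j) (by
          have e : (s⁻¹ • (z t).rdArgUnknown D (urd t) Vx Vy) 0 = s⁻¹ * 0 := rfl
          rw [e, mul_zero, mul_zero, abs_zero]
          exact hb.M_pos.le)
      have h := h₃ i
      have hsp' : i.sp ≤ (Mq + 1) * (1 + |(z t).v|) := by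
        have : i.sp = ut (urd t) (z t).v := by rw [Line.sp, hξ]; rfl
        rw [this]
        exact S.sp_le ht.1 _
      rw [hξ, hw, map_smul, smul_eq_mul, abs_mul, abs_of_pos (inv_pos.2 hs0),
        inv_mul_le_iff₀ hs0] at h
      calc _ ≤ s * (C₃ * i.sp) := h
        _ ≤ s * (C₃ * ((Mq + 1) * (1 + |(z t).v|))) := by gcongr
        _ = (C₃ * (Mq + 1) * (1 + C₂)) * (1 + |(z t).v|) * W := by rw [hs]; ring
        _ ≤ K * (1 + |(z t).v|) * W := by gcongr; linarith
  · have := h₄ i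
    rw [hξ] at this
    have h' : |(z t).thetaRate D| ≤ C₄ * i.sp := by
      rw [State.thetaRate, ← hrel]
      exact this
    calc _ ≤ C₄ * i.sp := h'
      _ ≤ C₄ * ((Mq + 1) * (1 + |(z t).v|)) := by gcongr
      _ = C₄ * (Mq + 1) * (1 + |(z t).v|) := by ring
      _ ≤ _ := by gcongr; linarith
  · have := h₅ i
    rw [hξ] at this
    have h' : |G1 D (z t).θ (z t).v (z t).u (urd t) ((z t).VN D) ((z t).ybp D) ((z t).xbp D)
        ((z t).ePsi D (urd t)) ((z t).thetaRate D)|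
        ≤ C₅ * i.sp * (|(z t).xbp D| + |(z t).ePsi D (urd t)| + |(z t).u - urd t|) := by
      rw [State.thetaRate, ← hrel]
      exact this
    calc _ ≤ _ := h'
      _ ≤ C₅ * ((Mq + 1) * (1 + |(z t).v|))
          * (|(z t).xbp D| + |(z t).ePsi D (urd t)| + |(z t).u - urd t|) := by gcongr
      _ = C₅ * (Mq + 1) * (1 + |(z t).v|)
          * (|(z t).xbp D| + |(z t).ePsi D (urd t)| + |(z t).u - urd t|) := by ring
      _ ≤ _ := by gcongr; linarith
  · have h := h₆ i
    rw [hξ] at h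
    have h' : |rdVec D ((z t).rdArg D (urd t) (deriv urd t))|
        ≤ (κmax / σ + 1 / D.k.Δ + C₆ * |(z t).xbp D|) * |(z t).v| + C₆ := h
    have hle : C₆ ≤ K := by linarith
    exact h'.trans (by gcongr)
  · have := h₇ i
    rw [Line.ρ, hξ] at this
    exact this

/-- The coupling coefficient has constant sign along a solution. -/
theorem exists_sign {T : EReal} {z : ℝ → State} (hz : InTube D Vx Vy Vmax urd σ cr t₀ T z) :
    ∃ s : ℝ, s ^ 2 = 1 ∧ ∀ t ∈ timeInterval t₀ T, cr ≤ s * (z t).CrVal D (urd t) := by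
  have hcont : ContinuousOn (fun t => (z t).CrVal D (urd t)) (timeInterval t₀ T) := fun t ht => by
    have h1 := (contDiffAt_Cr (n := 1) (D := D)
      (ξ := (z t).rdArg D (urd t) (deriv urd t)) (S.regular hz ht)).continuousAt
    exact h1.comp_continuousWithinAt (f := fun τ => (z τ).rdArg D (urd τ) (deriv urd τ))
      (hz.sol.hasDeriv_rdArg ht (S.regular hz ht) S.hurd).continuousWithinAt
  have h0 := left_mem_timeInterval hz.sol.lt
  have hcr := S.hcr
  have key : ∀ s : ℝ, s ^ 2 = 1 → 0 < s * (z t₀).CrVal D (urd t₀) →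
      ∀ t ∈ timeInterval t₀ T, cr ≤ s * (z t).CrVal D (urd t) := by
    intro s hs hpos t ht
    have habs : |s * (z t).CrVal D (urd t)| = |(z t).CrVal D (urd t)| := by
      rw [abs_mul]
      have : |s| = 1 := by rw [← sq_eq_sq₀ (abs_nonneg _) zero_le_one, sq_abs, hs, one_pow]
      rw [this, one_mul]
    have hA := hz.Cr_away t ht
    rcases le_total 0 (s * (z t).CrVal D (urd t)) with hn | hn
    · rwa [← habs, abs_of_nonneg hn] at hA
    · exfalso
      have hsub := Icc_subset_timeInterval ht
      -- A change of sign would force a zero of `C_r`, which contradicts the lower bound on `|C_r|`.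
      obtain ⟨τ, hτ, h⟩ := intermediate_value_Icc' ht.1
        ((continuousOn_const.mul hcont).mono hsub : ContinuousOn
          (fun τ => s * (z τ).CrVal D (urd τ)) (Set.Icc t₀ t)) ⟨hn, hpos.le⟩
      have h2 := hz.Cr_away τ (hsub hτ)
      have h3 : (z τ).CrVal D (urd τ) = 0 := by
        rcases mul_eq_zero.1 h with h | h
        · have h' : s = 0 := h
          rw [h'] at hs
          norm_num at hs
        · exact h
      rw [h3, abs_zero] at h2
      linarith
  have hA := hz.Cr_away t₀ h0
  rcases le_total 0 ((z t₀).CrVal D (urd t₀)) with hn | hn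
  · rw [abs_of_nonneg hn] at hA
    exact ⟨1, by norm_num, key 1 (by norm_num) (by linarith)⟩
  · rw [abs_of_nonpos hn] at hA
    exact ⟨-1, by norm_num, key (-1) (by norm_num) (by linarith)⟩

end Setting

/-- The sway inequality: `w ^ 2` decays up to a forcing by the yaw rate error when the yaw
reference grows with a slope that the sway damping dominates. -/
theorem sway_mul_le {X Y r rd e Xm cX cY b C B F ν Ym v : ℝ} (hν : 0 < ν)
    (hC : 0 ≤ C) (hb : 0 ≤ b) (hcX : 0 ≤ cX) (hF : 0 ≤ F) (hFB : F ≤ B)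
    (hX : |X| ≤ Xm + cX * F) (hY : Y ≤ -Ym + cY * F) (hr : r = e + rd)
    (hrd : |rd| ≤ (b + C * F) * |v| + C) (hνe : ν = Ym - Xm * b) :
    2 * v * (X * r + Y * v)
      ≤ -ν * v ^ 2 + 2 * (cY + cX * b + Xm * C + cX * C * B) * F * v ^ 2
        + 2 * (Xm + cX * B) ^ 2 / ν * (e ^ 2 + C ^ 2) := by
  have hv := abs_nonneg v
  have hv2 : |v| ^ 2 = v ^ 2 := sq_abs v
  have hXB : |X| ≤ Xm + cX * B := hX.trans (by gcongr)
  have hXB0 : 0 ≤ Xm + cX * B := (abs_nonneg _).trans hXB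
  have hrb : |r| ≤ |e| + ((b + C * F) * |v| + C) := by
    rw [hr]; exact (abs_add_le _ _).trans (by linarith)
  have h1 : v * (X * r) ≤ |v| * (|X| * |r|) := by
    rw [← abs_mul, ← abs_mul]; exact le_abs_self _
  have h2 : |v| * (|X| * |r|) ≤ |v| * (|X| * (|e| + ((b + C * F) * |v| + C))) := by gcongr
  have h3 : |X| * ((b + C * F) * v ^ 2)
      ≤ (Xm + cX * F) * ((b + C * F) * v ^ 2) := by gcongr
  have h3' : cX * C * F * (F * v ^ 2) ≤ cX * C * B * (F * v ^ 2) := by gcongr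
  have h4 : |v| * (|X| * (|e| + C)) ≤ |v| * ((Xm + cX * B) * (|e| + C)) := by gcongr
  -- The part of the yaw rate proportional to `|v|` reduces the damping from `2 * Ym` to `2 * ν`, up
  -- to multiples of `F`. The remainder `|e| + C` is separated by Young's inequality at the price of
  -- one further `ν`.
  have h5 := two_mul_le_young hν |v| ((Xm + cX * B) * (|e| + C))
  have h6 : ((Xm + cX * B) * (|e| + C)) ^ 2 / ν
      ≤ 2 * (Xm + cX * B) ^ 2 / ν * (e ^ 2 + C ^ 2) := by
    rw [div_mul_eq_mul_div]
    gcongr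
    have : (|e| + C) ^ 2 ≤ 2 * (e ^ 2 + C ^ 2) := by nlinarith [sq_nonneg (|e| - C), sq_abs e]
    calc _ = (Xm + cX * B) ^ 2 * (|e| + C) ^ 2 := by ring
      _ ≤ (Xm + cX * B) ^ 2 * (2 * (e ^ 2 + C ^ 2)) := by gcongr
      _ = _ := by ring
  have h7 : Y * v ^ 2 ≤ (-Ym + cY * F) * v ^ 2 := by gcongr
  have e1 : |v| * (|X| * (|e| + ((b + C * F) * |v| + C)))
      = |v| * (|X| * (|e| + C)) + |X| * ((b + C * F) * v ^ 2) := by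
    rw [← hv2]; ring
  rw [hv2] at h5
  subst hνe
  nlinarith

/-- The factor `K₀ = (C₃ + 1) / rate` makes the yaw decay pay for the forcing `C₃ * r₂` of the sway
inequality and still leave `-(p₂ + r₂)`. The yaw forcing grows with `v₂` but carries `F ^ 2`, so it
only adds an exponentially decaying amount to the rate. -/
theorem lyapunov_sum_le {sv ow ν C' C₃ C L K₀ K M B F E v₂ p₂ r₂ W rate c : ℝ}
    (hC' : 0 ≤ C') (hC₃ : 0 ≤ C₃) (hL : 0 ≤ L) (hrate : 0 < rate) (hK₀ : K₀ = (C₃ + 1) / rate)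
    (hK : 0 ≤ K) (hM : 0 < M) (hB : 0 ≤ B) (hF : 0 ≤ F) (hFB : F ≤ B) (hFE : F ≤ B * E)
    (hv : 0 ≤ v₂) (hp : 0 ≤ p₂) (hW : 0 ≤ W) (hWM : W ≤ M * (p₂ + r₂))
    (hcν : c ≤ ν) (hcM : c ≤ 1 / (K₀ * M))
    (hsv : sv ≤ -ν * v₂ + C' * F * v₂ + C₃ * (r₂ + C ^ 2))
    (how : ow ≤ -rate * (p₂ + r₂) + K * (L * (1 + v₂) * F ^ 2)) :
    sv + K₀ * ow ≤ (-c + (C' + K₀ * (K * L) * B) * B * E) * (v₂ + K₀ * W)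
      + (C₃ * C ^ 2 + K₀ * (K * L) * B ^ 2) := by
  have hK₀0 : 0 < K₀ := by rw [hK₀]; positivity
  set G := K₀ * (K * L) with hG
  have hG0 : 0 ≤ G := by positivity
  have h1 := mul_le_mul_of_nonneg_left how hK₀0.le
  have hcV : c * (v₂ + K₀ * W) ≤ ν * v₂ + (p₂ + r₂) := by
    have g1 : c * v₂ ≤ ν * v₂ := by gcongr
    have g2 : c * (K₀ * W) ≤ 1 / (K₀ * M) * (K₀ * (M * (p₂ + r₂))) := by gcongr
    have g3 : 1 / (K₀ * M) * (K₀ * (M * (p₂ + r₂))) = p₂ + r₂ := by field_simp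
    linarith
  have hrate' : K₀ * (-rate * (p₂ + r₂)) = -(C₃ + 1) * (p₂ + r₂) := by
    rw [hK₀]; field_simp
  have hGe : K₀ * (K * (L * (1 + v₂) * F ^ 2)) = G * F ^ 2 + G * F ^ 2 * v₂ := by rw [hG]; ring
  have hG1 : G * F ^ 2 ≤ G * B ^ 2 := by gcongr
  have hG2 : (C' * F + G * F ^ 2) * v₂ ≤ (C' + G * B) * B * E * (v₂ + K₀ * W) := by
    have i1 : C' * F + G * F ^ 2 ≤ (C' + G * B) * F := by
      have : G * F ^ 2 ≤ G * B * F := by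
        rw [pow_two, ← mul_assoc]; gcongr
      linarith
    have i2 : (C' + G * B) * F ≤ (C' + G * B) * (B * E) := by gcongr
    have i3 : v₂ ≤ v₂ + K₀ * W := by
      have := mul_nonneg hK₀0.le hW
      linarith
    have i4 : 0 ≤ (C' + G * B) * (B * E) := le_trans (by positivity) i2
    calc _ ≤ ((C' + G * B) * (B * E)) * v₂ := mul_le_mul_of_nonneg_right (i1.trans i2) hv
      _ ≤ ((C' + G * B) * (B * E)) * (v₂ + K₀ * W) := by gcongr
      _ = _ := by ring
  have hp2 : 0 ≤ C₃ * p₂ := by positivity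
  rw [mul_add K₀, hrate', hGe] at h1
  rw [add_mul, neg_mul]
  linarith

/-! ### Boundedness of the sway velocity -/

namespace Setting

set_option linter.unusedSectionVars false
variable {D : Design} {Vx Vy Vmax : ℝ} {urd : ℝ → ℝ} {t₀ Xmax Ymin κmax κmax' Mq σ cr : ℝ}
  (S : Setting D Vx Vy Vmax urd t₀ Xmax Ymin κmax κmax' Mq σ cr)
include S

/-- The look-ahead condition makes `Xmax / Δ` smaller than a quarter of the margin that the
curvature term leaves. -/
theorem sway_margin_pos : 0 < Ymin - Xmax * (κmax / σ + 1 / D.k.Δ) := by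
  have h1 := S.hσ_pos
  have h2 := S.hΔ
  have h3 := D.k.Δ_pos
  have hX := S.hXmax
  rw [div_lt_iff₀ h1] at h2
  have h4 : Xmax * (1 / D.k.Δ) < Ymin - Xmax * κmax * (1 / σ) := by
    rw [mul_one_div, div_lt_iff₀ h3]
    nlinarith
  have e : Xmax * (κmax / σ + 1 / D.k.Δ) = Xmax * κmax * (1 / σ) + Xmax * (1 / D.k.Δ) := by ring
  linarith

theorem sqrt_fast_decay : ∃ B > 0, ∃ μ > 0, ∀ T z, InTube D Vx Vy Vmax urd σ cr t₀ T z →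
    ∀ t ∈ timeInterval t₀ T, √((z t).fast D (urd t) Vx Vy)
      ≤ B * (z t₀).errNorm D (urd t₀) (deriv urd t₀) Vx Vy * Real.exp (-μ * (t - t₀)) := by
  obtain ⟨C, hC, μ, hμ, h⟩ := S.fast_decay
  refine ⟨√C, by positivity, μ / 2, by positivity, fun T z hz t ht => ?_⟩
  have h0 := (z t₀).errNorm_nonneg D (urd t₀) (deriv urd t₀) Vx Vy
  refine Real.sqrt_le_iff.2 ⟨by positivity, (h T z hz t ht).trans (le_of_eq ?_)⟩
  rw [mul_pow, mul_pow, Real.sq_sqrt hC.le, ← Real.exp_nat_mul]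
  congr 2
  push_cast
  ring

/-- The coefficients `X` and `Y` are affine, so bounds at `u_rd` carry over to the actual surge
velocity up to a multiple of the surge error, which decays. -/
theorem X_le {t : ℝ} (ht : t₀ ≤ t) (u : ℝ) :
    |D.w.X u| ≤ Xmax + |(D.w.m23 ^ 2 - D.w.m11 * D.w.m33) / D.w.det| * |u - urd t| := by
  have e : D.w.X u = D.w.X (urd t)
      + (D.w.m23 ^ 2 - D.w.m11 * D.w.m33) / D.w.det * (u - urd t) := by
    rw [Vessel.X, Vessel.X]; ring
  rw [e]
  refine (abs_add_le _ _).trans ?_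
  rw [abs_mul]
  linarith [S.hX t ht]

theorem Y_le {t : ℝ} (ht : t₀ ≤ t) (u : ℝ) :
    D.w.Y u ≤ -Ymin + |(D.w.m22 - D.w.m11) * D.w.m23 / D.w.det| * |u - urd t| := by
  have e : D.w.Y u = D.w.Y (urd t)
      + (D.w.m22 - D.w.m11) * D.w.m23 / D.w.det * (u - urd t) := by
    rw [Vessel.Y, Vessel.Y]; ring
  have h1 := S.hY t ht (urd t) ⟨by linarith [S.q_pos ht, S.hVmax], le_rfl⟩
  have h2 := le_abs_self ((D.w.m22 - D.w.m11) * D.w.m23 / D.w.det * (u - urd t))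
  rw [abs_mul] at h2
  rw [e]
  linarith

/-- Squares of the perturbations of the yaw error dynamics. -/
theorem forcing_le {q q' C a : ℝ} {z : State} (h : Pointwise D Vx Vy q q' κmax σ C a z) :
    (z.total D q * z.VNe D Vx Vy) ^ 2
      + (-fderiv ℝ (rdVec D) (z.rdArg D q q') (z.rdArgUnknown D q Vx Vy)) ^ 2
      ≤ 3 * C ^ 2 * (1 + z.v ^ 2) * z.fast D q Vx Vy := by
  have hobs := z.obs_nonneg Vx Vy
  have hle : z.obs Vx Vy ≤ z.fast D q Vx Vy := by
    rw [State.fast]; nlinarith [sq_nonneg (z.xbp D), sq_nonneg (z.u - q)]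
  have hs := Real.sq_sqrt hobs
  have hC : 0 ≤ C := (abs_nonneg _).trans h.total_le
  have h1 : |z.total D q * z.VNe D Vx Vy| ≤ C * √(z.obs Vx Vy) := by
    rw [abs_mul]
    have := (z.current_le_sqrt_obs D Vx Vy).1
    have := h.total_le
    gcongr
  have h2 := h.fderiv_le
  have e1 : (z.total D q * z.VNe D Vx Vy) ^ 2 ≤ (C * √(z.obs Vx Vy)) ^ 2 :=
    sq_le_sq.2 (h1.trans (le_abs_self _))
  have e2 : (-fderiv ℝ (rdVec D) (z.rdArg D q q') (z.rdArgUnknown D q Vx Vy)) ^ 2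
      ≤ (C * (1 + |z.v|) * √(z.obs Vx Vy)) ^ 2 := by
    rw [neg_sq]; exact sq_le_sq.2 (h2.trans (le_abs_self _))
  have e3 : (1 + |z.v|) ^ 2 ≤ 2 * (1 + z.v ^ 2) := by
    nlinarith [sq_nonneg (1 - |z.v|), sq_abs z.v]
  rw [mul_pow C, hs] at e1
  rw [mul_pow (C * (1 + |z.v|)), mul_pow C, hs] at e2
  have e4 : C ^ 2 * (1 + |z.v|) ^ 2 * z.obs Vx Vy
      ≤ C ^ 2 * (2 * (1 + z.v ^ 2)) * z.obs Vx Vy := by gcongr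
  have e5 : 0 ≤ C ^ 2 * z.v ^ 2 * z.obs Vx Vy := by positivity
  calc _ ≤ C ^ 2 * z.obs Vx Vy + C ^ 2 * (2 * (1 + z.v ^ 2)) * z.obs Vx Vy := by linarith
    _ ≤ 3 * C ^ 2 * (1 + z.v ^ 2) * z.obs Vx Vy := by linarith
    _ ≤ _ := by gcongr

set_option maxHeartbeats 1600000 in
-- Sway velocity and yaw errors drive each other, so they are bounded together through `v ^ 2 + K₀ *
-- oscW`. All coefficients that work against the sway damping are multiples of `F`, the square root
-- of `State.fast`, whose decay was established without reference to `v`.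
theorem sway_bounded (R : ℝ) (hR : 0 < R) : ∃ B > 0, ∀ T z,
    InTube D Vx Vy Vmax urd σ cr t₀ T z → |(z t₀).v| ≤ R →
    (z t₀).errNorm D (urd t₀) (deriv urd t₀) Vx Vy ≤ R →
    ∀ t ∈ timeInterval t₀ T, |(z t).v| ≤ B := by
  obtain ⟨Bf, hBf, μ, hμ, hfast⟩ := S.sqrt_fast_decay
  obtain ⟨C, hC, a, ha, hpt⟩ := S.exists_pointwise R
  obtain ⟨ε, hε, rate, hrate, K, hK, m, hm, M, hM, hosc⟩ :=
    exists_oscW D.k.k1_pos D.k.k2_pos S.hcr hC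
  have hν := S.sway_margin_pos
  set ν := Ymin - Xmax * (κmax / σ + 1 / D.k.Δ) with hνdef
  have hX := S.hXmax
  have hκ0 := S.κmax_nonneg
  have hσ := S.hσ
  have hΔ := D.k.Δ_pos
  set cX := |(D.w.m23 ^ 2 - D.w.m11 * D.w.m33) / D.w.det| with hcX
  have hcX0 : 0 ≤ cX := abs_nonneg _
  set cY := |(D.w.m22 - D.w.m11) * D.w.m23 / D.w.det| with hcY
  have hcY0 : 0 ≤ cY := abs_nonneg _
  set b := κmax / σ + 1 / D.k.Δ with hb
  have hb0 : 0 ≤ b := by positivity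
  set B := Bf * R with hB
  have hB0 : 0 < B := by positivity
  set C₃ := 2 * (Xmax + cX * B) ^ 2 / ν with hC₃
  have hC₃0 : 0 ≤ C₃ := by positivity
  set C' := 2 * (cY + cX * b + Xmax * C + cX * C * B) with hC'
  have hC'0 : 0 ≤ C' := by positivity
  set K₀ := (C₃ + 1) / rate with hK₀
  have hK₀0 : 0 < K₀ := by positivity
  set G := K₀ * (K * (3 * C ^ 2)) with hG
  have hG0 : 0 ≤ G := by positivity
  set c := min ν (1 / (K₀ * M)) with hc
  have hc0 : 0 < c := by positivity
  -- The bound of `bounded_of_deriv_le`, with the largest initial value of `v ^ 2 + K₀ * oscW` that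
  -- data of size `R` allow.
  set Q := Real.exp ((C' + G * B) * B / μ) * (R ^ 2 + K₀ * (M * R ^ 2) + (C₃ * C ^ 2 + G * B ^ 2) / c)
    with hQ
  have hQ0 : 0 ≤ Q := by positivity
  refine ⟨√Q + 1, by positivity, fun T z hz hv0 he0 t ht => ?_⟩
  obtain ⟨s, hs, hsign⟩ := S.exists_sign hz
  obtain ⟨hlow, hup, hder⟩ := hosc s hs
  have herr0 := (z t₀).errNorm_nonneg D (urd t₀) (deriv urd t₀) Vx Vy
  have hWnn : ∀ p r, 0 ≤ oscW D.k.k2 ε s p r := fun p r => le_trans (by positivity) (hlow p r)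
  have hinit : (z t₀).v ^ 2 + K₀ * oscW D.k.k2 ε s ((z t₀).ePsi D (urd t₀))
      ((z t₀).eR D (urd t₀) (deriv urd t₀)) ≤ R ^ 2 + K₀ * (M * R ^ 2) := by
    have h1 : (z t₀).v ^ 2 ≤ R ^ 2 := by rw [← sq_abs]; gcongr
    have h2 := State.errNorm_sq D (urd t₀) (deriv urd t₀) Vx Vy (z t₀)
    have h3 := (z t₀).fast_nonneg D (urd t₀) Vx Vy
    have h4 : (z t₀).errNorm D (urd t₀) (deriv urd t₀) Vx Vy ^ 2 ≤ R ^ 2 := by gcongr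
    have h5 : (z t₀).ePsi D (urd t₀) ^ 2 + (z t₀).eR D (urd t₀) (deriv urd t₀) ^ 2 ≤ R ^ 2 := by
      have := sq_nonneg ((z t₀).ybp D)
      linarith
    have h6 := (hup ((z t₀).ePsi D (urd t₀)) ((z t₀).eR D (urd t₀) (deriv urd t₀))).trans
      (mul_le_mul_of_nonneg_left h5 hM.le)
    have h7 := mul_le_mul_of_nonneg_left h6 hK₀0.le
    linarith
  have key := bounded_of_deriv_le (T := T) (t₀ := t₀) (c := c) (μ := μ) (C := (C' + G * B) * B)
    (K := C₃ * C ^ 2 + G * B ^ 2)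
    (f := fun τ => (z τ).v ^ 2 + K₀ * oscW D.k.k2 ε s ((z τ).ePsi D (urd τ))
      ((z τ).eR D (urd τ) (deriv urd τ)))
    hc0 hμ (by positivity) (by positivity)
    (by have := hWnn ((z t₀).ePsi D (urd t₀)) ((z t₀).eR D (urd t₀) (deriv urd t₀)); positivity)
    (fun τ hτ => ((hz.sol.v_eq τ hτ).pow 2).add ((hasDerivWithinAt_oscW
      (hz.sol.hasDeriv_ePsi hτ (S.regular hz hτ) S.hurd)
      (hz.sol.hasDeriv_eR hτ (S.regular hz hτ) S.hurd)).const_mul K₀)) (fun τ hτ => ?_) ht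
  · have h1 : (z t).v ^ 2 ≤ Q := by
      have h2 := mul_nonneg hK₀0.le
        (hWnn ((z t).ePsi D (urd t)) ((z t).eR D (urd t) (deriv urd t)))
      have h3 : Real.exp ((C' + G * B) * B / μ) * ((z t₀).v ^ 2 + K₀ * oscW D.k.k2 ε s
          ((z t₀).ePsi D (urd t₀)) ((z t₀).eR D (urd t₀) (deriv urd t₀))
          + (C₃ * C ^ 2 + G * B ^ 2) / c) ≤ Q := by
        rw [hQ]
        gcongr
      linarith
    linarith [Real.abs_le_sqrt h1]
  · have hP := hpt T z hz he0 τ hτ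
    have hforce := S.forcing_le hP
    have hF0 : 0 ≤ √((z τ).fast D (urd τ) Vx Vy) := Real.sqrt_nonneg _
    obtain ⟨f1, f2, -, -⟩ := (z τ).abs_le_sqrt_fast D (urd τ) Vx Vy
    have hsq := Real.sq_sqrt ((z τ).fast_nonneg D (urd τ) Vx Vy)
    -- This decay makes the positive part of the growth rate integrable.
    have hFe : √((z τ).fast D (urd τ) Vx Vy) ≤ B * Real.exp (-μ * (τ - t₀)) :=
      (hfast T z hz τ hτ).trans (by rw [hB]; gcongr)
    have hexp1 : Real.exp (-μ * (τ - t₀)) ≤ 1 :=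
      Real.exp_le_one_iff.2 (mul_nonpos_of_nonpos_of_nonneg (neg_nonpos.2 hμ.le)
        (sub_nonneg.2 hτ.1))
    have hFB : √((z τ).fast D (urd τ) Vx Vy) ≤ B := hFe.trans (mul_le_of_le_one_right hB0.le hexp1)
    set F := √((z τ).fast D (urd τ) Vx Vy) with hFdef
    set p := (z τ).ePsi D (urd τ) with hp
    set r := (z τ).eR D (urd τ) (deriv urd τ) with hr
    have hsway := sway_mul_le (X := D.w.X (z τ).u) (Y := D.w.Y (z τ).u) (r := (z τ).r)
      (rd := rdVec D ((z τ).rdArg D (urd τ) (deriv urd τ))) (e := r) (Xm := Xmax) (cX := cX)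
      (cY := cY) (b := b) (C := C) (B := B) (F := F) (ν := ν) (Ym := Ymin) (v := (z τ).v)
      hν hC.le hb0 hcX0 hF0 hFB
      ((S.X_le hτ.1 _).trans (by gcongr)) ((S.Y_le hτ.1 _).trans (by gcongr))
      (by rw [hr, State.eR]; ring) (hP.rd_le.trans (by gcongr)) hνdef
    have hosc' := hder ((z τ).CrVal D (urd τ)) p r ((z τ).total D (urd τ) * (z τ).VNe D Vx Vy)
      (-fderiv ℝ (rdVec D) ((z τ).rdArg D (urd τ) (deriv urd τ))
        ((z τ).rdArgUnknown D (urd τ) Vx Vy)) (hsign τ hτ) (by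
      refine (le_abs_self _).trans ?_
      have : |s| = 1 := by rw [← sq_eq_sq₀ (abs_nonneg _) zero_le_one, sq_abs, hs, one_pow]
      rw [abs_mul, this, one_mul]
      exact hP.Cr_le)
    rw [← hsq] at hforce
    have hosc'' := hosc'.trans (add_le_add_right (mul_le_mul_of_nonneg_left hforce hK.le) _)
    simp only [Nat.cast_ofNat, Nat.add_one_sub_one, pow_one]
    exact lyapunov_sum_le hC'0 hC₃0 (by positivity) hrate hK₀ hK.le hM hB0.le hF0 hFB hFe
      (sq_nonneg (z τ).v) (sq_nonneg p) (hWnn p r) (hup p r) (min_le_left _ _)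
      (min_le_right _ _) hsway hosc''

end Setting

theorem abs_le_sqrt_mul_exp {a C E c τ : ℝ} (hC : 0 ≤ C) (hE : 0 ≤ E)
    (h : a ^ 2 ≤ C * E ^ 2 * Real.exp (-c * τ)) : |a| ≤ √C * E * Real.exp (-(c / 2) * τ) := by
  refine abs_le_of_sq_le_sq (h.trans (le_of_eq ?_)) (by positivity)
  rw [mul_pow, mul_pow, Real.sq_sqrt hC, ← Real.exp_nat_mul]
  congr 2
  push_cast
  ring

/-- A scalar error that is damped at a rate `a / √(Δ ^ 2 + y ^ 2)` and driven by a decaying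
forcing decays exponentially. -/
theorem sq_decay_of_los {t₀ a Δ d μ E R : ℝ} {T : EReal} {y y' k : ℝ → ℝ} (ha : 0 < a)
    (hΔ : 0 < Δ) (hd : 0 ≤ d) (hμ : 0 < μ) (hE : 0 ≤ E) (hER : E ≤ R)
    (hy0 : |y t₀| ≤ E)
    (hy : ∀ t ∈ timeInterval t₀ T, HasDerivWithinAt y (y' t) (timeInterval t₀ T) t)
    (hk : ∀ t ∈ timeInterval t₀ T, a / √(Δ ^ 2 + y t ^ 2) ≤ k t)
    (h : ∀ t ∈ timeInterval t₀ T, |y' t + k t * y t| ≤ d * E * Real.exp (-μ * (t - t₀)))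
    {t : ℝ} (ht : t ∈ timeInterval t₀ T) :
    let b := a / √(Δ ^ 2 + (1 + R + d * R / μ) ^ 2)
    y t ^ 2 ≤ (1 + d ^ 2 / b / (2 * μ - min b μ)) * E ^ 2
      * Real.exp (-(min b μ) * (t - t₀)) := by
  intro b
  have hR : 0 ≤ R := hE.trans hER
  have hb : 0 < b := by positivity
  have hin : ∀ τ, 0 < 1 + y τ ^ 2 := fun τ => by positivity
  have hbound : ∀ τ ∈ timeInterval t₀ T, |y τ| ≤ 1 + R + d * R / μ := by
    intro τ hτ
    -- `√(1 + y ^ 2)` replaces `|y|` because it is differentiable. The damping can only decrease it,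
    -- so its growth is at most the integral `d * E / μ` of the forcing; hence the rate `c = 0`.
    have h1 := exp_decay_of_deriv_le (T := T) (t₀ := t₀) (c := 0) (μ := μ) (K := d * E)
      (f := fun τ => √(1 + y τ ^ 2)) hμ (by positivity)
      (fun s hs => (((hy s hs).pow 2).const_add 1).sqrt (hin s).ne') (fun s hs => by
        have hk0 : 0 ≤ k s := le_trans (by positivity) (hk s hs)
        have hpos : 0 < √(1 + y s ^ 2) := Real.sqrt_pos.2 (hin s)
        have hle : |y s| ≤ √(1 + y s ^ 2) := Real.abs_le_sqrt (by linarith)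
        simp only [Nat.cast_ofNat, Nat.add_one_sub_one, pow_one, neg_zero, zero_mul, zero_add,
          Pi.pow_apply]
        rw [div_le_iff₀ (by positivity)]
        have e1 : y s * y' s ≤ |y s| * |y' s + k s * y s| := by
          rw [← abs_mul]
          refine le_trans ?_ (le_abs_self _)
          nlinarith [mul_nonneg hk0 (sq_nonneg (y s))]
        have e2 : |y s| * |y' s + k s * y s|
            ≤ √(1 + y s ^ 2) * (d * E * Real.exp (-μ * (s - t₀))) := by
          have := h s hs
          gcongr
        linarith) hτ
    simp only [neg_zero, zero_mul, Real.exp_zero, mul_one, sub_zero] at h1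
    have h2 : |y τ| ≤ √(1 + y τ ^ 2) := Real.abs_le_sqrt (by linarith)
    have h3 : √(1 + y t₀ ^ 2) ≤ 1 + E := by
      refine Real.sqrt_le_iff.2 ⟨by positivity, ?_⟩
      nlinarith [sq_abs (y t₀), abs_nonneg (y t₀)]
    have h4 : d * E / μ ≤ d * R / μ := by gcongr
    linarith
  have hc : min b μ < 2 * μ := (min_le_right _ _).trans_lt (by linarith)
  have key := exp_decay_of_deriv_le (T := T) (t₀ := t₀) (c := min b μ) (μ := 2 * μ)
    (K := d ^ 2 / b * E ^ 2) (f := fun τ => y τ ^ 2) hc (by positivity)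
    (fun s hs => (hy s hs).pow 2) (fun s hs => by
      -- On the bounded range of `y` just obtained, the damping rate has the positive lower bound
      -- `b`.
      have hkb : b ≤ k s := by
        refine le_trans ?_ (hk s hs)
        have h1 : y s ^ 2 ≤ (1 + R + d * R / μ) ^ 2 := by
          rw [← sq_abs]; gcongr; exact hbound s hs
        have h2 : 0 < √(Δ ^ 2 + y s ^ 2) := Real.sqrt_pos.2 (by positivity)
        change a / √(Δ ^ 2 + (1 + R + d * R / μ) ^ 2) ≤ a / √(Δ ^ 2 + y s ^ 2)
        gcongr
      have h1 := two_mul_le_young hb (y s) (y' s + k s * y s)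
      have h2 : (y' s + k s * y s) ^ 2 ≤ (d * E * Real.exp (-μ * (s - t₀))) ^ 2 :=
        sq_le_sq.2 ((h s hs).trans (le_abs_self _))
      have h3 : (d * E * Real.exp (-μ * (s - t₀))) ^ 2
          = d ^ 2 * E ^ 2 * Real.exp (-(2 * μ) * (s - t₀)) := by
        rw [mul_pow, mul_pow, ← Real.exp_nat_mul]
        congr 2
        push_cast
        ring
      have h4 : (y' s + k s * y s) ^ 2 / b ≤ d ^ 2 / b * E ^ 2
          * Real.exp (-(2 * μ) * (s - t₀)) := by
        rw [div_le_iff₀ hb]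
        calc _ ≤ _ := h2
          _ = _ := h3
          _ = _ := by field_simp
      have h5 : b * y s ^ 2 ≤ k s * y s ^ 2 := by gcongr
      have h6 : min b μ * y s ^ 2 ≤ b * y s ^ 2 := by gcongr; exact min_le_left _ _
      simp only [Nat.cast_ofNat, Nat.add_one_sub_one, pow_one]
      linarith) ht
  refine key.trans ?_
  have h0 : y t₀ ^ 2 ≤ E ^ 2 := by rw [← sq_abs]; gcongr
  have hc' := sub_pos.2 hc
  calc _ ≤ (E ^ 2 + d ^ 2 / b * E ^ 2 / (2 * μ - min b μ))
        * Real.exp (-(min b μ) * (t - t₀)) := by gcongr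
    _ = _ := by ring

/-! ### Exponential decay of the yaw and normal errors -/

namespace Setting

set_option linter.unusedSectionVars false
variable {D : Design} {Vx Vy Vmax : ℝ} {urd : ℝ → ℝ} {t₀ Xmax Ymin κmax κmax' Mq σ cr : ℝ}
  (S : Setting D Vx Vy Vmax urd t₀ Xmax Ymin κmax κmax' Mq σ cr)
include S

/-- Once `v` is bounded, the forcing of the yaw dynamics is bounded by a constant times
`State.fast`, and the strict Lyapunov function turns its decay into decay of the yaw errors. -/
theorem yaw_decay (R : ℝ) (hR : 0 < R) : ∃ C > 0, ∃ c > 0, ∀ T z,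
    InTube D Vx Vy Vmax urd σ cr t₀ T z → |(z t₀).v| ≤ R →
    (z t₀).errNorm D (urd t₀) (deriv urd t₀) Vx Vy ≤ R →
    ∀ t ∈ timeInterval t₀ T, (z t).ePsi D (urd t) ^ 2 + (z t).eR D (urd t) (deriv urd t) ^ 2
      ≤ C * (z t₀).errNorm D (urd t₀) (deriv urd t₀) Vx Vy ^ 2 * Real.exp (-c * (t - t₀)) := by
  obtain ⟨Cf, hCf, μ, hμ, hfast⟩ := S.fast_decay
  obtain ⟨C, hC, a, ha, hpt⟩ := S.exists_pointwise R
  obtain ⟨Bv, hBv, hv⟩ := S.sway_bounded R hR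
  obtain ⟨ε, hε, rate, hrate, K, hK, m, hm, M, hM, hosc⟩ :=
    exists_oscW D.k.k1_pos D.k.k2_pos S.hcr hC
  set c := min (rate / M) (μ / 2) with hc
  have hc0 : 0 < c := by positivity
  have hcμ : c < μ := (min_le_right _ _).trans_lt (by linarith)
  have hμc := sub_pos.2 hcμ
  set G := K * (3 * C ^ 2 * (1 + Bv ^ 2) * Cf) with hG
  have hG0 : 0 ≤ G := by positivity
  refine ⟨(M + G / (μ - c)) / m, by positivity, c, hc0, fun T z hz hv0 he0 t ht => ?_⟩
  set A := (z t₀).errNorm D (urd t₀) (deriv urd t₀) Vx Vy ^ 2 with hA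
  have hA0 : 0 ≤ A := by positivity
  obtain ⟨s, hs, hsign⟩ := S.exists_sign hz
  obtain ⟨hlow, hup, hder⟩ := hosc s hs
  have key := exp_decay_of_deriv_le (T := T) (t₀ := t₀) (c := c) (μ := μ) (K := G * A)
    hcμ (by positivity) (fun τ hτ => hasDerivWithinAt_oscW (k₂ := D.k.k2) (ε := ε) (s := s)
      (hz.sol.hasDeriv_ePsi hτ (S.regular hz hτ) S.hurd)
      (hz.sol.hasDeriv_eR hτ (S.regular hz hτ) S.hurd)) (fun τ hτ => by
    have hP := hpt T z hz he0 τ hτ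
    have hosc' := hder ((z τ).CrVal D (urd τ)) ((z τ).ePsi D (urd τ))
      ((z τ).eR D (urd τ) (deriv urd τ)) ((z τ).total D (urd τ) * (z τ).VNe D Vx Vy)
      (-fderiv ℝ (rdVec D) ((z τ).rdArg D (urd τ) (deriv urd τ))
        ((z τ).rdArgUnknown D (urd τ) Vx Vy)) (hsign τ hτ) (by
      refine (le_abs_self _).trans ?_
      have : |s| = 1 := by rw [← sq_eq_sq₀ (abs_nonneg _) zero_le_one, sq_abs, hs, one_pow]
      rw [abs_mul, this, one_mul]
      exact hP.Cr_le)
    have h1 : 3 * C ^ 2 * (1 + (z τ).v ^ 2) * (z τ).fast D (urd τ) Vx Vy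
        ≤ 3 * C ^ 2 * (1 + Bv ^ 2) * (Cf * A * Real.exp (-μ * (τ - t₀))) := by
      have h2 : (z τ).v ^ 2 ≤ Bv ^ 2 := by rw [← sq_abs]; gcongr; exact hv T z hz hv0 he0 τ hτ
      have := (z τ).fast_nonneg D (urd τ) Vx Vy
      gcongr
      exact hfast T z hz τ hτ
    have h2 := mul_le_mul_of_nonneg_left ((S.forcing_le hP).trans h1) hK.le
    refine hosc'.trans (add_le_add ?_ (h2.trans (le_of_eq (by rw [hG]; ring))))
    have h3 := hup ((z τ).ePsi D (urd τ)) ((z τ).eR D (urd τ) (deriv urd τ))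
    have h4 : 0 ≤ oscW D.k.k2 ε s ((z τ).ePsi D (urd τ)) ((z τ).eR D (urd τ) (deriv urd τ)) :=
      le_trans (by positivity) (hlow _ _)
    rw [neg_mul, neg_mul, neg_le_neg_iff]
    calc _ ≤ rate / M * (M * ((z τ).ePsi D (urd τ) ^ 2
          + (z τ).eR D (urd τ) (deriv urd τ) ^ 2)) := by gcongr; exact min_le_left _ _
      _ = _ := by field_simp) ht
  have h1 := hlow ((z t).ePsi D (urd t)) ((z t).eR D (urd t) (deriv urd t))
  have h2 := hup ((z t₀).ePsi D (urd t₀)) ((z t₀).eR D (urd t₀) (deriv urd t₀))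
  have h3 : (z t₀).ePsi D (urd t₀) ^ 2 + (z t₀).eR D (urd t₀) (deriv urd t₀) ^ 2 ≤ A := by
    rw [hA, State.errNorm_sq]
    have := (z t₀).fast_nonneg D (urd t₀) Vx Vy
    have := sq_nonneg ((z t₀).ybp D)
    linarith
  have h4 := h2.trans (mul_le_mul_of_nonneg_left h3 hM.le)
  rw [div_mul_eq_mul_div, div_mul_eq_mul_div, le_div_iff₀ hm, mul_comm _ m]
  calc _ ≤ _ := h1
    _ ≤ _ := key
    _ ≤ (M * A + G * A / (μ - c)) * Real.exp (-c * (t - t₀)) := by gcongr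
    _ = _ := by ring

/-- With `v` bounded and all other errors decaying in proportion to the initial error, the forcing
of the normal error has the form required by `sq_decay_of_los`. -/
theorem ybp_decay (R : ℝ) (hR : 0 < R) : ∃ C > 0, ∃ c > 0, ∀ T z,
    InTube D Vx Vy Vmax urd σ cr t₀ T z → |(z t₀).v| ≤ R →
    (z t₀).errNorm D (urd t₀) (deriv urd t₀) Vx Vy ≤ R →
    ∀ t ∈ timeInterval t₀ T, (z t).ybp D ^ 2
      ≤ C * (z t₀).errNorm D (urd t₀) (deriv urd t₀) Vx Vy ^ 2 * Real.exp (-c * (t - t₀)) := by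
  obtain ⟨Bf, hBf, μ, hμ, hfast⟩ := S.sqrt_fast_decay
  obtain ⟨C, hC, a, ha, hpt⟩ := S.exists_pointwise R
  obtain ⟨Bv, hBv, hv⟩ := S.sway_bounded R hR
  obtain ⟨Cy, hCy, c₁, hc₁, hyaw⟩ := S.yaw_decay R hR
  -- `c₁` is a rate for squares, whereas `μ` already refers to the errors themselves.
  set ν := min μ (c₁ / 2) with hν
  have hν0 : 0 < ν := by positivity
  -- The two `Bf` in the bracket stand for the tangential and surge errors and `√Cy` for the yaw
  -- angle error, all within `G1`; the last `Bf` is the normal current error.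
  set d := C * (1 + Bv) * (2 * Bf + √Cy) + Bf with hd
  have hd0 : 0 ≤ d := by positivity
  set b := a / √(D.k.Δ ^ 2 + (1 + R + d * R / ν) ^ 2) with hb
  have hΔ := D.k.Δ_pos
  have hb0 : 0 < b := by positivity
  have hbν : 0 < 2 * ν - min b ν := by linarith [min_le_right b ν]
  refine ⟨1 + d ^ 2 / b / (2 * ν - min b ν), by positivity, min b ν, by positivity,
    fun T z hz hv0 he0 t ht => ?_⟩
  have hE0 := (z t₀).errNorm_nonneg D (urd t₀) (deriv urd t₀) Vx Vy
  set E := (z t₀).errNorm D (urd t₀) (deriv urd t₀) Vx Vy with hE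
  refine sq_decay_of_los (y := fun τ => (z τ).ybp D) ha hΔ hd0 hν0 hE0 he0 ?_
    (fun τ hτ => hz.sol.hasDeriv_ybp hτ (S.regular hz hτ))
    (fun τ hτ => (hpt T z hz he0 τ hτ).los_rate) (fun τ hτ => ?_) ht
  · refine abs_le_of_sq_le_sq ?_ hE0
    rw [hE, State.errNorm_sq]
    have := (z t₀).fast_nonneg D (urd t₀) Vx Vy
    have := sq_nonneg ((z t₀).ePsi D (urd t₀))
    have := sq_nonneg ((z t₀).eR D (urd t₀) (deriv urd t₀))
    linarith
  · have hP := hpt T z hz he0 τ hτ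
    have hτ0 := sub_nonneg.2 hτ.1
    have hF : √((z τ).fast D (urd τ) Vx Vy) ≤ Bf * E * Real.exp (-ν * (τ - t₀)) := by
      refine (hfast T z hz τ hτ).trans ?_
      gcongr
      exact min_le_left _ _
    have hp : |(z τ).ePsi D (urd τ)| ≤ √Cy * E * Real.exp (-ν * (τ - t₀)) := by
      refine (abs_le_sqrt_mul_exp hCy.le hE0 (le_trans (le_add_of_nonneg_right (sq_nonneg _))
        (hyaw T z hz hv0 he0 τ hτ))).trans ?_
      gcongr
      exact min_le_right _ _
    obtain ⟨f1, f2, -, -⟩ := (z τ).abs_le_sqrt_fast D (urd τ) Vx Vy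
    have hN : |(z τ).VNe D Vx Vy| ≤ √((z τ).fast D (urd τ) Vx Vy) := by
      refine ((z τ).current_le_sqrt_obs D Vx Vy).1.trans (Real.sqrt_le_sqrt ?_)
      rw [State.fast]
      have := sq_nonneg ((z τ).xbp D)
      have := sq_nonneg ((z τ).u - urd τ)
      linarith
    have hG : |G1 D (z τ).θ (z τ).v (z τ).u (urd τ) ((z τ).VN D) ((z τ).ybp D) ((z τ).xbp D)
        ((z τ).ePsi D (urd τ)) ((z τ).thetaRate D)|
        ≤ C * (1 + Bv) * (Bf * E * Real.exp (-ν * (τ - t₀)) + √Cy * E * Real.exp (-ν * (τ - t₀))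
          + Bf * E * Real.exp (-ν * (τ - t₀))) := by
      refine hP.G1_le.trans ?_
      have := hv T z hz hv0 he0 τ hτ
      have g1 := f1.trans hF
      have g2 := f2.trans hF
      gcongr
    have e : yDotKnown D (z τ).θ (z τ).v (z τ).u (urd τ) ((z τ).VN D) ((z τ).ybp D) ((z τ).xbp D)
          ((z τ).ePsi D (urd τ)) ((z τ).thetaRate D) + (z τ).VNe D Vx Vy
        + ut (urd τ) (z τ).v / √(D.k.Δ ^ 2 + ((z τ).ybp D
          + g D.k.Δ (z τ).v (urd τ) ((z τ).VN D) ((z τ).ybp D)) ^ 2) * (z τ).ybp D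
        = G1 D (z τ).θ (z τ).v (z τ).u (urd τ) ((z τ).VN D) ((z τ).ybp D) ((z τ).xbp D)
        ((z τ).ePsi D (urd τ)) ((z τ).thetaRate D) + (z τ).VNe D Vx Vy := by
      rw [yDotKnown]; ring
    rw [e]
    refine (abs_add_le _ _).trans ((add_le_add hG (hN.trans hF)).trans (le_of_eq ?_))
    rw [hd]; ring

theorem exp_estimate (R : ℝ) (hR : 0 < R) : ∃ C > 0, ∃ rate > 0, ∀ T z,
    InTube D Vx Vy Vmax urd σ cr t₀ T z → |(z t₀).v| ≤ R →
    (z t₀).errNorm D (urd t₀) (deriv urd t₀) Vx Vy ≤ R →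
    ∀ t ∈ timeInterval t₀ T, (z t).errNorm D (urd t) (deriv urd t) Vx Vy
      ≤ C * (z t₀).errNorm D (urd t₀) (deriv urd t₀) Vx Vy * Real.exp (-rate * (t - t₀)) := by
  obtain ⟨C₁, hC₁, c₁, hc₁, h₁⟩ := S.fast_decay
  obtain ⟨C₂, hC₂, c₂, hc₂, h₂⟩ := S.yaw_decay R hR
  obtain ⟨C₃, hC₃, c₃, hc₃, h₃⟩ := S.ybp_decay R hR
  set c := min c₁ (min c₂ c₃) with hc
  refine ⟨√(C₁ + C₂ + C₃), by positivity, c / 2, by positivity, fun T z hz hv0 he0 t ht => ?_⟩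
  have hE0 := (z t₀).errNorm_nonneg D (urd t₀) (deriv urd t₀) Vx Vy
  have hτ := sub_nonneg.2 ht.1
  refine (le_abs_self _).trans (abs_le_sqrt_mul_exp (by positivity) hE0 ?_)
  rw [State.errNorm_sq]
  have g₁ := h₁ T z hz t ht
  have g₂ := h₂ T z hz hv0 he0 t ht
  have g₃ := h₃ T z hz hv0 he0 t ht
  set E := (z t₀).errNorm D (urd t₀) (deriv urd t₀) Vx Vy with hE
  have i₁ : C₁ * E ^ 2 * Real.exp (-c₁ * (t - t₀)) ≤ C₁ * E ^ 2 * Real.exp (-c * (t - t₀)) := by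
    gcongr; exact min_le_left _ _
  have i₂ : C₂ * E ^ 2 * Real.exp (-c₂ * (t - t₀)) ≤ C₂ * E ^ 2 * Real.exp (-c * (t - t₀)) := by
    gcongr; exact (min_le_right _ _).trans (min_le_left _ _)
  have i₃ : C₃ * E ^ 2 * Real.exp (-c₃ * (t - t₀)) ≤ C₃ * E ^ 2 * Real.exp (-c * (t - t₀)) := by
    gcongr; exact (min_le_right _ _).trans (min_le_right _ _)
  calc _ ≤ C₁ * E ^ 2 * Real.exp (-c * (t - t₀)) + C₃ * E ^ 2 * Real.exp (-c * (t - t₀))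
        + C₂ * E ^ 2 * Real.exp (-c * (t - t₀)) := by linarith
    _ = _ := by ring

end Setting

/-! ### Bounded quantities along solutions -/

namespace BoundedAlong

variable {F : EReal → (ℝ → State) → Prop} {err : ℝ → State → ℝ} {t₀ : ℝ} {f f₁ f₂ : ℝ → State → ℝ}

theorem mono (h : BoundedAlong F err t₀ f₁) (hle : ∀ t z, |f t z| ≤ |f₁ t z|) :
    BoundedAlong F err t₀ f := fun R hR => by
  obtain ⟨B, hB⟩ := h R hR
  exact ⟨B, fun T z hz hv he t ht => (hle t _).trans (hB T z hz hv he t ht)⟩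

theorem of_abs_le {B : ℝ} (hle : ∀ t z, |f t z| ≤ B) : BoundedAlong F err t₀ f :=
  fun _ _ => ⟨B, fun _ _ _ _ _ t _ => hle t _⟩

theorem const (c : ℝ) : BoundedAlong F err t₀ (fun _ _ => c) := of_abs_le fun _ _ => le_rfl

theorem cos (f : ℝ → State → ℝ) : BoundedAlong F err t₀ (fun t z => Real.cos (f t z)) :=
  of_abs_le fun _ _ => Real.abs_cos_le_one _

theorem sin (f : ℝ → State → ℝ) : BoundedAlong F err t₀ (fun t z => Real.sin (f t z)) :=
  of_abs_le fun _ _ => Real.abs_sin_le_one _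

theorem add (h₁ : BoundedAlong F err t₀ f₁) (h₂ : BoundedAlong F err t₀ f₂) :
    BoundedAlong F err t₀ (fun t z => f₁ t z + f₂ t z) := fun R hR => by
  obtain ⟨B₁, hB₁⟩ := h₁ R hR
  obtain ⟨B₂, hB₂⟩ := h₂ R hR
  exact ⟨B₁ + B₂, fun T z hz hv he t ht => (abs_add_le _ _).trans
    (add_le_add (hB₁ T z hz hv he t ht) (hB₂ T z hz hv he t ht))⟩

theorem neg (h₁ : BoundedAlong F err t₀ f₁) : BoundedAlong F err t₀ (fun t z => -f₁ t z) :=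
  h₁.mono fun _ _ => (abs_neg _).le

theorem sub (h₁ : BoundedAlong F err t₀ f₁) (h₂ : BoundedAlong F err t₀ f₂) :
    BoundedAlong F err t₀ (fun t z => f₁ t z - f₂ t z) := by
  simpa only [sub_eq_add_neg] using h₁.add h₂.neg

theorem mul (h₁ : BoundedAlong F err t₀ f₁) (h₂ : BoundedAlong F err t₀ f₂) :
    BoundedAlong F err t₀ (fun t z => f₁ t z * f₂ t z) := fun R hR => by
  obtain ⟨B₁, hB₁⟩ := h₁ R hR
  obtain ⟨B₂, hB₂⟩ := h₂ R hR
  refine ⟨B₁ * B₂, fun T z hz hv he t ht => ?_⟩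
  have h1 := hB₁ T z hz hv he t ht
  have h2 := hB₂ T z hz hv he t ht
  rw [abs_mul]
  exact mul_le_mul h1 h2 (abs_nonneg _) ((abs_nonneg _).trans h1)

end BoundedAlong

theorem State.abs_le_errNorm (D : Design) (q q' Vx Vy : ℝ) (z : State) :
    |z.xbp D| ≤ z.errNorm D q q' Vx Vy ∧ |z.ybp D| ≤ z.errNorm D q q' Vx Vy ∧
    |z.ePsi D q| ≤ z.errNorm D q q' Vx Vy ∧ |z.eR D q q'| ≤ z.errNorm D q q' Vx Vy ∧
    |z.u - q| ≤ z.errNorm D q q' Vx Vy ∧ |z.ex| ≤ z.errNorm D q q' Vx Vy ∧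
    |z.ey| ≤ z.errNorm D q q' Vx Vy ∧ |Vx - z.Vxh| ≤ z.errNorm D q q' Vx Vy ∧
    |Vy - z.Vyh| ≤ z.errNorm D q q' Vx Vy := by
  have h1 := sq_nonneg (z.xbp D)
  have h2 := sq_nonneg (z.ybp D)
  have h3 := sq_nonneg (z.ePsi D q)
  have h4 := sq_nonneg (z.eR D q q')
  have h5 := sq_nonneg (z.u - q)
  have h6 := sq_nonneg z.ex
  have h7 := sq_nonneg z.ey
  have h8 := sq_nonneg (Vx - z.Vxh)
  have h9 := sq_nonneg (Vy - z.Vyh)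
  refine ⟨?_, ?_, ?_, ?_, ?_, ?_, ?_, ?_, ?_⟩ <;> refine Real.abs_le_sqrt ?_ <;> linarith

/-- Boundedness along the solutions in the tube, uniform for bounded initial data. -/
abbrev TubeBounded (D : Design) (Vx Vy Vmax : ℝ) (urd : ℝ → ℝ) (σ cr t₀ : ℝ)
    (f : ℝ → State → ℝ) : Prop :=
  BoundedAlong (InTube D Vx Vy Vmax urd σ cr t₀)
    (fun t z => z.errNorm D (urd t) (deriv urd t) Vx Vy) t₀ f

namespace Setting

set_option linter.unusedSectionVars false
variable {D : Design} {Vx Vy Vmax : ℝ} {urd : ℝ → ℝ} {t₀ Xmax Ymin κmax κmax' Mq σ cr : ℝ}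
  (S : Setting D Vx Vy Vmax urd t₀ Xmax Ymin κmax κmax' Mq σ cr)
include S

theorem bdd_errNorm : TubeBounded D Vx Vy Vmax urd σ cr t₀
    (fun t z => z.errNorm D (urd t) (deriv urd t) Vx Vy) := fun R hR => by
  obtain ⟨C, hC, c, hc, h⟩ := S.exp_estimate R hR
  refine ⟨C * R * 1, fun T z hz hv he t ht => ?_⟩
  have h0 := (z t₀).errNorm_nonneg D (urd t₀) (deriv urd t₀) Vx Vy
  rw [abs_of_nonneg (State.errNorm_nonneg _ _ _ _ _ _)]
  refine (h T z hz hv he t ht).trans ?_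
  have h2 : Real.exp (-c * (t - t₀)) ≤ 1 := Real.exp_le_one_iff.2
    (mul_nonpos_of_nonpos_of_nonneg (neg_nonpos.2 hc.le) (sub_nonneg.2 ht.1))
  gcongr

theorem bdd_of_le {f : ℝ → State → ℝ}
    (h : ∀ t z, |f t z| ≤ z.errNorm D (urd t) (deriv urd t) Vx Vy) :
    TubeBounded D Vx Vy Vmax urd σ cr t₀ f :=
  S.bdd_errNorm.mono fun t z => (h t z).trans (le_abs_self _)

theorem bdd_xbp : TubeBounded D Vx Vy Vmax urd σ cr t₀ (fun _ z => z.xbp D) :=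
  S.bdd_of_le fun _ z => (z.abs_le_errNorm D _ _ _ _).1

theorem bdd_ybp : TubeBounded D Vx Vy Vmax urd σ cr t₀ (fun _ z => z.ybp D) :=
  S.bdd_of_le fun _ z => (z.abs_le_errNorm D _ _ _ _).2.1

theorem bdd_ePsi : TubeBounded D Vx Vy Vmax urd σ cr t₀ (fun t z => z.ePsi D (urd t)) :=
  S.bdd_of_le fun _ z => (z.abs_le_errNorm D _ _ _ _).2.2.1

theorem bdd_eR : TubeBounded D Vx Vy Vmax urd σ cr t₀
    (fun t z => z.eR D (urd t) (deriv urd t)) :=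
  S.bdd_of_le fun _ z => (z.abs_le_errNorm D _ _ _ _).2.2.2.1

theorem bdd_eU : TubeBounded D Vx Vy Vmax urd σ cr t₀ (fun t z => z.u - urd t) :=
  S.bdd_of_le fun _ z => (z.abs_le_errNorm D _ _ _ _).2.2.2.2.1

theorem bdd_ex : TubeBounded D Vx Vy Vmax urd σ cr t₀ (fun _ z => z.ex) :=
  S.bdd_of_le fun _ z => (z.abs_le_errNorm D _ _ _ _).2.2.2.2.2.1

theorem bdd_ey : TubeBounded D Vx Vy Vmax urd σ cr t₀ (fun _ z => z.ey) :=
  S.bdd_of_le fun _ z => (z.abs_le_errNorm D _ _ _ _).2.2.2.2.2.2.1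

theorem bdd_Vxh : TubeBounded D Vx Vy Vmax urd σ cr t₀ (fun _ z => z.Vxh) := by
  have h : TubeBounded D Vx Vy Vmax urd σ cr t₀ (fun _ z => Vx - z.Vxh) :=
    S.bdd_of_le fun _ z => (z.abs_le_errNorm D _ _ _ _).2.2.2.2.2.2.2.1
  simpa only [sub_sub_cancel] using (BoundedAlong.const Vx).sub h

theorem bdd_Vyh : TubeBounded D Vx Vy Vmax urd σ cr t₀ (fun _ z => z.Vyh) := by
  have h : TubeBounded D Vx Vy Vmax urd σ cr t₀ (fun _ z => Vy - z.Vyh) :=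
    S.bdd_of_le fun _ z => (z.abs_le_errNorm D _ _ _ _).2.2.2.2.2.2.2.2
  simpa only [sub_sub_cancel] using (BoundedAlong.const Vy).sub h

theorem bdd_v : TubeBounded D Vx Vy Vmax urd σ cr t₀ (fun _ z => z.v) := fun R hR => by
  obtain ⟨B, -, h⟩ := S.sway_bounded R hR
  exact ⟨B, h⟩

theorem bdd_urd : TubeBounded D Vx Vy Vmax urd σ cr t₀ (fun t _ => urd t) :=
  fun _ _ => ⟨Mq, fun _ _ _ _ _ t ht => (S.hurd_bdd t ht.1).1⟩

theorem bdd_urd' : TubeBounded D Vx Vy Vmax urd σ cr t₀ (fun t _ => deriv urd t) :=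
  fun _ _ => ⟨Mq, fun _ _ _ _ _ t ht => (S.hurd_bdd t ht.1).2.1⟩

theorem bdd_urd'' : TubeBounded D Vx Vy Vmax urd σ cr t₀ (fun t _ => deriv (deriv urd) t) :=
  fun _ _ => ⟨Mq, fun _ _ _ _ _ t ht => (S.hurd_bdd t ht.1).2.2⟩

theorem bdd_u : TubeBounded D Vx Vy Vmax urd σ cr t₀ (fun _ z => z.u) := by
  simpa only [sub_add_cancel] using S.bdd_eU.add S.bdd_urd

theorem bdd_κ : TubeBounded D Vx Vy Vmax urd σ cr t₀ (fun _ z => D.P.κ z.θ) :=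
  BoundedAlong.of_abs_le fun _ z => S.hκ z.θ

theorem bdd_VT : TubeBounded D Vx Vy Vmax urd σ cr t₀ (fun _ z => z.VT D) :=
  (S.bdd_Vxh.mul (.cos fun _ z => D.P.γ z.θ)).add (S.bdd_Vyh.mul (.sin fun _ z => D.P.γ z.θ))

theorem bdd_VN : TubeBounded D Vx Vy Vmax urd σ cr t₀ (fun _ z => z.VN D) :=
  (S.bdd_Vxh.neg.mul (.sin fun _ z => D.P.γ z.θ)).add (S.bdd_Vyh.mul (.cos fun _ z => D.P.γ z.θ))

theorem bdd_abs {f : ℝ → State → ℝ} (h : TubeBounded D Vx Vy Vmax urd σ cr t₀ f) :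
    TubeBounded D Vx Vy Vmax urd σ cr t₀ (fun t z => |f t z|) :=
  h.mono fun _ _ => (abs_abs _).le

/-- A quantity that is dominated, for initial data of size `R`, by a bounded quantity. -/
theorem bdd_of_pointwise {f : ℝ → State → ℝ} {b : ℝ → ℝ → State → ℝ}
    (hb : ∀ C, TubeBounded D Vx Vy Vmax urd σ cr t₀ (b C))
    (h : ∀ C a t z, t₀ ≤ t → Pointwise D Vx Vy (urd t) (deriv urd t) κmax σ C a z →
      |f t z| ≤ b C t z) :
    TubeBounded D Vx Vy Vmax urd σ cr t₀ f := fun R hR => by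
  obtain ⟨C, -, a, -, hpt⟩ := S.exists_pointwise R
  obtain ⟨B, hB⟩ := hb C R hR
  exact ⟨B, fun T z hz hv he t ht => (h C a t _ ht.1 (hpt T z hz he t ht)).trans
    ((le_abs_self _).trans (hB T z hz hv he t ht))⟩

theorem bdd_thetaRate : TubeBounded D Vx Vy Vmax urd σ cr t₀ (fun _ z => z.thetaRate D) :=
  S.bdd_of_pointwise (fun C => (BoundedAlong.const C).mul
    ((BoundedAlong.const 1).add (S.bdd_abs S.bdd_v))) fun _ _ _ _ _ h => h.theta_le

theorem bdd_CrVal : TubeBounded D Vx Vy Vmax urd σ cr t₀ (fun t z => z.CrVal D (urd t)) :=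
  S.bdd_of_pointwise (fun C => BoundedAlong.const C) fun _ _ _ _ _ h => h.Cr_le

theorem bdd_rd : TubeBounded D Vx Vy Vmax urd σ cr t₀
    (fun t z => rdVec D (z.rdArg D (urd t) (deriv urd t))) :=
  S.bdd_of_pointwise (fun C => (((BoundedAlong.const (κmax / σ + 1 / D.k.Δ)).add
    ((BoundedAlong.const C).mul (S.bdd_abs S.bdd_xbp))).mul (S.bdd_abs S.bdd_v)).add
      (BoundedAlong.const C)) fun _ _ _ _ _ h => h.rd_le

theorem bdd_yDotKnown : TubeBounded D Vx Vy Vmax urd σ cr t₀ (fun t z => yDotKnown D z.θ z.v z.u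
    (urd t) (z.VN D) (z.ybp D) (z.xbp D) (z.ePsi D (urd t)) (z.thetaRate D)) := by
  refine S.bdd_of_pointwise (b := fun C t z => (Mq + 1) * (1 + |z.v|) * (|z.ybp D| * (1 / D.k.Δ))
    + C * (1 + |z.v|) * (|z.xbp D| + |z.ePsi D (urd t)| + |z.u - urd t|)) (fun C => ?_)
    fun C a t z ht h => ?_
  · have hv : TubeBounded D Vx Vy Vmax urd σ cr t₀ (fun _ z => 1 + |z.v|) :=
      (BoundedAlong.const 1).add (S.bdd_abs S.bdd_v)
    exact (((BoundedAlong.const (Mq + 1)).mul hv).mul ((S.bdd_abs S.bdd_ybp).mul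
      (BoundedAlong.const (1 / D.k.Δ)))).add (((BoundedAlong.const C).mul hv).mul
        (((S.bdd_abs S.bdd_xbp).add (S.bdd_abs S.bdd_ePsi)).add (S.bdd_abs S.bdd_eU)))
  · rw [yDotKnown]
    refine (abs_add_le _ _).trans (add_le_add ?_ h.G1_le)
    have hΔ := D.k.Δ_pos
    have hut := ut_pos z.v (S.q_pos ht)
    have hsp := S.sp_le ht z.v
    rw [abs_mul, abs_neg, abs_of_pos hut, abs_div, div_eq_mul_one_div]
    have h1 : 1 / |√(D.k.Δ ^ 2 + (z.ybp D + g D.k.Δ z.v (urd t) (z.VN D) (z.ybp D)) ^ 2)|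
        ≤ 1 / D.k.Δ := by
      refine one_div_le_one_div_of_le hΔ ((Real.le_sqrt' hΔ).2 ?_ |>.trans (le_abs_self _))
      have := sq_nonneg (z.ybp D + g D.k.Δ z.v (urd t) (z.VN D) (z.ybp D))
      linarith
    have h2 := hut.le.trans hsp
    gcongr

theorem bdd_r : TubeBounded D Vx Vy Vmax urd σ cr t₀ (fun _ z => z.r) := by
  refine (S.bdd_eR.add S.bdd_rd).mono fun t z => le_of_eq ?_
  rw [State.eR, sub_add_cancel]

theorem bdd_Fu : TubeBounded D Vx Vy Vmax urd σ cr t₀ (fun _ z => D.w.Fu z.v z.r) :=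
  ((BoundedAlong.const _).mul (((BoundedAlong.const _).mul S.bdd_v).add
    ((BoundedAlong.const _).mul S.bdd_r))).mul S.bdd_r

theorem bdd_Fr : TubeBounded D Vx Vy Vmax urd σ cr t₀ (fun _ z => D.w.Fr z.u z.v z.r) := by
  have c : ∀ a : ℝ, TubeBounded D Vx Vy Vmax urd σ cr t₀ (fun _ _ => a) := BoundedAlong.const
  unfold Vessel.Fr
  simp only [div_eq_mul_inv]
  exact (((((c _).mul (c _)).sub ((c _).mul ((c _).add ((c _).mul S.bdd_u)))).mul (c _)).mul
    S.bdd_v).add (((((c _).mul ((c _).add ((c _).mul S.bdd_u))).sub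
      ((c _).mul ((c _).add ((c _).mul S.bdd_u)))).mul (c _)).mul S.bdd_r)

theorem bdd_tauU : TubeBounded D Vx Vy Vmax urd σ cr t₀
    (fun t z => z.tauU D (urd t) (deriv urd t)) :=
  ((S.bdd_Fu.neg.add S.bdd_urd').add ((BoundedAlong.const _).mul S.bdd_urd)).sub
    ((BoundedAlong.const _).mul S.bdd_eU)

theorem bdd_uRate : TubeBounded D Vx Vy Vmax urd σ cr t₀
    (fun t z => z.uRate D (urd t) (deriv urd t)) :=
  (S.bdd_Fu.sub ((BoundedAlong.const _).mul S.bdd_u)).add S.bdd_tauU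

theorem bdd_vRate : TubeBounded D Vx Vy Vmax urd σ cr t₀ (fun _ z => z.vRate D) :=
  ((((BoundedAlong.const _).mul S.bdd_u).add (BoundedAlong.const _)).mul S.bdd_r).add
    ((((BoundedAlong.const _).mul S.bdd_u).sub (BoundedAlong.const _)).mul S.bdd_v)

theorem bdd_rdArgRate (j : Fin 12) : TubeBounded D Vx Vy Vmax urd σ cr t₀
    (fun t z => z.rdArgRate D (urd t) (deriv urd t) (deriv (deriv urd) t) j) := by
  have c : ∀ a : ℝ, TubeBounded D Vx Vy Vmax urd σ cr t₀ (fun _ _ => a) := BoundedAlong.const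
  have hs : TubeBounded D Vx Vy Vmax urd σ cr t₀ (fun _ z => Real.sin (D.P.γ z.θ)) := .sin _
  have hc : TubeBounded D Vx Vy Vmax urd σ cr t₀ (fun _ z => Real.cos (D.P.γ z.θ)) := .cos _
  have hκ := S.bdd_κ.mul S.bdd_thetaRate
  fin_cases j
  · exact S.bdd_thetaRate
  · exact S.bdd_vRate
  · exact S.bdd_uRate
  · exact S.bdd_urd'
  · exact S.bdd_urd''
  · exact ((((c _).mul S.bdd_ex).mul hc).add (((c _).mul S.bdd_ey).mul hs)).add (hκ.mul S.bdd_VN)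
  · exact (((((c _).mul S.bdd_ex).neg).mul hs).add (((c _).mul S.bdd_ey).mul hc)).sub
      (hκ.mul S.bdd_VT)
  · exact S.bdd_yDotKnown
  · exact (c _).mul S.bdd_xbp
  · exact S.bdd_CrVal.mul S.bdd_eR
  · exact (c _).mul S.bdd_ex
  · exact (c _).mul S.bdd_ey

/-- Here the direction is the known rate of the arguments, whose `θ`-component does not vanish. The
bound on the normal error is therefore indispensable, and it is available because exponential decay
has already been proved. -/
theorem bdd_fderiv : TubeBounded D Vx Vy Vmax urd σ cr t₀ (fun t z =>
    fderiv ℝ (rdVec D) (z.rdArg D (urd t) (deriv urd t))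
      (z.rdArgRate D (urd t) (deriv urd t) (deriv (deriv urd) t))) := fun R hR => by
  choose B hB using fun j => S.bdd_rdArgRate j R hR
  obtain ⟨Bv, hv⟩ := S.bdd_v R hR
  obtain ⟨By, hy⟩ := S.bdd_ybp R hR
  obtain ⟨δ, M₀, hM⟩ := S.exists_lines R
  -- With `M ≥ By` the restriction on `y` times the `θ`-component holds for the normalised
  -- direction.
  obtain ⟨hb, hline⟩ := hM (max M₀ By) (le_max_left _ _)
  obtain ⟨C, hC, h⟩ := hb.exists_fderiv_rdVec_le
  set K := 1 + ∑ j, |B j| with hK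
  have hK0 : 0 < K := by positivity
  have hMq := S.Mq_pos
  refine ⟨K * (C * ((Mq + 1) * (1 + Bv))), fun T z hz hv0 he t ht => ?_⟩
  have hw : ∀ j, |(K⁻¹ • (z t).rdArgRate D (urd t) (deriv urd t) (deriv (deriv urd) t)) j| ≤ 1 := by
    intro j
    rw [Pi.smul_apply, smul_eq_mul, abs_mul, abs_of_pos (inv_pos.2 hK0),
      inv_mul_le_iff₀ hK0, mul_one]
    refine (hB j T z hz hv0 he t ht).trans ((le_abs_self _).trans ?_)
    have := Finset.single_le_sum (f := fun j => |B j|) (fun j _ => abs_nonneg _)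
      (Finset.mem_univ j)
    linarith
  obtain ⟨i, hξ, hw'⟩ := hline T z hz he t ht _ hw (by
    rw [abs_mul]
    refine (mul_le_of_le_one_right (abs_nonneg _) (hw 0)).trans ?_
    exact (hy T z hz hv0 he t ht).trans (le_max_right _ _))
  have h1 := h i
  have hsp : i.sp ≤ (Mq + 1) * (1 + Bv) := by
    have : i.sp = ut (urd t) (z t).v := by rw [Line.sp, hξ]; rfl
    rw [this]
    have hvt := hv T z hz hv0 he t ht
    refine (S.sp_le ht.1 _).trans ?_
    gcongr
  rw [hξ, hw', map_smul, smul_eq_mul, abs_mul, abs_of_pos (inv_pos.2 hK0),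
    inv_mul_le_iff₀ hK0] at h1
  exact h1.trans (by gcongr)

theorem bdd_tauR : TubeBounded D Vx Vy Vmax urd σ cr t₀
    (fun t z => z.tauR D (urd t) (deriv urd t) (deriv (deriv urd) t)) :=
  ((S.bdd_Fr.neg.add S.bdd_fderiv).sub ((BoundedAlong.const _).mul S.bdd_eR)).sub
    (((BoundedAlong.const _).mul S.bdd_CrVal).mul S.bdd_ePsi)

end Setting

/-! ## The closed loop as an ordinary differential equation in `ℝ¹¹` -/

/-- The coordinates of a state. -/
def State.vec (z : State) : Fin 11 → ℝ :=
  ![z.x, z.y, z.ψ, z.u, z.v, z.r, z.xh, z.yh, z.Vxh, z.Vyh, z.θ]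

/-- The state with given coordinates. -/
def State.ofVec (w : Fin 11 → ℝ) : State :=
  ⟨w 0, w 1, w 2, w 3, w 4, w 5, w 6, w 7, w 8, w 9, w 10⟩

theorem State.ofVec_vec (z : State) : State.ofVec z.vec = z := rfl

theorem State.vec_ofVec (w : Fin 11 → ℝ) : (State.ofVec w).vec = w := by
  funext j
  fin_cases j <;> rfl

/-- The closed-loop vector field; `p` lists the values of `u_rd` and its first two derivatives,
and the coordinates of the state. -/
def field (D : Design) (Vx Vy : ℝ) (p : (ℝ × ℝ × ℝ) × (Fin 11 → ℝ)) : Fin 11 → ℝ :=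
  let z := State.ofVec p.2
  ![z.u * Real.cos z.ψ - z.v * Real.sin z.ψ + Vx,
    z.u * Real.sin z.ψ + z.v * Real.cos z.ψ + Vy,
    z.r,
    z.uRate D p.1.1 p.1.2.1,
    z.vRate D,
    D.w.Fr z.u z.v z.r + z.tauR D p.1.1 p.1.2.1 p.1.2.2,
    z.u * Real.cos z.ψ - z.v * Real.sin z.ψ + z.Vxh + D.k.kx1 * z.ex,
    z.u * Real.sin z.ψ + z.v * Real.cos z.ψ + z.Vyh + D.k.ky1 * z.ey,
    D.k.kx2 * z.ex,
    D.k.ky2 * z.ey,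
    z.thetaRate D]

/-- The values of the reference and of its first two derivatives. -/
def jet (urd : ℝ → ℝ) (t : ℝ) : ℝ × ℝ × ℝ := (urd t, deriv urd t, deriv (deriv urd) t)

theorem continuous_jet {urd : ℝ → ℝ} (h : ContDiff ℝ 2 urd) : Continuous (jet urd) := by
  have h1 : ContDiff ℝ 1 (deriv urd) :=
    (contDiff_succ_iff_deriv (n := 1) (f := urd)).1 h |>.2.2
  exact h.continuous.prodMk (h1.continuous.prodMk (contDiff_one_iff_deriv.1 h1).2)

theorem IsSolution.hasDeriv_vec {D : Design} {Vx Vy : ℝ} {urd : ℝ → ℝ} {t₀ : ℝ} {T : EReal}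
    {z : ℝ → State} (h : IsSolution D Vx Vy urd t₀ T z) {t : ℝ} (ht : t ∈ timeInterval t₀ T) :
    HasDerivWithinAt (fun τ => (z τ).vec) (field D Vx Vy (jet urd t, (z t).vec))
      (timeInterval t₀ T) t := by
  rw [hasDerivWithinAt_pi]
  intro j
  fin_cases j
  · exact h.x_eq t ht
  · exact h.y_eq t ht
  · exact h.ψ_eq t ht
  · exact h.u_eq t ht
  · exact h.v_eq t ht
  · exact h.r_eq t ht
  · exact h.xh_eq t ht
  · exact h.yh_eq t ht
  · exact h.Vxh_eq t ht
  · exact h.Vyh_eq t ht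
  · exact h.θ_eq t ht

theorem isSolution_of_hasDeriv_vec {D : Design} {Vx Vy : ℝ} {urd : ℝ → ℝ} {t₀ : ℝ} {T : EReal}
    {z : ℝ → State} (hT : (t₀ : EReal) < T)
    (hcurv : ∀ t ∈ timeInterval t₀ T, 1 - D.P.κ (z t).θ * (z t).ybp D ≠ 0)
    (hCr : ∀ t ∈ timeInterval t₀ T, (z t).CrVal D (urd t) ≠ 0)
    (h : ∀ t ∈ timeInterval t₀ T, HasDerivWithinAt (fun τ => (z τ).vec)
      (field D Vx Vy (jet urd t, (z t).vec)) (timeInterval t₀ T) t) :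
    IsSolution D Vx Vy urd t₀ T z where
  lt := hT
  curv_ne := hcurv
  Cr_ne := hCr
  x_eq t ht := hasDerivWithinAt_pi.1 (h t ht) 0
  y_eq t ht := hasDerivWithinAt_pi.1 (h t ht) 1
  ψ_eq t ht := hasDerivWithinAt_pi.1 (h t ht) 2
  u_eq t ht := hasDerivWithinAt_pi.1 (h t ht) 3
  v_eq t ht := hasDerivWithinAt_pi.1 (h t ht) 4
  r_eq t ht := hasDerivWithinAt_pi.1 (h t ht) 5
  xh_eq t ht := hasDerivWithinAt_pi.1 (h t ht) 6
  yh_eq t ht := hasDerivWithinAt_pi.1 (h t ht) 7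
  Vxh_eq t ht := hasDerivWithinAt_pi.1 (h t ht) 8
  Vyh_eq t ht := hasDerivWithinAt_pi.1 (h t ht) 9
  θ_eq t ht := hasDerivWithinAt_pi.1 (h t ht) 10

/-! ### Smoothness of the vector field -/

theorem PlanarPath.contDiff_xP (P : PlanarPath) : ContDiff ℝ 1 P.xP := by
  have e : deriv P.xP = fun θ => Real.cos (P.γ θ) := funext fun θ => (P.hasDerivAt_xP θ).deriv
  refine contDiff_one_iff_deriv.2 ⟨fun θ => (P.hasDerivAt_xP θ).differentiableAt, ?_⟩
  rw [e]
  exact Real.continuous_cos.comp P.smooth_γ.continuous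

theorem PlanarPath.contDiff_yP (P : PlanarPath) : ContDiff ℝ 1 P.yP := by
  have e : deriv P.yP = fun θ => Real.sin (P.γ θ) := funext fun θ => (P.hasDerivAt_yP θ).deriv
  refine contDiff_one_iff_deriv.2 ⟨fun θ => (P.hasDerivAt_yP θ).differentiableAt, ?_⟩
  rw [e]
  exact Real.continuous_sin.comp P.smooth_γ.continuous

section Smooth

variable (D : Design) (Vx Vy : ℝ)

theorem contDiff_coord (j : Fin 11) :
    ContDiff ℝ 1 fun p : (ℝ × ℝ × ℝ) × (Fin 11 → ℝ) => p.2 j := by fun_prop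

theorem contDiff_γ : ContDiff ℝ 1 fun p : (ℝ × ℝ × ℝ) × (Fin 11 → ℝ) => D.P.γ (p.2 10) :=
  (D.P.smooth_γ.of_le (by simp)).comp (contDiff_coord 10)

theorem contDiff_curvature :
    ContDiff ℝ 1 fun p : (ℝ × ℝ × ℝ) × (Fin 11 → ℝ) => D.P.κ (p.2 10) :=
  (D.P.contDiff_κ.of_le (by simp)).comp (contDiff_coord 10)

theorem contDiff_xbp :
    ContDiff ℝ 1 fun p : (ℝ × ℝ × ℝ) × (Fin 11 → ℝ) => (State.ofVec p.2).xbp D :=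
  ((contDiff_γ D).cos.mul ((contDiff_coord 0).sub (D.P.contDiff_xP.comp (contDiff_coord 10)))).add
    ((contDiff_γ D).sin.mul ((contDiff_coord 1).sub (D.P.contDiff_yP.comp (contDiff_coord 10))))

theorem contDiff_ybp :
    ContDiff ℝ 1 fun p : (ℝ × ℝ × ℝ) × (Fin 11 → ℝ) => (State.ofVec p.2).ybp D :=
  ((contDiff_γ D).sin.neg.mul
      ((contDiff_coord 0).sub (D.P.contDiff_xP.comp (contDiff_coord 10)))).add
    ((contDiff_γ D).cos.mul ((contDiff_coord 1).sub (D.P.contDiff_yP.comp (contDiff_coord 10))))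

theorem contDiff_VT :
    ContDiff ℝ 1 fun p : (ℝ × ℝ × ℝ) × (Fin 11 → ℝ) => (State.ofVec p.2).VT D :=
  ((contDiff_coord 8).mul (contDiff_γ D).cos).add ((contDiff_coord 9).mul (contDiff_γ D).sin)

theorem contDiff_VN :
    ContDiff ℝ 1 fun p : (ℝ × ℝ × ℝ) × (Fin 11 → ℝ) => (State.ofVec p.2).VN D :=
  ((contDiff_coord 8).neg.mul (contDiff_γ D).sin).add ((contDiff_coord 9).mul (contDiff_γ D).cos)

variable {D} {p₀ : (ℝ × ℝ × ℝ) × (Fin 11 → ℝ)}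
  (hreg : Regular D.k.Δ (State.ofVec p₀.2).v p₀.1.1 ((State.ofVec p₀.2).VN D))
  (hcurv : 1 - D.P.κ (State.ofVec p₀.2).θ * (State.ofVec p₀.2).ybp D ≠ 0)
  (hCr : (State.ofVec p₀.2).CrVal D p₀.1.1 ≠ 0)

include hcurv in
-- The form without side-slip angle is used, since `Complex.arg` is not differentiable everywhere.
theorem contDiffAt_thetaRate :
    ContDiffAt ℝ 1 (fun p : (ℝ × ℝ × ℝ) × (Fin 11 → ℝ) => (State.ofVec p.2).thetaRate D) p₀ := by
  simp only [State.thetaRate, thetaDot_eq]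
  have h2 := (contDiff_coord 2).sub (contDiff_γ D)
  exact (((((contDiff_coord 3).mul h2.cos).sub ((contDiff_coord 4).mul h2.sin)).add
    (contDiff_VT D)).add (contDiff_const.mul (contDiff_xbp D))).contDiffAt.div
      (contDiff_const.sub ((contDiff_curvature D).mul (contDiff_ybp D))).contDiffAt hcurv

include hreg

theorem contDiffAt_add_g : ContDiffAt ℝ 1 (fun p : (ℝ × ℝ × ℝ) × (Fin 11 → ℝ) =>
    (State.ofVec p.2).ybp D + g D.k.Δ (State.ofVec p.2).v p.1.1 ((State.ofVec p.2).VN D)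
      ((State.ofVec p.2).ybp D)) p₀ := by
  have hq : ContDiff ℝ 1 fun p : (ℝ × ℝ × ℝ) × (Fin 11 → ℝ) => p.1.1 := by fun_prop
  have hN := contDiff_VN D
  have hy := contDiff_ybp D
  have ha := (hN.pow 2).sub ((hq.pow 2).add ((contDiff_coord 4).pow 2))
  have hb := hy.mul hN
  have hc := (contDiff_const (c := D.k.Δ ^ 2)).add (hy.pow 2)
  exact hy.contDiffAt.add (hN.contDiffAt.mul ((hb.contDiffAt.add
    (((hb.pow 2).sub (ha.mul hc)).contDiffAt.sqrt (hreg.disc_pos _).ne')).div ha.neg.contDiffAt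
      (neg_ne_zero.2 hreg.ga_neg.ne)))

theorem contDiffAt_los : ContDiffAt ℝ 1 (fun p : (ℝ × ℝ × ℝ) × (Fin 11 → ℝ) =>
    los D.k.Δ (State.ofVec p.2).v p.1.1 ((State.ofVec p.2).VN D) ((State.ofVec p.2).ybp D)) p₀ :=
  ((contDiffAt_add_g hreg).div_const D.k.Δ).arctan

theorem contDiffAt_ePsi : ContDiffAt ℝ 1 (fun p : (ℝ × ℝ × ℝ) × (Fin 11 → ℝ) =>
    (State.ofVec p.2).ePsi D p.1.1) p₀ := by
  have hq : ContDiff ℝ 1 fun p : (ℝ × ℝ × ℝ) × (Fin 11 → ℝ) => p.1.1 := by fun_prop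
  exact (contDiff_coord 2).contDiffAt.sub (((contDiff_γ D).contDiffAt.sub
    ((contDiff_coord 4).contDiffAt.div hq.contDiffAt hreg.q_pos.ne').arctan).sub
      (contDiffAt_los hreg))

theorem contDiffAt_rdArg : ContDiffAt ℝ 1 (fun p : (ℝ × ℝ × ℝ) × (Fin 11 → ℝ) =>
    (State.ofVec p.2).rdArg D p.1.1 p.1.2.1) p₀ := by
  have hq : ContDiff ℝ 1 fun p : (ℝ × ℝ × ℝ) × (Fin 11 → ℝ) => p.1.1 := by fun_prop
  have hq' : ContDiff ℝ 1 fun p : (ℝ × ℝ × ℝ) × (Fin 11 → ℝ) => p.1.2.1 := by fun_prop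
  rw [contDiffAt_pi]
  intro j
  fin_cases j
  · exact (contDiff_coord 10).contDiffAt
  · exact (contDiff_coord 4).contDiffAt
  · exact (contDiff_coord 3).contDiffAt
  · exact hq.contDiffAt
  · exact hq'.contDiffAt
  · exact (contDiff_VT D).contDiffAt
  · exact (contDiff_VN D).contDiffAt
  · exact (contDiff_ybp D).contDiffAt
  · exact (contDiff_xbp D).contDiffAt
  · exact contDiffAt_ePsi hreg
  · exact ((contDiff_coord 0).sub (contDiff_coord 6)).contDiffAt
  · exact ((contDiff_coord 1).sub (contDiff_coord 7)).contDiffAt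

theorem contDiffAt_CrVal : ContDiffAt ℝ 1 (fun p : (ℝ × ℝ × ℝ) × (Fin 11 → ℝ) =>
    (State.ofVec p.2).CrVal D p.1.1) p₀ := by
  have h := contDiffAt_Cr (n := 1) (D := D)
    (ξ := (State.ofVec p₀.2).rdArg D p₀.1.1 p₀.1.2.1) hreg
  exact h.comp p₀ (contDiffAt_rdArg hreg)

include hcurv

theorem contDiffAt_yDotKnown : ContDiffAt ℝ 1 (fun p : (ℝ × ℝ × ℝ) × (Fin 11 → ℝ) =>
    yDotKnown D (State.ofVec p.2).θ (State.ofVec p.2).v (State.ofVec p.2).u p.1.1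
      ((State.ofVec p.2).VN D) ((State.ofVec p.2).ybp D) ((State.ofVec p.2).xbp D)
      ((State.ofVec p.2).ePsi D p.1.1) ((State.ofVec p.2).thetaRate D)) p₀ := by
  have hq : ContDiff ℝ 1 fun p : (ℝ × ℝ × ℝ) × (Fin 11 → ℝ) => p.1.1 := by fun_prop
  have hut := contDiffAt_ut (contDiff_coord 4).contDiffAt hq.contDiffAt hreg.q_pos
  have hy := (contDiff_ybp D).contDiffAt (x := p₀)
  have hlos := contDiffAt_los hreg
  have hp := contDiffAt_ePsi hreg
  have hrel := (hp.sub ((contDiff_coord 4).contDiffAt.div hq.contDiffAt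
    hreg.q_pos.ne').arctan).sub hlos
  have hΔ := D.k.Δ_pos
  have hpos : ∀ s : ℝ, 0 < D.k.Δ ^ 2 + s ^ 2 := fun s => by positivity
  have hs := (contDiffAt_const (c := D.k.Δ ^ 2).add ((contDiffAt_add_g hreg).pow 2)).sqrt
    (hpos _).ne'
  exact (hut.neg.mul (hy.div hs (Real.sqrt_pos.2 (hpos _)).ne')).add
    ((((hut.mul (contDiffAt_const.sub hp.cos)).mul hlos.sin).add
      (((contDiff_coord 3).sub hq).contDiffAt.mul hrel.sin)).add
        ((hut.mul hlos.cos).mul hp.sin) |>.sub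
          ((contDiff_xbp D).contDiffAt.mul
            ((contDiff_curvature D).contDiffAt.mul (contDiffAt_thetaRate hcurv))))

include hCr

theorem good_of_regular : Good D ((State.ofVec p₀.2).rdArg D p₀.1.1 p₀.1.2.1) :=
  ⟨hreg, hcurv, hCr⟩

theorem contDiffAt_eR : ContDiffAt ℝ 1 (fun p : (ℝ × ℝ × ℝ) × (Fin 11 → ℝ) =>
    (State.ofVec p.2).eR D p.1.1 p.1.2.1) p₀ := by
  have h : ContDiffAt ℝ 1 (rdVec D) ((State.ofVec p₀.2).rdArg D p₀.1.1 p₀.1.2.1) :=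
    (good_of_regular hreg hcurv hCr).contDiffAt_rdVec.of_le (by simp)
  have h2 := h.comp p₀ (contDiffAt_rdArg hreg)
  exact (contDiff_coord 5).contDiffAt.sub h2

omit hreg hcurv hCr in
theorem contDiff_Fu : ContDiff ℝ 1 fun p : (ℝ × ℝ × ℝ) × (Fin 11 → ℝ) =>
    D.w.Fu (p.2 4) (p.2 5) := by
  unfold Vessel.Fu
  fun_prop

omit hreg hcurv hCr in
theorem contDiff_Fr : ContDiff ℝ 1 fun p : (ℝ × ℝ × ℝ) × (Fin 11 → ℝ) =>
    D.w.Fr (p.2 3) (p.2 4) (p.2 5) := by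
  unfold Vessel.Fr
  fun_prop

omit hreg hcurv hCr in
theorem contDiff_uRate : ContDiff ℝ 1 fun p : (ℝ × ℝ × ℝ) × (Fin 11 → ℝ) =>
    (State.ofVec p.2).uRate D p.1.1 p.1.2.1 := by
  have h := contDiff_Fu (D := D)
  unfold State.uRate State.tauU
  change ContDiff ℝ 1 fun p : (ℝ × ℝ × ℝ) × (Fin 11 → ℝ) => D.w.Fu (p.2 4) (p.2 5)
    - D.w.d11 / D.w.m11 * p.2 3 + (-D.w.Fu (p.2 4) (p.2 5) + p.1.2.1
      + D.w.d11 / D.w.m11 * p.1.1 - D.k.ku * (p.2 3 - p.1.1))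
  fun_prop

omit hreg hcurv hCr in
theorem contDiff_vRate : ContDiff ℝ 1 fun p : (ℝ × ℝ × ℝ) × (Fin 11 → ℝ) =>
    (State.ofVec p.2).vRate D :=
  (((contDiff_X D.w).comp (contDiff_coord 3)).mul (contDiff_coord 5)).add
    (((contDiff_Y D.w).comp (contDiff_coord 3)).mul (contDiff_coord 4))

theorem contDiffAt_rdArgRate : ContDiffAt ℝ 1 (fun p : (ℝ × ℝ × ℝ) × (Fin 11 → ℝ) =>
    (State.ofVec p.2).rdArgRate D p.1.1 p.1.2.1 p.1.2.2) p₀ := by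
  have hq' : ContDiff ℝ 1 fun p : (ℝ × ℝ × ℝ) × (Fin 11 → ℝ) => p.1.2.1 := by fun_prop
  have hq'' : ContDiff ℝ 1 fun p : (ℝ × ℝ × ℝ) × (Fin 11 → ℝ) => p.1.2.2 := by fun_prop
  have hx := (contDiff_coord 0).sub (contDiff_coord 6)
  have hy := (contDiff_coord 1).sub (contDiff_coord 7)
  have hγ := contDiff_γ D
  have hs := (contDiff_curvature D).contDiffAt.mul (contDiffAt_thetaRate hcurv)
  rw [contDiffAt_pi]
  intro j
  fin_cases j
  · exact contDiffAt_thetaRate hcurv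
  · exact contDiff_vRate.contDiffAt
  · exact contDiff_uRate.contDiffAt
  · exact hq'.contDiffAt
  · exact hq''.contDiffAt
  · exact ((((contDiff_const.mul hx).mul hγ.cos).add
      ((contDiff_const.mul hy).mul hγ.sin)).contDiffAt).add (hs.mul (contDiff_VN D).contDiffAt)
  · exact ((((contDiff_const.mul hx).neg.mul hγ.sin).add
      ((contDiff_const.mul hy).mul hγ.cos)).contDiffAt).sub (hs.mul (contDiff_VT D).contDiffAt)
  · exact contDiffAt_yDotKnown hreg hcurv
  · exact (contDiff_const.mul (contDiff_xbp D)).contDiffAt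
  · exact (contDiffAt_CrVal hreg).mul (contDiffAt_eR hreg hcurv hCr)
  · exact (contDiff_const.mul hx).contDiffAt
  · exact (contDiff_const.mul hy).contDiffAt

/-- The control contains the derivative of `r_d`, so continuous differentiability of the vector
field requires two derivatives of `r_d`. -/
theorem contDiffAt_tauR : ContDiffAt ℝ 1 (fun p : (ℝ × ℝ × ℝ) × (Fin 11 → ℝ) =>
    (State.ofVec p.2).tauR D p.1.1 p.1.2.1 p.1.2.2) p₀ := by
  have h1 : ContDiffAt ℝ 1 (fderiv ℝ (rdVec D)) ((State.ofVec p₀.2).rdArg D p₀.1.1 p₀.1.2.1) :=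
    ((good_of_regular hreg hcurv hCr).contDiffAt_rdVec.of_le
      (WithTop.coe_le_coe.2 le_top : (2 : WithTop ℕ∞) ≤ ∞)).fderiv_right (m := 1)
      one_add_one_eq_two.le
  have h2 := (h1.comp p₀ (contDiffAt_rdArg hreg)).clm_apply (contDiffAt_rdArgRate hreg hcurv hCr)
  exact (((contDiff_Fr.neg.contDiffAt).add h2).sub
    (contDiffAt_const.mul (contDiffAt_eR hreg hcurv hCr))).sub
      ((contDiffAt_const.mul (contDiffAt_CrVal hreg)).mul (contDiffAt_ePsi hreg))

theorem contDiffAt_field : ContDiffAt ℝ 1 (field D Vx Vy) p₀ := by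
  have hx := (contDiff_coord 0).sub (contDiff_coord 6)
  have hy := (contDiff_coord 1).sub (contDiff_coord 7)
  have h0 := ((contDiff_coord 3).mul (contDiff_coord 2).cos).sub
    ((contDiff_coord 4).mul (contDiff_coord 2).sin)
  have h1 := ((contDiff_coord 3).mul (contDiff_coord 2).sin).add
    ((contDiff_coord 4).mul (contDiff_coord 2).cos)
  rw [contDiffAt_pi]
  intro j
  fin_cases j
  · exact (h0.add contDiff_const).contDiffAt
  · exact (h1.add contDiff_const).contDiffAt
  · exact (contDiff_coord 5).contDiffAt
  · exact contDiff_uRate.contDiffAt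
  · exact contDiff_vRate.contDiffAt
  · exact contDiff_Fr.contDiffAt.add (contDiffAt_tauR hreg hcurv hCr)
  · exact ((h0.add (contDiff_coord 8)).add (contDiff_const.mul hx)).contDiffAt
  · exact ((h1.add (contDiff_coord 9)).add (contDiff_const.mul hy)).contDiffAt
  · exact (contDiff_const.mul hx).contDiffAt
  · exact (contDiff_const.mul hy).contDiffAt
  · exact contDiffAt_thetaRate hcurv

end Smooth

/-! ## Continuation of solutions -/

section Continuation

open Filter Set Topology

/-- Local existence for an ordinary differential equation whose right-hand side is continuously
differentiable in the state and in a continuous time-dependent parameter. -/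
theorem exists_local_solution {P E : Type*} [NormedAddCommGroup P] [NormedSpace ℝ P]
    [NormedAddCommGroup E] [NormedSpace ℝ E] [CompleteSpace E] {Φ : P × E → E} {c : ℝ → P}
    {T : ℝ} {w₀ : E} (hc : Continuous c) (hΦ : ContDiffAt ℝ 1 Φ (c T, w₀)) :
    ∃ ε > 0, ∃ α : ℝ → E, α T = w₀ ∧ ∀ t ∈ Icc (T - ε) (T + ε),
      HasDerivWithinAt α (Φ (c t, α t)) (Icc (T - ε) (T + ε)) t := by
  obtain ⟨K, s, hs, hl⟩ := hΦ.exists_lipschitzOnWith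
  obtain ⟨ρ, hρ, hρs⟩ := Metric.mem_nhds_iff.1 hs
  obtain ⟨ε₁, hε₁, hε₁c⟩ := Metric.continuousAt_iff.1 (hc.continuousAt (x := T)) ρ hρ
  -- `L` bounds the vector field on the ball of radius `ρ`, by the Lipschitz estimate from its
  -- centre.
  set L : ℝ := K * ρ + ‖Φ (c T, w₀)‖ + 1 with hL
  have hL0 : 0 < L := by positivity
  -- The time step is so short that the parameter stays in the Lipschitz neighbourhood and a curve
  -- of speed `L` moves by at most `ρ / 2`.
  set ε := min (ε₁ / 2) (ρ / 2 / L) with hε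
  have hε0 : 0 < ε := by positivity
  have hεε : ε < ε₁ := (min_le_left _ _).trans_lt (half_lt_self hε₁)
  have hmem : ∀ t ∈ Icc (T - ε) (T + ε), ∀ x ∈ Metric.closedBall w₀ (ρ / 2),
      (c t, x) ∈ Metric.ball (c T, w₀) ρ := by
    intro t ht x hx
    rw [Metric.mem_ball, Prod.dist_eq]
    refine max_lt (hε₁c ?_) ((Metric.mem_closedBall.1 hx).trans_lt (half_lt_self hρ))
    rw [Real.dist_eq, abs_lt]
    constructor <;> linarith [ht.1, ht.2]
  have hP : IsPicardLindelof (fun t x => Φ (c t, x)) (tmin := T - ε) (tmax := T + ε)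
      ⟨T, by constructor <;> linarith⟩ w₀ ⟨ρ / 2, by positivity⟩ 0 ⟨L, hL0.le⟩ K := by
    refine ⟨fun t ht => ?_, fun x hx => ?_, fun t ht x hx => ?_, ?_⟩
    · refine LipschitzOnWith.of_dist_le_mul fun x hx y hy => ?_
      refine (hl.dist_le_mul _ (hρs (hmem t ht x hx)) _ (hρs (hmem t ht y hy))).trans
        (le_of_eq ?_)
      rw [Prod.dist_eq, dist_self, max_eq_right dist_nonneg]
    · exact hl.continuousOn.comp (hc.prodMk continuous_const).continuousOn
        fun t ht => hρs (hmem t ht x hx)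
    · have h1 := hl.dist_le_mul _ (hρs (hmem t ht x hx)) _ (mem_of_mem_nhds hs)
      have h2 : dist (c t, x) (c T, w₀) ≤ ρ := (Metric.mem_ball.1 (hmem t ht x hx)).le
      have h3 : (K : ℝ) * dist (c t, x) (c T, w₀) ≤ K * ρ := by gcongr
      rw [dist_eq_norm] at h1
      have h4 := norm_le_norm_sub_add (Φ (c t, x)) (Φ (c T, w₀))
      change ‖Φ (c t, x)‖ ≤ L
      linarith
    · have h1 : L * ε ≤ ρ / 2 := by
        calc L * ε ≤ L * (ρ / 2 / L) := by gcongr; exact min_le_right _ _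
          _ = ρ / 2 := by field_simp
      change L * max (T + ε - T) (T - (T - ε)) ≤ ρ / 2 - 0
      rw [add_sub_cancel_left, sub_sub_cancel, max_self, sub_zero]
      exact h1
  obtain ⟨α, hα, h⟩ := hP.exists_eq_forall_mem_Icc_hasDerivWithinAt₀
  exact ⟨ε, hε0, α, hα, h⟩

/-- A function with bounded derivative on `[t₀, T)` has a limit at `T`. -/
theorem exists_tendsto_of_deriv_bounded {ι : Type*} [Fintype ι] {w w' : ℝ → ι → ℝ} {t₀ T B : ℝ}
    (hT : t₀ < T) (hw : ∀ t ∈ Ico t₀ T, HasDerivWithinAt w (w' t) (Ico t₀ T) t)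
    (hB : ∀ t ∈ Ico t₀ T, ‖w' t‖ ≤ B) : ∃ l, Tendsto w (𝓝[<] T) (𝓝 l) := by
  have hl : LipschitzOnWith B.toNNReal w (Ico t₀ T) :=
    (convex_Ico t₀ T).lipschitzOnWith_of_nnnorm_hasDerivWithin_le hw fun t ht => by
      rw [← NNReal.coe_le_coe, coe_nnnorm]
      exact (hB t ht).trans (Real.le_coe_toNNReal B)
  -- A bounded derivative on a convex set gives a Lipschitz map. It extends to the whole line, and
  -- the value of the extension at `T` is the limit.
  obtain ⟨g, hg, heq⟩ := hl.extend_pi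
  refine ⟨g T, ((hg.continuous.tendsto T).mono_left nhdsWithin_le_nhds).congr' ?_⟩
  filter_upwards [Ico_mem_nhdsLT hT] with t ht using (heq ht).symm

/-- Continuation of a solution that converges to a regular point. -/
theorem exists_continuation {P E : Type*} [NormedAddCommGroup P] [NormedSpace ℝ P]
    [NormedAddCommGroup E] [NormedSpace ℝ E] [CompleteSpace E] {Φ : P × E → E} {c : ℝ → P}
    {t₀ T : ℝ} {w : ℝ → E} {l : E} (hT : t₀ < T) (hc : Continuous c)
    (hΦ : ContDiffAt ℝ 1 Φ (c T, l))
    (hw : ∀ t ∈ Ico t₀ T, HasDerivWithinAt w (Φ (c t, w t)) (Ico t₀ T) t)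
    (hl : Tendsto w (𝓝[<] T) (𝓝 l)) :
    ∃ ε > 0, ∃ W : ℝ → E, (∀ t < T, W t = w t) ∧ W T = l ∧
      ∀ t ∈ Ico t₀ (T + ε), HasDerivWithinAt W (Φ (c t, W t)) (Ico t₀ (T + ε)) t := by
  obtain ⟨ε, hε, α, hαT, hα⟩ := exists_local_solution hc hΦ
  have hα' : ∀ t ∈ Ioo (T - ε) (T + ε), HasDerivAt α (Φ (c t, α t)) t := fun t ht =>
    (hα t (Ioo_subset_Icc_self ht)).hasDerivAt (Icc_mem_nhds ht.1 ht.2)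
  set W : ℝ → E := fun t => if t < T then w t else α t with hW
  have hlt : ∀ t < T, W t = w t := fun t ht => if_pos ht
  have hge : ∀ t ≥ T, W t = α t := fun t ht => if_neg (not_lt.2 ht)
  have hWT : W T = l := (hge T le_rfl).trans hαT
  have hwW : ∀ t ∈ Ioo t₀ T, HasDerivAt W (Φ (c t, W t)) t := by
    intro t ht
    rw [hlt t ht.2]
    refine ((hw t (Ioo_subset_Ico_self ht)).hasDerivAt (Ico_mem_nhds ht.1 ht.2)).congr_of_eventuallyEq ?_
    filter_upwards [Iio_mem_nhds ht.2] with τ hτ using hlt τ hτ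
  have hlW : Tendsto W (𝓝[<] T) (𝓝 l) := hl.congr' (by
    filter_upwards [self_mem_nhdsWithin] with t ht using (hlt t ht).symm)
  refine ⟨ε, hε, W, hlt, hWT, fun t ht => ?_⟩
  rcases lt_trichotomy t T with h | h | h
  · have h1 : HasDerivWithinAt W (Φ (c t, W t)) (Ico t₀ T) t := by
      rw [hlt t h]
      exact (hw t ⟨ht.1, h⟩).congr (fun τ hτ => hlt τ hτ.2) (hlt t h)
    refine h1.mono_of_mem_nhdsWithin ?_
    filter_upwards [self_mem_nhdsWithin, mem_nhdsWithin_of_mem_nhds (Iio_mem_nhds h)]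
      with τ hτ hτ' using ⟨hτ.1, hτ'⟩
  · subst h
    -- At the junction the left derivative is the limit of the derivatives from the left, which
    -- exists because the vector field is continuous at the limit point. It agrees with the right
    -- derivative supplied by the local solution.
    have hleft : HasDerivWithinAt W (Φ (c t, l)) (Iic t) t := by
      refine hasDerivWithinAt_Iic_of_tendsto_deriv (s := Ioo t₀ t)
        (fun τ hτ => (hwW τ hτ).differentiableAt.differentiableWithinAt) ?_
        (Ioo_mem_nhdsLT hT) ?_
      · rw [ContinuousWithinAt, hWT]
        exact hlW.mono_left (nhdsWithin_mono _ fun τ hτ => hτ.2)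
      · have h1 : Tendsto (fun τ => Φ (c τ, W τ)) (𝓝[<] t) (𝓝 (Φ (c t, l))) :=
          hΦ.continuousAt.tendsto.comp
            (((hc.tendsto t).mono_left nhdsWithin_le_nhds).prodMk_nhds hlW)
        refine h1.congr' ?_
        filter_upwards [Ioo_mem_nhdsLT hT] with τ hτ using (hwW τ hτ).deriv.symm
    have hright : HasDerivWithinAt W (Φ (c t, l)) (Ici t) t := by
      have h1 := (hα' t ⟨by linarith, by linarith⟩).hasDerivWithinAt (s := Ici t)
      rw [hαT] at h1
      exact h1.congr (fun τ hτ => hge τ hτ) (hge t le_rfl)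
    have h2 := hleft.union hright
    rw [Iic_union_Ici, hasDerivWithinAt_univ] at h2
    rw [hWT]
    exact h2.hasDerivWithinAt
  · rw [hge t h.le]
    refine ((hα' t ⟨by linarith, ht.2⟩).congr_of_eventuallyEq ?_).hasDerivWithinAt
    filter_upwards [Ioi_mem_nhds h] with τ hτ using hge τ (le_of_lt hτ)

end Continuation

theorem timeInterval_coe (t₀ T : ℝ) : timeInterval t₀ (T : EReal) = Set.Ico t₀ T := by
  ext t
  simp [timeInterval]

/-! ### Forward completeness -/

namespace Setting

open Filter Set Topology

set_option linter.unusedSectionVars false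
variable {D : Design} {Vx Vy Vmax : ℝ} {urd : ℝ → ℝ} {t₀ Xmax Ymin κmax κmax' Mq σ cr : ℝ}
  (S : Setting D Vx Vy Vmax urd t₀ Xmax Ymin κmax κmax' Mq σ cr)
include S

theorem exists_field_bound {T : EReal} {z : ℝ → State}
    (hz : InTube D Vx Vy Vmax urd σ cr t₀ T z) :
    ∃ B, ∀ t ∈ timeInterval t₀ T, ‖field D Vx Vy (jet urd t, (z t).vec)‖ ≤ B := by
  have c : ∀ a : ℝ, TubeBounded D Vx Vy Vmax urd σ cr t₀ (fun _ _ => a) := BoundedAlong.const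
  have hs : TubeBounded D Vx Vy Vmax urd σ cr t₀ (fun _ z => Real.sin z.ψ) := .sin _
  have hc : TubeBounded D Vx Vy Vmax urd σ cr t₀ (fun _ z => Real.cos z.ψ) := .cos _
  have hx := (S.bdd_u.mul hc).sub (S.bdd_v.mul hs)
  have hy := (S.bdd_u.mul hs).add (S.bdd_v.mul hc)
  have key : ∀ j, TubeBounded D Vx Vy Vmax urd σ cr t₀
      (fun t z => field D Vx Vy (jet urd t, z.vec) j) := by
    intro j
    fin_cases j
    · exact hx.add (c Vx)
    · exact hy.add (c Vy)
    · exact S.bdd_r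
    · exact S.bdd_uRate
    · exact S.bdd_vRate
    · exact S.bdd_Fr.add S.bdd_tauR
    · exact (hx.add S.bdd_Vxh).add ((c _).mul S.bdd_ex)
    · exact (hy.add S.bdd_Vyh).add ((c _).mul S.bdd_ey)
    · exact (c _).mul S.bdd_ex
    · exact (c _).mul S.bdd_ey
    · exact S.bdd_thetaRate
  have hv0 := abs_nonneg (z t₀).v
  have he0 := (z t₀).errNorm_nonneg D (urd t₀) (deriv urd t₀) Vx Vy
  -- The radius is adapted to the initial data of the given solution; the summand `1` makes it
  -- positive.
  choose B hB using fun j =>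
    key j (|(z t₀).v| + (z t₀).errNorm D (urd t₀) (deriv urd t₀) Vx Vy + 1) (by positivity)
  refine ⟨∑ j, |B j|, fun t ht => (pi_norm_le_iff_of_nonneg (by positivity)).2 fun j => ?_⟩
  refine (hB j T z hz (by linarith) (by linarith) t ht).trans ((le_abs_self _).trans ?_)
  exact Finset.single_le_sum (f := fun j => |B j|) (fun j _ => abs_nonneg _) (Finset.mem_univ j)

/-- A solution in the tube does not cease to exist in finite time. -/
theorem forward_complete (T : ℝ) (z : ℝ → State) (hz : InTube D Vx Vy Vmax urd σ cr t₀ T z) :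
    ∃ T' : ℝ, T < T' ∧ ∃ z' : ℝ → State, IsSolution D Vx Vy urd t₀ T' z' ∧
      ∀ t ∈ timeInterval t₀ T, z' t = z t := by
  have hT : t₀ < T := EReal.coe_lt_coe_iff.1 hz.sol.lt
  have hI := timeInterval_coe t₀ T
  obtain ⟨B, hB⟩ := S.exists_field_bound hz
  have hder := fun t ht => hz.sol.hasDeriv_vec (t := t) ht
  rw [hI] at hB hder
  obtain ⟨l, hl⟩ := exists_tendsto_of_deriv_bounded hT hder hB
  have hjet := continuous_jet S.hurd
  have hlim : Tendsto (fun t => (jet urd t, (z t).vec)) (𝓝[<] T) (𝓝 (jet urd T, l)) :=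
    ((hjet.tendsto T).mono_left nhdsWithin_le_nhds).prodMk_nhds hl
  have hev : ∀ᶠ t in 𝓝[<] T, t ∈ timeInterval t₀ T := by
    rw [hI]; exact Ico_mem_nhdsLT hT
  -- Regularity is an open condition and might be lost in the limit. The bounds with `δ`, `σ` and
  -- `cr` are non-strict and uniform, hence pass to the limit and imply it.
  have hreg : Regular D.k.Δ (State.ofVec l).v (urd T) ((State.ofVec l).VN D) := by
    obtain ⟨δ, hδ, hδ1, hgap⟩ := S.exists_gap
    have h1 : |(State.ofVec l).VN D| ≤ δ * urd T := by
      have h2 := ((contDiff_VN D).continuous.tendsto (jet urd T, l)).comp hlim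
      refine le_of_tendsto_of_tendsto h2.abs
        (((S.hurd.continuous.tendsto T).mono_left nhdsWithin_le_nhds).const_mul δ) ?_
      filter_upwards [hev] with t ht using hgap T z hz t ht
    have hq := S.q_pos hT.le
    have h3 : |(State.ofVec l).VN D| < urd T := h1.trans_lt (by nlinarith)
    have h4 : (State.ofVec l).VN D ^ 2 < urd T ^ 2 :=
      sq_lt_sq' (by linarith [(abs_lt.1 h3).1]) (abs_lt.1 h3).2
    exact ⟨D.k.Δ_pos, hq, by nlinarith [sq_nonneg (State.ofVec l).v]⟩
  have hcont₁ : Continuous fun p : (ℝ × ℝ × ℝ) × (Fin 11 → ℝ) =>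
      1 - D.P.κ (State.ofVec p.2).θ * (State.ofVec p.2).ybp D :=
    continuous_const.sub ((contDiff_curvature D).continuous.mul (contDiff_ybp D).continuous)
  have hcurv : 1 - D.P.κ (State.ofVec l).θ * (State.ofVec l).ybp D ≠ 0 := by
    refine (S.hσ.trans_le (ge_of_tendsto ((hcont₁.tendsto (jet urd T, l)).comp hlim) ?_)).ne'
    filter_upwards [hev] with t ht using hz.tube t ht
  have hcont₂ := (contDiffAt_CrVal (p₀ := (jet urd T, l)) hreg).continuousAt
  have hCr : (State.ofVec l).CrVal D (urd T) ≠ 0 := by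
    refine abs_pos.1 (S.hcr.trans_le (ge_of_tendsto (hcont₂.tendsto.comp hlim).abs ?_))
    filter_upwards [hev] with t ht using hz.Cr_away t ht
  obtain ⟨ε, hε, W, hWlt, hWT, hW⟩ := exists_continuation hT hjet
    (contDiffAt_field Vx Vy (p₀ := (jet urd T, l)) hreg hcurv hCr) hder hl
  have hWc : ContinuousAt W T := by
    have h1 := (hW T ⟨hT.le, by linarith⟩).continuousWithinAt
    exact h1.continuousAt (Ico_mem_nhds hT (by linarith))
  have hpair : Tendsto (fun t => (jet urd t, W t)) (𝓝 T) (𝓝 (jet urd T, l)) := by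
    refine (hjet.tendsto T).prodMk_nhds ?_
    rw [← hWT]
    exact hWc
  -- Beyond `T` the solution may leave the tube; continuity keeps both denominators nonzero for a
  -- short time.
  have hne : ∀ᶠ t in 𝓝 T, 1 - D.P.κ (State.ofVec (W t)).θ * (State.ofVec (W t)).ybp D ≠ 0
      ∧ (State.ofVec (W t)).CrVal D (urd t) ≠ 0 :=
    (((hcont₁.tendsto (jet urd T, l)).comp hpair).eventually_ne hcurv).and
      ((hcont₂.tendsto.comp hpair).eventually_ne hCr)
  obtain ⟨ε', hε', hball⟩ := Metric.eventually_nhds_iff.1 hne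
  set η := min ε ε' with hη
  have hη0 : 0 < η := by positivity
  have hnew : ∀ t ∈ timeInterval t₀ ((T + η : ℝ) : EReal),
      1 - D.P.κ (State.ofVec (W t)).θ * (State.ofVec (W t)).ybp D ≠ 0
      ∧ (State.ofVec (W t)).CrVal D (urd t) ≠ 0 := by
    intro t ht
    rw [timeInterval_coe] at ht
    rcases lt_or_ge t T with h | h
    · rw [hWlt t h]
      have ht' : t ∈ timeInterval t₀ (T : EReal) := by rw [hI]; exact ⟨ht.1, h⟩
      exact ⟨hz.sol.curv_ne t ht', hz.sol.Cr_ne t ht'⟩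
    · refine hball ?_
      rw [Real.dist_eq, abs_lt]
      constructor <;> linarith [ht.2, min_le_right ε ε']
  refine ⟨T + η, by linarith, fun t => State.ofVec (W t), isSolution_of_hasDeriv_vec
    (EReal.coe_lt_coe_iff.2 (by linarith)) (fun t ht => (hnew t ht).1) (fun t ht => (hnew t ht).2)
    (fun t ht => ?_), fun t ht => ?_⟩
  · simp only [State.vec_ofVec]
    rw [timeInterval_coe] at ht ⊢
    have hsub : Ico t₀ (T + η) ⊆ Ico t₀ (T + ε) :=
      Ico_subset_Ico_right (by linarith [min_le_left ε ε'])
    exact (hW t (hsub ht)).mono hsub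
  · rw [hI] at ht
    change State.ofVec (W t) = z t
    rw [hWlt t ht.2, State.ofVec_vec]

end Setting

/-! ### From the exponential estimate to the stability notions -/

theorem ExponentiallyStable.stableOrigin {F : EReal → (ℝ → State) → Prop}
    {err : ℝ → State → ℝ} {t₀ : ℝ} (h : ExponentiallyStable F err t₀)
    (h0 : ∀ t z, 0 ≤ err t z) : StableOrigin F err t₀ := fun R hR ε hε => by
  obtain ⟨C, hC, c, hc, h⟩ := h R hR 1 one_pos
  -- The `1` keeps the initial error within the radius for which `C` was obtained.
  refine ⟨min 1 (ε / C), by positivity, fun T z hz hv he t ht => ?_⟩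
  have h2 : Real.exp (-c * (t - t₀)) ≤ 1 := Real.exp_le_one_iff.2
    (mul_nonpos_of_nonpos_of_nonneg (neg_nonpos.2 hc.le) (sub_nonneg.2 ht.1))
  have h3 : err t₀ (z t₀) < ε / C := he.trans_le (min_le_right _ _)
  have h4 := h0 t₀ (z t₀)
  calc err t (z t) ≤ C * err t₀ (z t₀) * Real.exp (-c * (t - t₀)) :=
        h T z hz hv (he.le.trans (min_le_left _ _)) t ht
    _ ≤ C * err t₀ (z t₀) * 1 := by gcongr
    _ = C * err t₀ (z t₀) := mul_one _
    _ < C * (ε / C) := by gcongr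
    _ = ε := by field_simp

theorem State.sqrt_xbp_sq_add_ybp_sq_le (D : Design) (q q' Vx Vy : ℝ) (z : State) :
    √(z.xbp D ^ 2 + z.ybp D ^ 2) ≤ z.errNorm D q q' Vx Vy := by
  refine Real.sqrt_le_sqrt ?_
  have h3 := sq_nonneg (z.ePsi D q)
  have h4 := sq_nonneg (z.eR D q q')
  have h5 := sq_nonneg (z.u - q)
  have h6 := sq_nonneg z.ex
  have h7 := sq_nonneg z.ey
  have h8 := sq_nonneg (Vx - z.Vxh)
  have h9 := sq_nonneg (Vy - z.Vyh)
  linarith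

namespace Setting

variable {D : Design} {Vx Vy Vmax : ℝ} {urd : ℝ → ℝ} {t₀ Xmax Ymin κmax κmax' Mq σ cr : ℝ}
  (S : Setting D Vx Vy Vmax urd t₀ Xmax Ymin κmax κmax' Mq σ cr)
include S

theorem exponentiallyStable : ExponentiallyStable (InTube D Vx Vy Vmax urd σ cr t₀)
    (fun t z => z.errNorm D (urd t) (deriv urd t) Vx Vy) t₀ := fun R hR ρ _ => by
  obtain ⟨C, hC, c, hc, h⟩ := S.exp_estimate (max R ρ) (lt_max_of_lt_left hR)
  exact ⟨C, hC, c, hc, fun T z hz hv he => h T z hz (hv.trans (le_max_left _ _))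
    (he.trans (le_max_right _ _))⟩

theorem attractiveOrigin : AttractiveOrigin (InTube D Vx Vy Vmax urd σ cr t₀)
    (fun t z => z.errNorm D (urd t) (deriv urd t) Vx Vy) := fun z hz => by
  have hv0 := abs_nonneg (z t₀).v
  have he0 := (z t₀).errNorm_nonneg D (urd t₀) (deriv urd t₀) Vx Vy
  set E := (z t₀).errNorm D (urd t₀) (deriv urd t₀) Vx Vy with hE
  -- Attraction concerns one solution at a time, so the radius may depend on its initial data.
  obtain ⟨C, hC, c, hc, h⟩ := S.exp_estimate (|(z t₀).v| + E + 1) (by positivity)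
  have hlim : Filter.Tendsto (fun t => C * E * Real.exp (-c * (t - t₀))) Filter.atTop
      (nhds (C * E * 0)) := by
    refine (Real.tendsto_exp_atBot.comp ?_).const_mul _
    exact (Filter.tendsto_atTop_add_const_right _ (-t₀) Filter.tendsto_id).const_mul_atTop_of_neg
      (neg_lt_zero.2 hc)
  rw [mul_zero] at hlim
  refine tendsto_of_tendsto_of_tendsto_of_le_of_le' tendsto_const_nhds hlim
    (.of_forall fun t => State.errNorm_nonneg _ _ _ _ _ _) ?_
  filter_upwards [Filter.eventually_ge_atTop t₀] with t ht
  exact h ⊤ z hz (by linarith) (by linarith) t ⟨ht, EReal.coe_lt_top t⟩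

end Setting

end PathFollowing

end

theorem mainTheorem1
    (D : Design) (Vx Vy Vmax : ℝ) (urd : ℝ → ℝ) (t₀ : ℝ)
    (Xmax Ymin κmax σ cr : ℝ)
    -- constant ocean current of size at most `Vmax`
    (hVmax : 0 < Vmax) (hV : √(Vx ^ 2 + Vy ^ 2) ≤ Vmax)
    -- desired surge velocity
    (hurd : ContDiff ℝ 2 urd)
    (hurd_bdd : ∃ M, ∀ t ≥ t₀,
      |urd t| ≤ M ∧ |deriv urd t| ≤ M ∧ |deriv (deriv urd) t| ≤ M)
    (hurd_gt : ∀ t ≥ t₀, 2 * Vmax < urd t)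
    -- sway coefficients in the range of desired velocities
    (hYmin : 0 < Ymin)
    (hY : ∀ t ≥ t₀, ∀ u ∈ Set.Icc (-Vmax) (urd t), D.w.Y u ≤ -Ymin)
    (hXmax : 0 < Xmax) (hX : ∀ t ≥ t₀, |D.w.X (urd t)| ≤ Xmax)
    -- curvature of the path
    (hκ : ∀ θ, |D.P.κ θ| ≤ κmax)
    (hκ' : ∃ M, ∀ θ, |deriv D.P.κ θ| ≤ M)
    (hκ_lt : κmax < Ymin / Xmax)
    -- tube and look-ahead distance
    (hσ : 0 < σ) (hσ_pos : 0 < Ymin - Xmax * κmax * (1 / σ))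
    (hκ_lt' : κmax < σ * (Ymin / Xmax))
    (hΔ : 4 * Xmax / (Ymin - Xmax * κmax * (1 / σ)) < D.k.Δ)
    -- lower bound for `|C_r|`
    (hcr : 0 < cr) :
    let F : EReal → (ℝ → State) → Prop := InTube D Vx Vy Vmax urd σ cr t₀
    let err : ℝ → State → ℝ := fun t z => z.errNorm D (urd t) (deriv urd t) Vx Vy
    -- forward completeness: a solution in the tube does not cease to exist in finite time
    (∀ (T : ℝ) (z : ℝ → State), F T z →
      ∃ T' : ℝ, T < T' ∧ ∃ z' : ℝ → State, IsSolution D Vx Vy urd t₀ T' z' ∧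
        ∀ t ∈ timeInterval t₀ T, z' t = z t) ∧
    -- the vessel follows the path
    (∀ z : ℝ → State, F ⊤ z →
      Filter.Tendsto
        (fun t => √(((z t).x - D.P.xP (z t).θ) ^ 2 + ((z t).y - D.P.yP (z t).θ) ^ 2))
        Filter.atTop (nhds 0)) ∧
    -- sway velocity and control inputs stay bounded
    BoundedAlong F err t₀ (fun _ z => z.v) ∧
    BoundedAlong F err t₀ (fun t z => z.tauR D (urd t) (deriv urd t) (deriv (deriv urd) t)) ∧
    BoundedAlong F err t₀ (fun t z => z.tauU D (urd t) (deriv urd t)) ∧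
    -- stability of the origin of the error system
    GloballyAsymptoticallyStable F err t₀ ∧
    LocallyExponentiallyStable F err t₀ ∧
    ExponentiallyStable F err t₀ := by
  obtain ⟨Mq, hMq⟩ := hurd_bdd
  obtain ⟨κmax', hκmax'⟩ := hκ'
  have S : Setting D Vx Vy Vmax urd t₀ Xmax Ymin κmax κmax' Mq σ cr :=
    ⟨hVmax, hV, hurd, hMq, hurd_gt, hY, hXmax, hX, hκ, hκmax', hσ, hσ_pos, hΔ, hcr⟩
  intro F err
  have hexp : ExponentiallyStable F err t₀ := S.exponentiallyStable
  have hattr : AttractiveOrigin F err := S.attractiveOrigin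
  refine ⟨S.forward_complete, fun z hz => ?_, S.bdd_v, S.bdd_tauR, S.bdd_tauU,
    ⟨hexp.stableOrigin fun t z => State.errNorm_nonneg _ _ _ _ _ _, hattr⟩,
    fun R hR => ⟨1, one_pos, hexp R hR 1 one_pos⟩, hexp⟩
  -- The distance to the path point is the norm of the tangential and normal errors, because the
  -- path frame is a rotation.
  refine squeeze_zero (fun t => Real.sqrt_nonneg _) (fun t => ?_) (hattr z hz)
  rw [← State.xbp_sq_add_ybp_sq]
  exact (z t).sqrt_xbp_sq_add_ybp_sq_le D (urd t) (deriv urd t) Vx Vy
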